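/- Let $d\ge 2$ and let $\Omega\subset\mathbb R^d$ be a bounded open set with $C^1$ boundary (near each boundary point, in suitable Cartesian coordinates, $\Omega$ is the region above the graph of a $C^1$ function). For $m\ge 0$ and open $U\subset\mathbb R^d$ let $A_m^U=(\sqrt{-\Delta+m^2}-m)_D$ be the self-adjoint operator defined by the quadratic form $q_m(u)=\int_{\mathbb R^d}\big(\sqrt{|2\pi\xi|^2+m^2}-m\big)|\hat u(\xi)|^2\,d\xi$ with form domain $H_0^{1/2}(U)$, the closure of $C_c^\infty(U)$ in $H^{1/2}(\mathbb R^d)$. For $h>0$, $\mu\ge 0$ let $H_{\mu,h}^U=hA_{\mu/h}^U-1$ and $H^+_{\mu,h}=H^{\mathbb R^d_+}_{\mu,h}$, where $\mathbb R^d_+=\{x=(x',x_d)\in\mathbb R^{d-1}\times\mathbb R:\ x_d>0\}$. For real $\phi\in C_0^1(\mathbb R^d)$, $\phi H^U_{\mu,h}\phi$ denotes the self-adjoint operator of the form $v\mapsto h\,q_{\mu/h}(\phi v)-\|\phi v\|^2$ on $\{v\in L^2(\mathbb R^d):\phi v\in H_0^{1/2}(U)\}$, and $T_-$ is the negative part of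 $T$. A modulus is a non-decreasing $w:[0,\infty)\to[0,\infty)$ with $w(t)\to0$ as $t\to0^+$. For an open ball $B_l$ of radius $l>0$ and $p\in B_l\cap\partial\Omega$, a boundary chart with modulus $w$ consists of Cartesian coordinates $x=(x',x_d)$ centred at $p$ and a differentiable function $g:D_l\to\mathbb R$ on the projection $D_l\subset\mathbb R^{d-1}$ of $B_l$, with $g(0)=0$, $\nabla g(0)=0$ (so that $(0,1)$ is the inward unit normal at $p$), $|\nabla g(x')-\nabla g(y')|\le w(|x'-y'|)$ for all $x',y'\in D_l$, and, for all $x\in B_l$: $x\in\partial\Omega$ if and only if $x_d=g(x')$, and $x\in\Omega$ if and only if $x_d>g(x')$. Put $\tau(x',x_d)=(x',x_d-g(x'))$ on $D_l\times\mathbb R$; for a function $\phi$, written in these coordinates, let $\phi'$ be the extension of $\phi\circ\tau^{-1}$ by zero to $\mathbb R^d$. (i) There are a modulus $w$ and $c>0$ such that for every open ball $B_l$ of radius $0<l\le c$ and every $p\in B_l\cap\partial\Omega$ there is a boundary chart with modulus $w$. (ii) For every modulus $w$ there are constants $c,C>0$ such that for every open ball $B_l$ of radius $0<l\le c$, every $p\in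 B_l\cap\partial\Omega$, every boundary chart for $B_l$ and $p$ with modulus $w$, and every real-valued $\phi\in C_0^1(\mathbb R^d)$ with support in $B_l$ and $|\phi|\le M$, the following hold: $\phi'\in C_0^1(\mathbb R^d)$; for all $\mu\ge0$ and $h>0$ the negative parts $(\phi H^\Omega_{\mu,h}\phi)_-$ and $(\phi'H^+_{\mu,h}\phi')_-$ are bounded and trace class, and $$\big|\operatorname{Tr}(\phi H^\Omega_{\mu,h}\phi)_- - \operatorname{Tr}(\phi'H^+_{\mu,h}\phi')_-\big|\le C\,M^2\,w(l)\,l^d(1+\mu)^{d/2}h^{-d};$$ $$\int_\Omega\phi(x)^2\,dx=\int_{\mathbb R^d_+}\phi'(x)^2\,dx;$$ and $\phi^2$ is integrable over $\partial\Omega$ with respect to the surface measure $\sigma$, with $$0\le\int_{\partial\Omega}\phi(x)^2\,d\sigma(x)-\int_{\mathbb R^{d-1}}\phi'(x',0)^2\,dx'\le C\,M^2\,w(l)^2\,l^{d-1}.$$ -/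

import Mathlib

open MeasureTheory Filter Topology
open scoped FourierTransform ContDiff ENNReal

namespace PseudoRelativistic

noncomputable section

/-- `ℝ^d` with the Euclidean norm. -/
abbrev E (d : ℕ) : Type := EuclideanSpace ℝ (Fin d)

/-- The complex Hilbert space `L²(ℝ^d)`. -/
abbrev L2 (d : ℕ) : Type := Lp ℂ 2 (volume : Measure (E d))

/-! ### The quadratic form of `√(-Δ + m²) - m` with Dirichlet condition -/

/-- `ψ_m(t) = √(t + m²) - m`. -/
def psi (m t : ℝ) : ℝ := √(t + m ^ 2) - m

/-- The sesquilinear version of `q_m(u) = ∫ ψ_m(|2πξ|²) |û(ξ)|² dξ`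
(antilinear in the first argument). -/
def quadForm {d : ℕ} (m : ℝ) (u v : L2 d) : ℂ :=
  ∫ ξ : E d, (psi m (‖(2 * Real.pi) • ξ‖ ^ 2) : ℂ) *
    inner ℂ ((𝓕 u : L2 d) ξ) ((𝓕 v : L2 d) ξ)

/-- The squared `H^{1/2}(ℝ^d)` norm, `∫ (1 + |ξ|²)^{1/2} |û(ξ)|² dξ ∈ [0, ∞]`. -/
def sobolevHalfSq {d : ℕ} (u : L2 d) : ℝ≥0∞ :=
  ∫⁻ ξ : E d, ENNReal.ofReal (√(1 + ‖ξ‖ ^ 2)) * ‖(𝓕 u : L2 d) ξ‖ₑ ^ 2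

/-- `u ∈ H_0^{1/2}(Ω)`: `u` belongs to the closure of `C_c^∞(Ω)` in `H^{1/2}(ℝ^d)`. -/
def MemH0Half {d : ℕ} (Ω : Set (E d)) (u : L2 d) : Prop :=
  ∀ ε : ℝ≥0∞, 0 < ε → ∃ (η : E d → ℂ) (hη : MemLp η 2 (volume : Measure (E d))),
    ContDiff ℝ ∞ η ∧ HasCompactSupport η ∧ tsupport η ⊆ Ω ∧ sobolevHalfSq (u - hη.toLp η) < ε

/-- Multiplication by a real function on `L²(ℝ^d)`; the second branch is never used for
`φ ∈ C_0^1(ℝ^d)`, see `mulL2_ae`. -/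
def mulL2 {d : ℕ} (φ : E d → ℝ) (v : L2 d) : L2 d :=
  open Classical in
  if h : MemLp (fun x => (φ x : ℂ) * v x) 2 (volume : Measure (E d)) then h.toLp _ else 0

theorem mulL2_ae {d : ℕ} (φ : E d → ℝ) (hφ : Continuous φ) (hs : HasCompactSupport φ)
    (v : L2 d) : ∀ᵐ x : E d, mulL2 φ v x = (φ x : ℂ) * v x := by
  obtain ⟨C, hC⟩ := hs.exists_bound_of_continuous hφ
  have h : MemLp (fun x => (φ x : ℂ) * v x) 2 (volume : Measure (E d)) := by
    refine MemLp.of_le_mul (c := C) (Lp.memLp v) ?_ ?_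
    · exact ((Complex.continuous_ofReal.comp hφ).aestronglyMeasurable).mul
        (Lp.aestronglyMeasurable v)
    · filter_upwards with x
      rw [norm_mul, Complex.norm_real]
      exact mul_le_mul_of_nonneg_right (hC x) (norm_nonneg _)
  rw [mulL2, dif_pos h]
  exact h.coeFn_toLp

/-- The form domain of `φ H φ`, where `H = H_{μ,h}^Ω`. -/
def localDomain {d : ℕ} (Ω : Set (E d)) (φ : E d → ℝ) : Set (L2 d) :=
  {v | MemH0Half Ω (mulL2 φ v)}

/-- The form of `φ H_{μ,h}^Ω φ` with `H_{μ,h}^Ω = h A_{μ/h}^Ω - 1`, that is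
`(v, w) ↦ h q_{μ/h}(φ v, φ w) - ⟪φ v, φ w⟫` on `localDomain Ω φ`. -/
def localForm {d : ℕ} (μ h : ℝ) (φ : E d → ℝ) (v w : L2 d) : ℂ :=
  (h : ℂ) * quadForm (μ / h) (mulL2 φ v) (mulL2 φ w) - inner ℂ (mulL2 φ v) (mulL2 φ w)

/-- The form of `φ H φ` is Hermitian (so that its negative part is unique). -/
theorem localForm_conj {d : ℕ} (μ h : ℝ) (φ : E d → ℝ) (v w : L2 d) :
    localForm μ h φ v w = starRingEnd ℂ (localForm μ h φ w v) := by
  simp only [localForm, quadForm, map_sub, map_mul, Complex.conj_ofReal, inner_conj_symm,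
    ← integral_conj]

/-! ### Negative parts and traces -/

section Operators

variable {H : Type} [NormedAddCommGroup H] [InnerProductSpace ℂ H] [CompleteSpace H]

/-- `T v = f` for the self-adjoint operator `T` associated with the form `a` on `D`.
(`T` acts in the closure of `D`; where `D` is not dense, `T = +∞` on the orthogonal complement.) -/
def FormOperator (D : Set H) (a : H → H → ℂ) (v f : H) : Prop :=
  v ∈ D ∧ ∀ w ∈ D, a w v = inner ℂ w f

/-- `N` is the negative part `T_-` of the self-adjoint operator `T` associated with the form `a`
on `D`, when this is a bounded operator: `N ≥ 0`, `T + N ≥ 0` and `(T + N) N = 0`, so that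
`T = (T + N) - N` is the decomposition of `T` into positive and negative part. -/
structure IsNegPart (D : Set H) (a : H → H → ℂ) (N : H →L[ℂ] H) : Prop where
  isPositive : N.IsPositive
  add_nonneg : ∀ v ∈ D, 0 ≤ (a v v).re + (inner ℂ v (N v)).re
  add_mul_eq_zero : ∀ f, FormOperator D a (N f) (-(N (N f)))

/-- `N` is trace class with trace `t` (for `N ≥ 0`): the diagonal sums converge to `t` in every
Hilbert basis. -/
def HasTrace (N : H →L[ℂ] H) (t : ℝ) : Prop :=
  ∀ (ι : Type) (b : HilbertBasis ι ℂ H), HasSum (fun i => inner ℂ (b i) (N (b i))) (t : ℂ)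

end Operators

/-- The negative part is determined by the form. -/
theorem IsNegPart.unique {H : Type} [NormedAddCommGroup H] [InnerProductSpace ℂ H]
    [CompleteSpace H] {D : Set H} {a : H → H → ℂ} {M N : H →L[ℂ] H}
    (ha : ∀ v ∈ D, ∀ w ∈ D, a v w = starRingEnd ℂ (a w v))
    (hM : IsNegPart D a M) (hN : IsNegPart D a N) : M = N := by
  have sM : ∀ x y, inner ℂ (M x) y = inner ℂ x (M y) := hM.isPositive.1
  have sN : ∀ x y, inner ℂ (N x) y = inner ℂ x (N y) := hN.isPositive.1
  have key : M * N * N = M * M * N := by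
    ext f
    refine ext_inner_left ℂ fun g => ?_
    have h1 := (hN.add_mul_eq_zero f).2 (M g) (hM.add_mul_eq_zero g).1
    have h2 := (hM.add_mul_eq_zero g).2 (N f) (hN.add_mul_eq_zero f).1
    have h3 := ha (M g) (hM.add_mul_eq_zero g).1 (N f) (hN.add_mul_eq_zero f).1
    rw [h1, h2, inner_conj_symm, inner_neg_left, inner_neg_right, neg_inj] at h3
    simpa [sM] using h3
  have key2 : N * N * M = N * M * M := by
    have := congrArg star key
    have aM : star M = M := hM.isPositive.isSelfAdjoint
    have aN : star N = N := hN.isPositive.isSelfAdjoint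
    simpa [star_mul, aM, aN, mul_assoc] using this
  have pos : ∀ {A B : H →L[ℂ] H}, IsNegPart D a A → IsNegPart D a B →
      0 ≤ A * (B - A) * A := by
    intro A B hA hB
    have aA : star A = A := hA.isPositive.isSelfAdjoint
    have aB : star B = B := hB.isPositive.isSelfAdjoint
    have sA : ∀ x y, inner ℂ (A x) y = inner ℂ x (A y) := hA.isPositive.1
    rw [ContinuousLinearMap.nonneg_iff_isPositive]
    have hs : IsSelfAdjoint (A * (B - A) * A) := by
      simp [IsSelfAdjoint, star_mul, aA, aB, mul_assoc]
    refine ⟨hs.isSymmetric, fun f => ?_⟩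
    have h1 := hB.add_nonneg (A f) (hA.add_mul_eq_zero f).1
    rw [(hA.add_mul_eq_zero f).2 (A f) (hA.add_mul_eq_zero f).1] at h1
    rw [ContinuousLinearMap.reApplyInnerSelf_apply, ← inner_conj_symm, RCLike.conj_re]
    change 0 ≤ (inner ℂ f (A ((B - A) (A f)))).re
    rw [← sA, _root_.sub_apply, inner_sub_right, Complex.sub_re]
    rw [inner_neg_right, Complex.neg_re] at h1
    linarith
  have p1 := pos hM hN
  have p2 := pos hN hM
  have aM : star M = M := hM.isPositive.isSelfAdjoint
  have aN : star N = N := hN.isPositive.isSelfAdjoint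
  have nM : 0 ≤ M := (ContinuousLinearMap.nonneg_iff_isPositive M).2 hM.isPositive
  have nN : 0 ≤ N := (ContinuousLinearMap.nonneg_iff_isPositive N).2 hN.isPositive
  obtain ⟨X, hX⟩ : ∃ X, X = M - N := ⟨_, rfl⟩
  have aX : star X = X := by rw [hX, star_sub, aM, aN]
  have nX : 0 ≤ X * X := by simpa [aX] using star_mul_self_nonneg X
  have e1 : M * (X * X) = M * X * M := by
    have : M * X * N = 0 := by rw [hX, mul_sub, sub_mul, key, sub_self]
    calc M * (X * X) = M * X * M - M * X * N := by rw [← mul_sub, ← hX, mul_assoc]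
      _ = _ := by rw [this, sub_zero]
  have e2 : N * (X * X) = -(N * X * N) := by
    have : N * X * M = 0 := by rw [hX, mul_sub, sub_mul, key2, sub_self]
    calc N * (X * X) = N * X * M - N * X * N := by rw [← mul_sub, ← hX, mul_assoc]
      _ = _ := by rw [this, zero_sub]
  have c1 : Commute M (X * X) := by
    have := congrArg star e1
    simp only [star_mul, aM, aX] at this
    exact e1.trans (by rw [mul_assoc]; exact this.symm)
  have c2 : Commute N (X * X) := by
    have := congrArg star e2
    simp only [star_mul, star_neg, aN, aX] at this
    exact e2.trans (by rw [mul_assoc]; exact this.symm)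
  have z1 : M * (X * X) = 0 := by
    refine le_antisymm ?_ (c1.mul_nonneg nM nX)
    have : M * (N - M) * M = -(M * X * M) := by rw [hX]; noncomm_ring
    rw [e1]
    rw [this] at p1
    exact neg_nonneg.1 p1
  have z2 : N * (X * X) = 0 := by
    refine le_antisymm ?_ (c2.mul_nonneg nN nX)
    rw [← hX] at p2
    rw [e2]
    exact neg_nonpos.2 p2
  have z3 : X * (X * X) = 0 := by
    nth_rewrite 1 [hX]
    rw [sub_mul, z1, z2, sub_self]
  have z4 : X * X = 0 := by
    have : star (X * X) * (X * X) = 0 := by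
      rw [star_mul, aX, mul_assoc, z3, mul_zero]
    exact CStarRing.star_mul_self_eq_zero_iff _ |>.1 this
  have z5 : X = 0 := by
    have : star X * X = 0 := by rw [aX, z4]
    exact CStarRing.star_mul_self_eq_zero_iff _ |>.1 this
  rw [hX] at z5
  exact sub_eq_zero.1 z5

/-! ### Boundary coordinates -/

/-- `x'` for `x = (x', x_d)`. -/
def horiz {n : ℕ} (x : E (n + 1)) : E n := WithLp.toLp 2 (fun i => x i.castSucc)

/-- `x_d` for `x = (x', x_d)`. -/
def vert {n : ℕ} (x : E (n + 1)) : ℝ := x (Fin.last n)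

/-- The point `(x', s)`. -/
def pt {n : ℕ} (x' : E n) (s : ℝ) : E (n + 1) :=
  WithLp.toLp 2 (Fin.snoc (α := fun _ => ℝ) x'.ofLp s)

@[simp] theorem horiz_pt {n : ℕ} (x' : E n) (s : ℝ) : horiz (pt x' s) = x' := by
  ext i; simp [horiz, pt]

@[simp] theorem vert_pt {n : ℕ} (x' : E n) (s : ℝ) : vert (pt x' s) = s := by
  simp [vert, pt]

@[simp] theorem pt_horiz_vert {n : ℕ} (x : E (n + 1)) : pt (horiz x) (vert x) = x := by
  ext i
  refine Fin.lastCases ?_ (fun j => ?_) i <;> simp [horiz, vert, pt]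

/-- The half-space `ℝ^d_+`, `d = n + 1`. -/
def halfSpace (n : ℕ) : Set (E (n + 1)) := {x | 0 < vert x}

/-- `Ω` has `C^1` boundary: near each boundary point, in suitable Cartesian coordinates, `Ω` is the
region above the graph of a `C^1` function. -/
def HasC1Boundary {n : ℕ} (Ω : Set (E (n + 1))) : Prop :=
  ∀ p ∈ frontier Ω, ∃ (κ : E (n + 1) ≃ᵃⁱ[ℝ] E (n + 1)) (γ : E n → ℝ) (r : ℝ),
    ContDiff ℝ 1 γ ∧ 0 < r ∧ ∀ x ∈ Metric.ball p r, (x ∈ Ω ↔ γ (horiz (κ x)) < vert (κ x))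

/-- A (candidate) modulus of continuity: non-negative, non-decreasing, vanishing at `0+`. -/
structure IsModulus (w : ℝ → ℝ) : Prop where
  nonneg : ∀ t, 0 ≤ t → 0 ≤ w t
  mono : MonotoneOn w (Set.Ici 0)
  tendsto_zero : Tendsto w (𝓝[>] 0) (𝓝 0)

/-- `D_l`, the projection of the ball `B_l(z)` to the hyperplane `x_d = 0` of the coordinates
`κ`. -/
def projBall {n : ℕ} (κ : E (n + 1) ≃ᵃⁱ[ℝ] E (n + 1)) (z : E (n + 1)) (l : ℝ) : Set (E n) :=
  (fun x => horiz (κ x)) '' Metric.ball z l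

/-- `κ` are Cartesian coordinates centred at the boundary point `p ∈ B_l(z)` in which `(0, 1)` is
the inward unit normal at `p`; inside `B_l(z)` the boundary of `Ω` is the graph of `g`, and `Ω` lies
above it; the gradient of `g` has modulus of continuity `w` on `D_l`. -/
structure IsBoundaryChart {n : ℕ} (Ω : Set (E (n + 1))) (w : ℝ → ℝ) (z : E (n + 1)) (l : ℝ)
    (p : E (n + 1)) (κ : E (n + 1) ≃ᵃⁱ[ℝ] E (n + 1)) (g : E n → ℝ) : Prop where
  mem_ball : p ∈ Metric.ball z l
  mem_frontier : p ∈ frontier Ω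
  center : κ p = 0
  differentiable : DifferentiableOn ℝ g (projBall κ z l)
  map_zero : g 0 = 0
  fderiv_zero : fderiv ℝ g 0 = 0
  modulus : ∀ x' ∈ projBall κ z l, ∀ y' ∈ projBall κ z l,
    ‖fderiv ℝ g x' - fderiv ℝ g y'‖ ≤ w ‖x' - y'‖
  frontier_iff : ∀ x ∈ Metric.ball z l, (x ∈ frontier Ω ↔ vert (κ x) = g (horiz (κ x)))
  mem_iff : ∀ x ∈ Metric.ball z l, (x ∈ Ω ↔ g (horiz (κ x)) < vert (κ x))

/-- The straightening map `τ(x', x_d) = (x', x_d - g(x'))`. -/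
def tau {n : ℕ} (g : E n → ℝ) : E (n + 1) ≃ E (n + 1) where
  toFun x := pt (horiz x) (vert x - g (horiz x))
  invFun y := pt (horiz y) (vert y + g (horiz y))
  left_inv x := by simp
  right_inv y := by simp

open Classical in
/-- `φ'`: the function `φ` written in the coordinates `κ`, composed with `τ⁻¹` on `D × ℝ` and
extended by zero. -/
def straightened {n : ℕ} (κ : E (n + 1) ≃ᵃⁱ[ℝ] E (n + 1)) (g : E n → ℝ) (D : Set (E n))
    (φ : E (n + 1) → ℝ) (y : E (n + 1)) : ℝ :=
  if horiz y ∈ D then φ (κ.symm ((tau g).symm y)) else 0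

end

end PseudoRelativistic

open PseudoRelativistic

/-!
# Straightening the boundary for `√(-Δ + m²) - m`

**Traces.** The map `T = τ ∘ κ`, with `g` replaced by a globally Lipschitz extension, preserves
volume, and `T` and its inverse are Lipschitz with constant `L = 1 + 2 w(l)`, because
`|∇g| ≤ 2 w(l)` on `D_l`. The quadratic form changes little under such a map. By Plancherel the heat
energy `⟨u, (1 - e^{sΔ}) u⟩` is a multiple of `∫∫ e^{-|x-y|²/4s} |u(x) - u(y)|² dx dy`
(`heatForm_eq`); since the kernel is radially decreasing and `1 - e^{-t}` is concave, `u ↦ u ∘ T`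
increases it at most by the factor `L^{d+2}` (`heatEnergy_comp_le`). As `√(t + m²) - m` is a
superposition of the functions `1 - e^{-st}` with positive weights (`lintegral_subordination`), the
same holds for `q_m`, uniformly in `m` (`energy_comp_le`). Hence, with `ε = 1 - L^{-(d+2)}` and `q'`
the form of the transformed function,
`h q - 1 ≥ (1 - ε) h q' - 1 = (1 - 2ε) (h q' - 1) + ε (h q' - 2)`.
The variational principle for the sum of the negative eigenvalues
(`IsNegPart.exists_hasTrace_of_forall_contraction`) turns this into
`Tr(φHφ)_- ≤ Tr(φ'H⁺φ')_- + ε Tr(φ'(hA - 2)φ')_-`, and the last trace is at most a constant times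
`‖φ‖² (1 + μ)^{d/2} h^{-d}`, by integrating the symbol over the set where it is negative
(`sum_norm_sq_sub_energy_le`). As `ε ≤ 2 (d + 2) w(l)`, exchanging the roles of the two operators
gives the estimate. The form domains correspond to each other because `H_0^{1/2}` is invariant under
bi-Lipschitz maps (`memH0Half_comp`), which rests on the fact that compactly supported Lipschitz
functions belong to it (`memH0Half_of_lipschitz`).

**Existence of the negative part.** The form of `φHφ` is closed on its domain, but the domain need
not be dense. With the domain made into a Hilbert space `X` and `J : X → L²` the inclusion, the
spectral calculus of the bounded operator `J J*` yields the negative part (`exists_isNegPart`).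

**Surface integrals.** The projection of the graph to `ℝ^{d-1}` is `1`-Lipschitz and its inverse is
`√(1 + (2w(l))²)`-Lipschitz. The behaviour of Hausdorff measure under Lipschitz maps gives both
inequalities (`setIntegral_range_graphMap`) without the area formula.

**Charts.** Locally `Ω = {f > 0}` for a `C¹` function `f` with `|∇f| ≥ 1`. After a rotation that makes
`∇f(p)` vertical, the intermediate value theorem and implicit differentiation give `g`, with
constants that depend on the modulus of continuity of `∇f` only (`exists_graph`); compactness of `∂Ω`
makes them uniform (`exists_boundaryCharts`).
-/

namespace PseudoRelativistic

/-! ### Negative parts and their traces -/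

section AbstractOperators

theorem enorm_sq_eq_ofReal {F : Type*} [NormedAddCommGroup F] (a : F) :
    ‖a‖ₑ ^ 2 = ENNReal.ofReal (‖a‖ ^ 2) := by
  rw [ENNReal.ofReal_pow (norm_nonneg _), ofReal_norm]

/-- Parseval's identity in `[0, ∞]`. -/
theorem tsum_enorm_inner_sq {H : Type} [NormedAddCommGroup H] [InnerProductSpace ℂ H] {ι : Type*}
    (b : HilbertBasis ι ℂ H) (x : H) :
    ∑' i, ‖inner ℂ (b i) x‖ₑ ^ 2 = ‖x‖ₑ ^ 2 := by
  have h := b.hasSum_inner_mul_inner x x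
  have h2 : HasSum (fun i => ‖inner ℂ (b i) x‖ ^ 2) (‖x‖ ^ 2) := by
    have := Complex.hasSum_re h
    rw [inner_self_eq_norm_sq_to_K] at this
    convert this using 1
    · ext i
      rw [← inner_conj_symm x (b i), mul_comm, Complex.mul_conj, Complex.normSq_eq_norm_sq,
        Complex.ofReal_re]
    · norm_cast
  simp only [enorm_sq_eq_ofReal]
  rw [← ENNReal.ofReal_tsum_of_nonneg (fun _ => sq_nonneg _) h2.summable, h2.tsum_eq]

variable {H : Type} [NormedAddCommGroup H] [InnerProductSpace ℂ H] [CompleteSpace H]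

/-- A closed form, given by a Hilbert space `X` and a bounded map `J : X → H` with
`a(J x, J y) = ⟨x, y⟩ - K ⟨J x, J y⟩`, has a bounded negative part. Formally `a` is the form of
`T = R⁻¹ - K` with `R = J J*`, so that `T_- = (K - R⁻¹)_+`, a continuous function of `R`. -/
theorem exists_isNegPart {X : Type} [NormedAddCommGroup X] [InnerProductSpace ℂ X]
    [CompleteSpace X] (J : X →L[ℂ] H) (a : H → H → ℂ) (K : ℝ) (hK : 0 < K)
    (ha : ∀ x y, a (J x) (J y) = inner ℂ x y - K * inner ℂ (J x) (J y)) :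
    ∃ N : H →L[ℂ] H, IsNegPart (Set.range J) a N := by
  set R : H →L[ℂ] H := J ∘L J.adjoint with hR
  have pR : R.IsPositive := ContinuousLinearMap.isPositive_self_comp_adjoint J
  have nR : 0 ≤ R := (ContinuousLinearMap.nonneg_iff_isPositive R).2 pR
  have sR : IsSelfAdjoint R := pR.isSelfAdjoint
  have spec : ∀ x ∈ spectrum ℝ R, 0 ≤ x := fun x hx => spectrum_nonneg_of_nonneg nR hx
  -- `g(ρ) = (K - 1/ρ)_+ / ρ`, written so as to be continuous also at `ρ = 0`
  set g : ℝ → ℝ := fun ρ => max 0 (K * ρ - 1) / (max ρ K⁻¹) ^ 2 with hg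
  have mpos : ∀ ρ : ℝ, 0 < max ρ K⁻¹ := fun ρ => lt_max_of_lt_right (inv_pos.2 hK)
  have cg : Continuous g := by
    refine Continuous.div (by fun_prop) (by fun_prop) fun ρ => ?_
    exact pow_ne_zero _ (mpos ρ).ne'
  have cg' : ContinuousOn g (spectrum ℝ R) := cg.continuousOn
  -- on the spectrum, `ρ g(ρ) = (K - 1/ρ)_+`
  have alt : ∀ ρ : ℝ, 0 ≤ ρ →
      (g ρ = 0 ∧ K * ρ ≤ 1) ∨ (0 < ρ ∧ 1 < K * ρ ∧ ρ * g ρ = K - 1 / ρ) := by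
    intro ρ h0
    rcases le_or_gt (K * ρ) 1 with h | h
    · left
      refine ⟨?_, h⟩
      simp only [hg]
      rw [max_eq_left (by linarith), zero_div]
    · right
      have hρ : 0 < ρ := by
        rcases h0.eq_or_lt with h' | h'
        · rw [← h', mul_zero] at h; linarith
        · exact h'
      refine ⟨hρ, h, ?_⟩
      simp only [hg]
      rw [max_eq_right (by linarith), max_eq_left]
      · field_simp
      · rw [inv_le_iff_one_le_mul₀ hK]; linarith
  set N : H →L[ℂ] H := cfc (fun ρ => ρ * g ρ) R with hN
  set G : H →L[ℂ] H := cfc g R with hG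
  have NRG : N = R * G := by
    rw [hN, cfc_mul (fun ρ => ρ) g R (by fun_prop) cg', cfc_id' ℝ R]
  have NN : N * N = K • N - G := by
    rw [hN, hG, ← cfc_mul _ _ R (by fun_prop) (by fun_prop), ← cfc_smul K _ R (by fun_prop),
      ← cfc_sub _ _ R (by fun_prop) cg']
    refine cfc_congr fun ρ hρ => ?_
    rcases alt ρ (spec ρ hρ) with ⟨h, -⟩ | ⟨h1, -, h2⟩
    · simp [h]
    · have h3 : g ρ = (K - 1 / ρ) / ρ := by rw [← h2]; field_simp
      simp only [h3, smul_eq_mul]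
      field_simp
  -- `C² = K - N`; the inequality `T + N ≥ 0` says that `C J` is a contraction
  set C : H →L[ℂ] H := cfc (fun ρ => √(K - ρ * g ρ)) R with hC
  have sC : IsSelfAdjoint C := cfc_predicate _ R
  have below : ∀ ρ : ℝ, 0 ≤ ρ → 0 ≤ K - ρ * g ρ := by
    intro ρ h0
    rcases alt ρ h0 with ⟨h, -⟩ | ⟨h1, -, h2⟩
    · simp [h, hK.le]
    · rw [h2]; simp; positivity
  have CC : C * C = K • (1 : H →L[ℂ] H) - N := by
    rw [hC, ← cfc_mul _ _ R (by fun_prop) (by fun_prop), hN, ← cfc_const_one ℝ R,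
      ← cfc_smul K _ R (by fun_prop), ← cfc_sub _ _ R (by fun_prop) (by fun_prop)]
    refine cfc_congr fun ρ hρ => ?_
    simp only [smul_eq_mul, mul_one]
    exact Real.mul_self_sqrt (below ρ (spec ρ hρ))
  have CRC : ‖C * R * C‖ ≤ 1 := by
    have : C * R * C = cfc (fun ρ => √(K - ρ * g ρ) * ρ * √(K - ρ * g ρ)) R := by
      rw [cfc_mul (fun ρ => √(K - ρ * g ρ) * ρ) (fun ρ => √(K - ρ * g ρ)) R (by fun_prop)
        (by fun_prop), cfc_mul (fun ρ => √(K - ρ * g ρ)) (fun ρ => ρ) R (by fun_prop)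
        (by fun_prop), cfc_id' ℝ R]
    rw [this]
    refine norm_cfc_le zero_le_one fun ρ hρ => ?_
    have h0 := spec ρ hρ
    have e : √(K - ρ * g ρ) * ρ * √(K - ρ * g ρ) = (K - ρ * g ρ) * ρ := by
      rw [mul_right_comm, Real.mul_self_sqrt (below ρ h0)]
    rw [e, Real.norm_of_nonneg (mul_nonneg (below ρ h0) h0)]
    rcases alt ρ h0 with ⟨h, h'⟩ | ⟨h1, -, h2⟩
    · simpa [h] using h'
    · rw [h2]; simp [h1.ne']
  have CJ : ‖C ∘L J‖ ≤ 1 := by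
    have h1 : (C ∘L J) ∘L (C ∘L J).adjoint = C * R * C := by
      rw [ContinuousLinearMap.adjoint_comp, sC.adjoint_eq]
      rfl
    have h2 := ContinuousLinearMap.norm_adjoint_comp_self (C ∘L J).adjoint
    rw [ContinuousLinearMap.adjoint_adjoint, h1, LinearIsometryEquiv.norm_map] at h2
    nlinarith [norm_nonneg (C ∘L J)]
  refine ⟨N, (ContinuousLinearMap.nonneg_iff_isPositive N).1 (cfc_nonneg fun ρ hρ => ?_), ?_, ?_⟩
  · exact mul_nonneg (spec ρ hρ) (div_nonneg (le_max_left _ _) (sq_nonneg _))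
  · rintro _ ⟨x, rfl⟩
    have h1 : ‖C (J x)‖ ≤ ‖x‖ := by simpa using (C ∘L J).le_of_opNorm_le CJ x
    have h2 : inner ℂ (J x) ((C * C) (J x)) = (‖C (J x)‖ : ℂ) ^ 2 := by
      rw [mul_apply_eq_comp, ← ContinuousLinearMap.adjoint_inner_left, sC.adjoint_eq,
        inner_self_eq_norm_sq_to_K]; rfl
    rw [CC] at h2
    have h3 : inner ℂ (J x) (N (J x)) = K * inner ℂ (J x) (J x) - (‖C (J x)‖ : ℂ) ^ 2 := by
      rw [← h2]
      simp [inner_smul_right_eq_smul]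
    rw [ha, h3, inner_self_eq_norm_sq_to_K, inner_self_eq_norm_sq_to_K]
    have e : (((‖x‖ : ℂ) ^ 2 - K * (‖J x‖ : ℂ) ^ 2).re +
        (K * (‖J x‖ : ℂ) ^ 2 - (‖C (J x)‖ : ℂ) ^ 2).re) = ‖x‖ ^ 2 - ‖C (J x)‖ ^ 2 := by
      rw [← Complex.add_re, sub_add_sub_cancel]
      norm_cast
    refine le_of_le_of_eq ?_ e.symm
    nlinarith [norm_nonneg (C (J x)), norm_nonneg x]
  · intro f
    have h1 : N f = J (J.adjoint (G f)) := by rw [NRG]; rfl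
    refine ⟨⟨_, h1.symm⟩, ?_⟩
    rintro _ ⟨x, rfl⟩
    have h2 : N (N f) = (K : ℂ) • N f - G f := by
      have := DFunLike.congr_fun NN f
      simpa using this
    rw [h2, h1, ha, ContinuousLinearMap.adjoint_inner_right]
    simp

theorem inner_star_mul_self (A : H →L[ℂ] H) (v w : H) :
    inner ℂ v ((star A * A) w) = inner ℂ (A v) (A w) := by
  rw [mul_apply_eq_comp, ContinuousLinearMap.star_eq_adjoint,
    ContinuousLinearMap.adjoint_inner_right]

/-- `‖A‖² - A* A` is of the form `β* β`. -/
theorem exists_inner_eq_norm_sq_sub (A : H →L[ℂ] H) : ∃ β : H →L[ℂ] H, ∀ v w,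
    inner ℂ (β v) (β w) = (‖A‖ : ℂ) ^ 2 * inner ℂ v w - inner ℂ (A v) (A w) := by
  set Q : H →L[ℂ] H := ((‖A‖ : ℂ) ^ 2) • (1 : H →L[ℂ] H) - star A * A with hQ
  have hQi : ∀ v w, inner ℂ v (Q w) = (‖A‖ : ℂ) ^ 2 * inner ℂ v w - inner ℂ (A v) (A w) := by
    intro v w
    rw [hQ, _root_.sub_apply, inner_sub_right, inner_star_mul_self, _root_.smul_apply,
      one_apply_eq_self, inner_smul_right]
  obtain ⟨β, hβ⟩ : ∃ β : H →L[ℂ] H, Q = star β * β := by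
    rw [← CStarAlgebra.nonneg_iff_eq_star_mul_self, ContinuousLinearMap.nonneg_iff_isPositive]
    have sa : IsSelfAdjoint Q := by
      refine IsSelfAdjoint.sub ?_ (IsSelfAdjoint.star_mul_self A)
      refine IsSelfAdjoint.smul ?_ (IsSelfAdjoint.one _)
      rw [isSelfAdjoint_iff, star_pow]; simp
    refine ⟨sa.isSymmetric, fun x => ?_⟩
    rw [ContinuousLinearMap.reApplyInnerSelf_apply, ← inner_conj_symm, RCLike.conj_re, hQi,
      inner_self_eq_norm_sq_to_K, inner_self_eq_norm_sq_to_K]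
    have e : (‖A‖ : ℂ) ^ 2 * (‖x‖ : ℂ) ^ 2 - (‖A x‖ : ℂ) ^ 2 =
        ((‖A‖ ^ 2 * ‖x‖ ^ 2 - ‖A x‖ ^ 2 : ℝ) : ℂ) := by push_cast; ring
    refine le_of_le_of_eq ?_ (congrArg Complex.re e).symm
    rw [Complex.ofReal_re]
    have h2 := pow_le_pow_left₀ (norm_nonneg _) (A.le_opNorm x) 2
    rw [mul_pow] at h2
    linarith
  refine ⟨β, fun v w => ?_⟩
  rw [← inner_star_mul_self, ← hβ, hQi]

/-- A form `⟨x, y⟩ - ⟨v, w⟩ - ⟨Φ v, Φ w⟩` given by a Hilbert space `X` and a bounded map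
`J : X → H`, with `v = J x`, `w = J y` and `Φ` bounded, has a negative part: the inner product of
`X` is changed to `⟨x, y⟩ + ⟨β v, β w⟩` with `β* β = ‖Φ‖² - Φ* Φ`. -/
theorem exists_isNegPart_of_sub {X : Type} [NormedAddCommGroup X] [InnerProductSpace ℂ X]
    [CompleteSpace X] (J : X →L[ℂ] H) (Φ : H →L[ℂ] H) (a : H → H → ℂ)
    (ha : ∀ x y, a (J x) (J y) =
      inner ℂ x y - inner ℂ (J x) (J y) - inner ℂ (Φ (J x)) (Φ (J y))) :
    ∃ N : H →L[ℂ] H, IsNegPart (Set.range J) a N := by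
  obtain ⟨β, hββ⟩ := exists_inner_eq_norm_sq_sub Φ
  -- the graph of `β J`, a Hilbert space with the changed inner product
  let Y : Submodule ℂ (WithLp 2 (X × H)) :=
    { carrier := {p | p.snd = β (J p.fst)}
      add_mem' := fun {p q} hp hq => by
        change (p + q).snd = β (J (p + q).fst)
        rw [WithLp.add_snd, WithLp.add_fst, map_add, map_add]
        exact congrArg₂ _ hp hq
      zero_mem' := by
        change (0 : WithLp 2 (X × H)).snd = β (J (0 : WithLp 2 (X × H)).fst)
        rw [WithLp.zero_snd, WithLp.zero_fst, map_zero, map_zero]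
      smul_mem' := fun c p hp => by
        change (c • p).snd = β (J (c • p).fst)
        rw [WithLp.smul_snd, WithLp.smul_fst, map_smul, map_smul]
        exact congrArg _ hp }
  have memY : ∀ p : WithLp 2 (X × H), p ∈ Y ↔ p.snd = β (J p.fst) := fun p => Iff.rfl
  have cY : IsClosed (Y : Set (WithLp 2 (X × H))) :=
    isClosed_eq (WithLp.sndL 2 ℂ X H).continuous
      (β.continuous.comp (J.continuous.comp (WithLp.fstL 2 ℂ X H).continuous))
  have : CompleteSpace Y := cY.completeSpace_coe
  let J₀ : WithLp 2 (X × H) →L[ℂ] H := J.comp (WithLp.fstL 2 ℂ X H)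
  let J' : Y →L[ℂ] H := J₀.comp Y.subtypeL
  have hJ' : ∀ p : Y, J' p = J (p : WithLp 2 (X × H)).fst := fun p => rfl
  have hrange : Set.range J' = Set.range J := by
    ext v
    constructor
    · rintro ⟨p, rfl⟩; exact ⟨_, (hJ' p).symm⟩
    · rintro ⟨x, rfl⟩
      have hx : WithLp.toLp 2 (x, β (J x)) ∈ Y := rfl
      exact ⟨⟨_, hx⟩, hJ' _⟩
  rw [← hrange]
  refine exists_isNegPart J' a (‖Φ‖ ^ 2 + 1) (by positivity) fun p q => ?_
  have hp := (memY _).1 p.2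
  have hq := (memY _).1 q.2
  have e1 : inner ℂ p q = inner ℂ (p : WithLp 2 (X × H)).fst (q : WithLp 2 (X × H)).fst +
      inner ℂ (β (J' p)) (β (J' q)) := by
    rw [Submodule.coe_inner, WithLp.prod_inner_apply, hJ', hJ', ← hp, ← hq]
    rfl
  rw [e1, hββ, hJ', hJ', ha]
  push_cast
  ring

/-- The squared Hilbert--Schmidt norm of `A` and of `A*`, computed in any two Hilbert bases. -/
theorem tsum_enorm_apply_sq_eq {ι κ : Type*} (b : HilbertBasis ι ℂ H) (c : HilbertBasis κ ℂ H)
    (A : H →L[ℂ] H) : ∑' i, ‖A (b i)‖ₑ ^ 2 = ∑' j, ‖A.adjoint (c j)‖ₑ ^ 2 := by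
  simp only [← tsum_enorm_inner_sq c (A (b _)), ← tsum_enorm_inner_sq b (A.adjoint (c _))]
  rw [ENNReal.tsum_comm]
  refine tsum_congr fun j => tsum_congr fun i => ?_
  rw [ContinuousLinearMap.adjoint_inner_right, ← inner_conj_symm, RCLike.enorm_conj]

/-- A positive operator is the square of a self-adjoint one. -/
theorem exists_selfAdjoint_sqrt {N : H →L[ℂ] H} (hN : N.IsPositive) :
    ∃ S : H →L[ℂ] H, S.adjoint = S ∧ ∀ x, inner ℂ x (N x) = ((‖S x‖ ^ 2 : ℝ) : ℂ) := by
  have nN : 0 ≤ N := (ContinuousLinearMap.nonneg_iff_isPositive N).2 hN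
  have sS : IsSelfAdjoint (CFC.sqrt N) := (CFC.sqrt_nonneg N).isSelfAdjoint
  refine ⟨CFC.sqrt N, sS.adjoint_eq, fun x => ?_⟩
  nth_rewrite 1 [← CFC.sqrt_mul_sqrt_self N nN]
  rw [mul_apply_eq_comp, ← ContinuousLinearMap.adjoint_inner_left, sS.adjoint_eq,
    inner_self_eq_norm_sq_to_K]
  norm_cast

/-- A positive operator whose finite diagonal sums in one Hilbert basis are bounded by `B` is
trace class, with trace at most `B`. -/
theorem exists_hasTrace {ι : Type} (b : HilbertBasis ι ℂ H) {N : H →L[ℂ] H} (hN : N.IsPositive)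
    (B : ℝ) (hB : ∀ F : Finset ι, ∑ i ∈ F, (inner ℂ (b i) (N (b i))).re ≤ B) :
    ∃ t : ℝ, HasTrace N t ∧ t ≤ B := by
  obtain ⟨S, hS, hN2⟩ := exists_selfAdjoint_sqrt hN
  simp only [hN2, Complex.ofReal_re] at hB
  have en : ∀ y : H, ‖y‖ₑ ^ 2 = ENNReal.ofReal (‖y‖ ^ 2) := enorm_sq_eq_ofReal
  have fin : ∑' i, ‖S (b i)‖ₑ ^ 2 ≤ ENNReal.ofReal B := by
    refine ENNReal.summable.tsum_le_of_sum_le fun F => ?_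
    simp only [en]
    rw [← ENNReal.ofReal_sum_of_nonneg fun _ _ => sq_nonneg _]
    exact ENNReal.ofReal_le_ofReal (hB F)
  have B0 : 0 ≤ B := by simpa using hB ∅
  refine ⟨(∑' i, ‖S (b i)‖ₑ ^ 2).toReal, fun κ c => ?_, ENNReal.toReal_le_of_le_ofReal B0 fin⟩
  have e : ∑' i, ‖S (b i)‖ₑ ^ 2 = ∑' j, ‖S (c j)‖ₑ ^ 2 := by
    rw [tsum_enorm_apply_sq_eq b c, hS]
  have fin' : ∑' j, ENNReal.ofReal (‖S (c j)‖ ^ 2) ≠ ⊤ := by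
    simp only [← en]
    rw [← e]
    exact ne_top_of_le_ne_top ENNReal.ofReal_ne_top fin
  simp only [hN2]
  rw [Complex.hasSum_ofReal, e]
  simp only [en]
  have := (ENNReal.hasSum_toReal fin')
  rw [ENNReal.tsum_toReal_eq fun i => ENNReal.ofReal_ne_top]
  simpa only [ENNReal.toReal_ofReal (sq_nonneg _)] using this

/-- `Tr S* N S ≤ Tr N` for a contraction `S`. -/
theorem HasTrace.sum_le {ι : Type} (b : HilbertBasis ι ℂ H) {N : H →L[ℂ] H} (hN : N.IsPositive)
    {t : ℝ} (ht : HasTrace N t) (S : H →L[ℂ] H) (hS : ‖S‖ ≤ 1) (F : Finset ι) :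
    ∑ i ∈ F, (inner ℂ (S (b i)) (N (S (b i)))).re ≤ t := by
  obtain ⟨Q, hQ, hN2⟩ := exists_selfAdjoint_sqrt hN
  have h := ht ι b
  simp only [hN2] at h
  rw [Complex.hasSum_ofReal] at h
  simp only [hN2, Complex.ofReal_re]
  have en : ∀ y : H, ‖y‖ₑ ^ 2 = ENNReal.ofReal (‖y‖ ^ 2) := enorm_sq_eq_ofReal
  have t0 : 0 ≤ t := h.nonneg fun _ => sq_nonneg _
  rw [← ENNReal.ofReal_le_ofReal_iff t0, ENNReal.ofReal_sum_of_nonneg fun _ _ => sq_nonneg _]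
  simp only [← en]
  calc ∑ i ∈ F, ‖Q (S (b i))‖ₑ ^ 2 ≤ ∑' i, ‖(Q ∘L S) (b i)‖ₑ ^ 2 := ENNReal.sum_le_tsum F
    _ = ∑' i, ‖S.adjoint (Q (b i))‖ₑ ^ 2 := by
      rw [tsum_enorm_apply_sq_eq b b, ContinuousLinearMap.adjoint_comp, hQ]; rfl
    _ ≤ ∑' i, ‖Q (b i)‖ₑ ^ 2 := by
      refine ENNReal.tsum_le_tsum fun i => pow_le_pow_left' ?_ 2
      rw [← ofReal_norm, ← ofReal_norm]
      refine ENNReal.ofReal_le_ofReal ?_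
      have := S.adjoint.le_of_opNorm_le (c := 1) (by rwa [LinearIsometryEquiv.norm_map]) (Q (b i))
      simpa using this
    _ = ENNReal.ofReal t := by
      simp only [en]
      rw [← ENNReal.ofReal_tsum_of_nonneg (fun _ => sq_nonneg _) h.summable, h.tsum_eq]

/-- Variational principle: the trace of the negative part of `a` is at most any bound for
`-Tr(S* T S)` valid for all contractions `S` with range in the form domain. -/
theorem IsNegPart.exists_hasTrace_of_forall_contraction {ι : Type} (b : HilbertBasis ι ℂ H)
    {D : Set H} {a : H → H → ℂ} {N : H →L[ℂ] H} (hN : IsNegPart D a N) (B : ℝ)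
    (hB : ∀ S : H →L[ℂ] H, ‖S‖ ≤ 1 → (∀ f, S f ∈ D) → ∀ F : Finset ι,
      ∑ i ∈ F, -(a (S (b i)) (S (b i))).re ≤ B) :
    ∃ t : ℝ, HasTrace N t ∧ t ≤ B := by
  refine exists_hasTrace b hN.isPositive B fun F => ?_
  have nN : 0 ≤ N := (ContinuousLinearMap.nonneg_iff_isPositive N).2 hN.isPositive
  have sN : IsSelfAdjoint N := hN.isPositive.isSelfAdjoint
  have spec : ∀ x ∈ spectrum ℝ N, 0 ≤ x := fun x hx => spectrum_nonneg_of_nonneg nN hx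
  have step : ∀ δ : ℝ, 0 < δ →
      ∑ i ∈ F, (inner ℂ (b i) (N (b i))).re ≤ B + F.card * (2 * δ) := by
    intro δ hδ
    -- `k(x) = 1/(x+δ)` on the spectrum, so that `N k(N)` approximates the projection on `N > 0`
    set k : ℝ → ℝ := fun x => (|x| + δ)⁻¹ with hk
    have ck : Continuous k := by
      refine Continuous.inv₀ (by fun_prop) fun x => ?_
      positivity
    set P : H →L[ℂ] H := cfc k N with hP
    have sP : IsSelfAdjoint P := cfc_predicate _ N
    set S : H →L[ℂ] H := N * P with hS
    have S1 : S = cfc (fun x => x * k x) N := by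
      rw [hS, hP, cfc_mul (fun x => x) k N (by fun_prop) ck.continuousOn, cfc_id' ℝ N]
    have sS : IsSelfAdjoint S := by rw [S1]; exact cfc_predicate _ N
    have nS : ‖S‖ ≤ 1 := by
      rw [S1]
      refine norm_cfc_le zero_le_one fun x hx => ?_
      have := spec x hx
      simp only [hk, abs_of_nonneg this]
      rw [Real.norm_of_nonneg (by positivity), mul_inv_le_iff₀ (by positivity)]
      linarith
    -- `x - x³/(x+δ)² ≤ 2δ`
    have diff : ‖N - P * (N * N * N) * P‖ ≤ 2 * δ := by
      have : N - P * (N * N * N) * P = cfc (fun x => x - k x * (x * x * x) * k x) N := by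
        rw [cfc_sub _ _ N (by fun_prop) (by fun_prop), cfc_id' ℝ N,
          cfc_mul (fun x => k x * (x * x * x)) k N (by fun_prop) (by fun_prop),
          cfc_mul k (fun x => x * x * x) N (by fun_prop) (by fun_prop),
          cfc_mul (fun x => x * x) (fun x => x) N (by fun_prop) (by fun_prop),
          cfc_mul (fun x => x) (fun x => x) N (by fun_prop) (by fun_prop), cfc_id' ℝ N]
      rw [this]
      refine norm_cfc_le (by positivity) fun x hx => ?_
      have hx0 := spec x hx
      simp only [hk, abs_of_nonneg hx0]
      have e : x - (x + δ)⁻¹ * (x * x * x) * (x + δ)⁻¹ = x * (2 * x * δ + δ ^ 2) / (x + δ) ^ 2 := by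
        field_simp
        ring
      rw [e, Real.norm_of_nonneg (by positivity), div_le_iff₀ (by positivity)]
      nlinarith [mul_nonneg hx0 hδ.le, mul_nonneg hδ.le (mul_nonneg hδ.le hx0), pow_pos hδ 3]
    have key : ∀ f, -(a (S f) (S f)).re = (inner ℂ f ((P * (N * N * N) * P) f)).re := by
      intro f
      have h1 := (hN.add_mul_eq_zero (P f)).2 (S f) (hN.add_mul_eq_zero (P f)).1
      have h2 : S f = N (P f) := rfl
      rw [← h2] at h1
      rw [h1, inner_neg_right, Complex.neg_re, neg_neg]
      congr 1
      rw [h2, ← ContinuousLinearMap.adjoint_inner_right, sN.adjoint_eq,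
        ← ContinuousLinearMap.adjoint_inner_right, sP.adjoint_eq]
      rfl
    have h := hB S nS (fun f => (hN.add_mul_eq_zero (P f)).1) F
    simp only [key] at h
    calc ∑ i ∈ F, (inner ℂ (b i) (N (b i))).re
        ≤ ∑ i ∈ F, ((inner ℂ (b i) ((P * (N * N * N) * P) (b i))).re + 2 * δ) := by
          refine Finset.sum_le_sum fun i _ => ?_
          have h1 : (inner ℂ (b i) ((N - P * (N * N * N) * P) (b i))).re ≤ 2 * δ := by
            refine (Complex.re_le_norm _).trans ((norm_inner_le_norm _ _).trans ?_)
            rw [b.orthonormal.1 i, one_mul]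
            refine ((N - P * (N * N * N) * P).le_of_opNorm_le diff _).trans ?_
            rw [b.orthonormal.1 i, mul_one]
          rw [_root_.sub_apply, inner_sub_right, Complex.sub_re] at h1
          linarith
      _ ≤ B + F.card * (2 * δ) := by
          rw [Finset.sum_add_distrib, Finset.sum_const, nsmul_eq_mul]
          linarith
  refine le_of_forall_pos_le_add fun ε hε => ?_
  have := step (ε / (2 * (F.card + 1))) (by positivity)
  refine this.trans ?_
  have h : (F.card : ℝ) * (2 * (ε / (2 * (F.card + 1)))) ≤ ε := by
    rw [show (F.card : ℝ) * (2 * (ε / (2 * (F.card + 1)))) = ε * (F.card / (F.card + 1)) by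
      field_simp]
    refine mul_le_of_le_one_right hε.le ?_
    rw [div_le_one (by positivity)]
    linarith
  linarith

/-- If `a₁ ≥ θ a₂ ∘ U + ε a₃ ∘ U` for a contraction `U`, then `Tr N₁ ≤ θ Tr N₂ + ε K`, where `K`
bounds the trace of the negative part of `a₃` in the variational sense. -/
theorem IsNegPart.trace_le_of_form_le {D₁ D₂ : Set H} {a₁ a₂ a₃ : H → H → ℂ}
    {N₁ N₂ : H →L[ℂ] H} (h₁ : IsNegPart D₁ a₁ N₁) (h₂ : IsNegPart D₂ a₂ N₂) {t₁ t₂ θ ε K : ℝ}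
    (ht₁ : HasTrace N₁ t₁) (ht₂ : HasTrace N₂ t₂) (U : H →L[ℂ] H) (hU : ‖U‖ ≤ 1)
    (hD : ∀ v ∈ D₁, U v ∈ D₂) (hθ : 0 ≤ θ) (hε : 0 ≤ ε)
    (hle : ∀ v ∈ D₁, θ * (a₂ (U v) (U v)).re + ε * (a₃ (U v) (U v)).re ≤ (a₁ v v).re)
    (hK : ∀ (ι : Type) (b : HilbertBasis ι ℂ H) (S : H →L[ℂ] H), ‖S‖ ≤ 1 → (∀ f, S f ∈ D₂) →
      ∀ F : Finset ι, ∑ i ∈ F, -(a₃ (S (b i)) (S (b i))).re ≤ K) :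
    t₁ ≤ θ * t₂ + ε * K := by
  obtain ⟨s, b, -⟩ := exists_hilbertBasis ℂ H
  obtain ⟨t, ht, hle'⟩ := h₁.exists_hasTrace_of_forall_contraction b (θ * t₂ + ε * K) (by
    intro S hS hSD F
    have hUS : ‖U ∘L S‖ ≤ 1 :=
      (U.opNorm_comp_le S).trans (mul_le_one₀ hU (norm_nonneg _) hS)
    have A := ht₂.sum_le b h₂.isPositive (U ∘L S) hUS F
    have B := hK _ b (U ∘L S) hUS (fun f => hD _ (hSD f)) F
    calc ∑ i ∈ F, -(a₁ (S (b i)) (S (b i))).re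
        ≤ ∑ i ∈ F, (θ * (inner ℂ ((U ∘L S) (b i)) (N₂ ((U ∘L S) (b i)))).re +
            ε * -(a₃ ((U ∘L S) (b i)) ((U ∘L S) (b i))).re) := by
          refine Finset.sum_le_sum fun i _ => ?_
          have x1 := hle _ (hSD (b i))
          have x2 := mul_le_mul_of_nonneg_left (h₂.add_nonneg _ (hD _ (hSD (b i)))) hθ
          simp only [ContinuousLinearMap.comp_apply]
          linarith
      _ ≤ θ * t₂ + ε * K := by
          rw [Finset.sum_add_distrib, ← Finset.mul_sum, ← Finset.mul_sum]
          gcongr)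
  have : t₁ = t := by exact_mod_cast (ht₁ _ b).unique (ht _ b)
  rwa [this]

end AbstractOperators

/-! ### Multiplication operators on `L²` -/

section BoundedMultiplication

variable {d : ℕ}

theorem memLp_mul_of_bound {f : E d → ℂ} (hf : AEStronglyMeasurable f volume) {C : ℝ}
    (hC : ∀ x, ‖f x‖ ≤ C) (v : L2 d) : MemLp (fun x => f x * v x) 2 (volume : Measure (E d)) := by
  refine MemLp.of_le_mul (c := C) (Lp.memLp v) (hf.mul (Lp.aestronglyMeasurable v)) ?_
  filter_upwards with x
  rw [norm_mul]
  exact mul_le_mul_of_nonneg_right (hC x) (norm_nonneg _)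

/-- Multiplication by a bounded measurable function, as a bounded operator on `L²(ℝ^d)`. -/
theorem exists_boundedMul {f : E d → ℂ} (hf : AEStronglyMeasurable f volume) {C : ℝ}
    (hC : ∀ x, ‖f x‖ ≤ C) :
    ∃ A : L2 d →L[ℂ] L2 d, ‖A‖ ≤ C ∧ ∀ v, ∀ᵐ x, A v x = f x * v x := by
  have C0 : 0 ≤ C := (norm_nonneg _).trans (hC 0)
  have ae : ∀ v : L2 d, ∀ᵐ x, (memLp_mul_of_bound hf hC v).toLp _ x = f x * v x := fun v =>
    (memLp_mul_of_bound hf hC v).coeFn_toLp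
  let A : L2 d →ₗ[ℂ] L2 d :=
    { toFun := fun v => (memLp_mul_of_bound hf hC v).toLp _
      map_add' := fun v w => by
        ext1
        filter_upwards [ae (v + w), ae v, ae w, Lp.coeFn_add v w,
          Lp.coeFn_add ((memLp_mul_of_bound hf hC v).toLp _) ((memLp_mul_of_bound hf hC w).toLp _)]
          with x h1 h2 h3 h4 h5
        rw [h1, h5, Pi.add_apply, h2, h3, h4, Pi.add_apply, mul_add]
      map_smul' := fun c v => by
        ext1
        filter_upwards [ae (c • v), ae v, Lp.coeFn_smul c v,
          Lp.coeFn_smul c ((memLp_mul_of_bound hf hC v).toLp _)] with x h1 h2 h3 h4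
        rw [h1, RingHom.id_apply, h4, Pi.smul_apply, h2, h3, Pi.smul_apply, smul_eq_mul,
          smul_eq_mul, mul_left_comm] }
  have bd : ∀ v, ‖A v‖ ≤ C * ‖v‖ := fun v => by
    refine Lp.norm_le_mul_norm_of_ae_le_mul ?_
    filter_upwards [ae v] with x hx
    change ‖(memLp_mul_of_bound hf hC v).toLp _ x‖ ≤ _
    rw [hx, norm_mul]
    exact mul_le_mul_of_nonneg_right (hC x) (norm_nonneg _)
  exact ⟨A.mkContinuous C bd, A.mkContinuous_norm_le C0 bd, ae⟩

theorem enorm_sq_eq_lintegral (u : L2 d) : ‖u‖ₑ ^ 2 = ∫⁻ x, ‖u x‖ₑ ^ 2 := by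
  rw [Lp.enorm_def, eLpNorm_eq_lintegral_rpow_enorm_toReal (by norm_num) (by norm_num)]
  simp only [ENNReal.toReal_ofNat, ENNReal.rpow_ofNat]
  rw [← ENNReal.rpow_two, ← ENNReal.rpow_mul]
  norm_num

end BoundedMultiplication

/-! ### Translations and the Fourier transform -/

section Translation

variable {d : ℕ}

theorem norm_fourierChar_coe (t : ℝ) : ‖(Real.fourierChar t : ℂ)‖ = 1 := Circle.norm_coe _

/-- The Fourier transform turns a translation into multiplication by a phase. -/
theorem fourier_translate (z : E d) (u : L2 d) :
    ∀ᵐ ξ, (𝓕 (Lp.compMeasurePreserving (fun x => x + z)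
      (measurePreserving_add_right volume z) u) : L2 d) ξ =
      (Real.fourierChar (inner ℝ z ξ) : ℂ) * (𝓕 u : L2 d) ξ := by
  obtain ⟨A, -, hA⟩ := exists_boundedMul (d := d)
    (f := fun ξ => (Real.fourierChar (inner ℝ z ξ) : ℂ)) (C := 1)
    (by
      refine Continuous.aestronglyMeasurable ?_
      exact continuous_subtype_val.comp (Real.continuous_fourierChar.comp (by fun_prop)))
    (fun ξ => (norm_fourierChar_coe _).le)
  set τ : L2 d →ₗᵢ[ℂ] L2 d := Lp.compMeasurePreservingₗᵢ ℂ (fun x => x + z)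
    (measurePreserving_add_right volume z) with hτ
  have key : ∀ u : L2 d, (𝓕 (τ u) : L2 d) = A (𝓕 u) := by
    intro u
    refine DenseRange.induction_on
      (SchwartzMap.denseRange_toLpCLM (F := ℂ) (E := E d) (μ := volume) (p := 2)
        ENNReal.ofNat_ne_top) u ?_ ?_
    · refine isClosed_eq ?_ ?_
      · exact (Lp.fourierTransformₗᵢ (E d) ℂ).continuous.comp τ.continuous
      · exact A.continuous.comp (Lp.fourierTransformₗᵢ (E d) ℂ).continuous
    · intro f
      rw [SchwartzMap.toLpCLM_apply]
      have h1 : τ (f.toLp 2) = (f.compSubConstCLM ℝ (-z)).toLp 2 := by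
        ext1
        have e := Lp.coeFn_compMeasurePreserving (f.toLp 2) (measurePreserving_add_right volume z)
        have e2 := (measurePreserving_add_right volume z).quasiMeasurePreserving.ae
          (f.coeFn_toLp 2 volume)
        filter_upwards [e, e2, (f.compSubConstCLM ℝ (-z)).coeFn_toLp 2 volume] with x h1 h2 h3
        rw [h3]
        refine h1.trans ?_
        rw [Function.comp_apply, h2, SchwartzMap.compSubConstCLM_apply, sub_neg_eq_add]
      rw [h1, SchwartzMap.toLp_fourier_eq, SchwartzMap.toLp_fourier_eq]
      ext1
      filter_upwards [hA ((𝓕 f).toLp 2), (𝓕 f).coeFn_toLp 2 volume,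
        (𝓕 (f.compSubConstCLM ℝ (-z))).coeFn_toLp 2 volume] with ξ h2 h3 h4
      rw [h2, h3, h4]
      have h5 := congrFun (VectorFourier.fourierIntegral_comp_add_right Real.fourierChar
        (volume : Measure (E d)) (innerₗ (E d)) (f : E d → ℂ) z) ξ
      have h6 : ((f : E d → ℂ) ∘ fun v => v + z) = (f.compSubConstCLM ℝ (-z) : E d → ℂ) := by
        ext x; simp [SchwartzMap.compSubConstCLM_apply]
      rw [h6] at h5
      exact h5
  have := hA (𝓕 u)
  rw [← key u] at this
  exact this

theorem fourier_sub_L2 (u v : L2 d) : (𝓕 (u - v) : L2 d) = 𝓕 u - 𝓕 v :=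
  map_sub (Lp.fourierTransformₗᵢ (E d) ℂ) u v

/-- Plancherel for a difference `u(· + z) - u`. -/
theorem lintegral_translate_sub (z : E d) (u : L2 d) :
    ∫⁻ x, ‖u (x + z) - u x‖ₑ ^ 2 =
      ∫⁻ ξ, ‖(Real.fourierChar (inner ℝ z ξ) : ℂ) - 1‖ₑ ^ 2 * ‖(𝓕 u : L2 d) ξ‖ₑ ^ 2 := by
  set w := Lp.compMeasurePreserving (fun x => x + z) (measurePreserving_add_right volume z) u
  have h1 : ∫⁻ x, ‖u (x + z) - u x‖ₑ ^ 2 = ‖w - u‖ₑ ^ 2 := by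
    rw [enorm_sq_eq_lintegral]
    refine lintegral_congr_ae ?_
    filter_upwards [Lp.coeFn_sub w u,
      Lp.coeFn_compMeasurePreserving u (measurePreserving_add_right volume z)] with x h2 h3
    rw [h2, Pi.sub_apply, h3]
    rfl
  have h2 : ‖w - u‖ₑ = ‖(𝓕 w : L2 d) - 𝓕 u‖ₑ := by
    rw [← fourier_sub_L2, ← ofReal_norm, ← ofReal_norm, Lp.norm_fourier_eq]
  rw [h1, h2, enorm_sq_eq_lintegral]
  refine lintegral_congr_ae ?_
  filter_upwards [Lp.coeFn_sub (𝓕 w : L2 d) (𝓕 u), fourier_translate z u] with ξ h2 h3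
  rw [h2, Pi.sub_apply, h3, ← mul_pow, ← enorm_mul, sub_mul, one_mul]

end Translation

/-! ### Heat energies -/

noncomputable section Heat

variable {d : ℕ}

/-- The Gaussian integral of `|e^{2πi⟨z,ξ⟩} - 1|² = 2 - 2 cos(2π⟨z,ξ⟩)`. -/
theorem lintegral_gaussian_mul_fourierChar_sub_one {b : ℝ} (hb : 0 < b) (ξ : E d) :
    ∫⁻ z : E d, ENNReal.ofReal (Real.exp (-b * ‖z‖ ^ 2)) *
        ‖(Real.fourierChar (inner ℝ z ξ) : ℂ) - 1‖ₑ ^ 2 =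
      ENNReal.ofReal ((Real.pi / b) ^ ((d : ℝ) / 2) *
        (2 * (1 - Real.exp (-(‖(2 * Real.pi) • ξ‖ ^ 2 / (4 * b)))))) := by
  have hb' : 0 < (b : ℂ).re := hb
  set c : ℂ := 2 * Real.pi * Complex.I with hc
  have i1 := GaussianFourier.integrable_cexp_neg_mul_sq_norm_add hb' 0 (0 : E d)
  have i2 := GaussianFourier.integrable_cexp_neg_mul_sq_norm_add hb' c ξ
  have pt : ∀ z : E d, ENNReal.ofReal (Real.exp (-b * ‖z‖ ^ 2)) *
        ‖(Real.fourierChar (inner ℝ z ξ) : ℂ) - 1‖ₑ ^ 2 =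
      ENNReal.ofReal (2 * ((Complex.exp (-b * ‖z‖ ^ 2 + 0 * (inner ℝ (0 : E d) z : ℝ))).re -
        (Complex.exp (-b * ‖z‖ ^ 2 + c * (inner ℝ ξ z : ℝ))).re)) := by
    intro z
    rw [← ofReal_norm, ← ENNReal.ofReal_pow (norm_nonneg _),
      ← ENNReal.ofReal_mul (Real.exp_pos _).le]
    congr 1
    have e1 : (Real.fourierChar (inner ℝ z ξ) : ℂ) =
        Complex.exp ((2 * Real.pi * inner ℝ z ξ : ℝ) * Complex.I) := by
      rw [Real.fourierChar_apply]
    set θ : ℝ := 2 * Real.pi * inner ℝ z ξ with hθ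
    have e2 : c * (inner ℝ ξ z : ℝ) = θ * Complex.I := by
      rw [hc, hθ, real_inner_comm]; push_cast; ring
    have e3 : ‖Complex.exp (θ * Complex.I) - 1‖ ^ 2 = 2 - 2 * Real.cos θ := by
      rw [← Complex.normSq_eq_norm_sq, Complex.normSq_apply, Complex.sub_re, Complex.sub_im,
        Complex.exp_ofReal_mul_I_re, Complex.exp_ofReal_mul_I_im, Complex.one_re, Complex.one_im]
      nlinarith [Real.sin_sq_add_cos_sq θ]
    have e4 : (-b * ‖z‖ ^ 2 : ℂ) = ((-b * ‖z‖ ^ 2 : ℝ) : ℂ) := by push_cast; ring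
    rw [e1, e3, e2, e4, zero_mul, add_zero, Complex.exp_add, Complex.exp_ofReal_re,
      ← Complex.ofReal_exp, Complex.re_ofReal_mul, Complex.exp_ofReal_mul_I_re]
    ring
  simp only [pt]
  rw [← ofReal_integral_eq_lintegral_ofReal]
  · congr 1
    have i12 := integral_sub i1.re i2.re
    simp only [RCLike.re_to_complex] at i12
    rw [integral_const_mul, i12]
    have r1 := integral_re i1
    have r2 := integral_re i2
    simp only [RCLike.re_to_complex] at r1 r2 ⊢
    rw [r1, r2, GaussianFourier.integral_cexp_neg_mul_sq_norm_add hb',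
      GaussianFourier.integral_cexp_neg_mul_sq_norm_add hb']
    have e5 : ((Real.pi : ℂ) / b) ^ ((Module.finrank ℝ (E d) : ℂ) / 2) =
        (((Real.pi / b) ^ ((d : ℝ) / 2) : ℝ) : ℂ) := by
      rw [Complex.ofReal_cpow (by positivity)]
      simp
    have e6 : c ^ 2 * (‖ξ‖ : ℂ) ^ 2 / (4 * b) =
        ((-(‖(2 * Real.pi) • ξ‖ ^ 2 / (4 * b)) : ℝ) : ℂ) := by
      rw [hc, norm_smul, Real.norm_of_nonneg (by positivity)]
      push_cast
      rw [mul_pow, mul_pow, Complex.I_sq]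
      ring
    rw [e5, e6, ← Complex.ofReal_exp, ← Complex.ofReal_mul, Complex.ofReal_re]
    simp
    ring
  · exact (i1.re.sub i2.re).const_mul 2
  · filter_upwards with z
    have := congrArg ENNReal.toReal (pt z)
    refine mul_nonneg zero_le_two (sub_nonneg.2 ?_)
    refine (Complex.re_le_norm _).trans ?_
    rw [Complex.norm_exp, zero_mul, add_zero]
    have e4 : (-b * ‖z‖ ^ 2 : ℂ) = ((-b * ‖z‖ ^ 2 : ℝ) : ℂ) := by push_cast; ring
    rw [e4, Complex.exp_ofReal_re]
    refine Real.exp_le_exp.2 ?_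
    rw [Complex.add_re, Complex.ofReal_re, hc]
    simp

/-- `⟨u, (1 - e^{sΔ}) u⟩ = ∫ (1 - e^{-s|2πξ|²}) |û(ξ)|² dξ`. -/
def heatEnergy (s : ℝ) (u : L2 d) : ℝ≥0∞ :=
  ∫⁻ ξ : E d, ENNReal.ofReal (1 - Real.exp (-(s * ‖(2 * Real.pi) • ξ‖ ^ 2))) *
    ‖(𝓕 u : L2 d) ξ‖ₑ ^ 2

/-- `∫∫ e^{-|x-y|²/4s} |u(x) - u(y)|² dx dy`. -/
def heatForm (s : ℝ) (u : E d → ℂ) : ℝ≥0∞ :=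
  ∫⁻ x, ∫⁻ y, ENNReal.ofReal (Real.exp (-(4 * s)⁻¹ * ‖x - y‖ ^ 2)) * ‖u x - u y‖ₑ ^ 2

/-- The heat energy as a double integral, by Plancherel in `x` for each fixed difference `x - y`. -/
theorem heatForm_eq {s : ℝ} (hs : 0 < s) (u : L2 d) :
    heatForm s u = ENNReal.ofReal (2 * (4 * Real.pi * s) ^ ((d : ℝ) / 2)) * heatEnergy s u := by
  have hb : 0 < (4 * s)⁻¹ := by positivity
  have mu : Measurable (u : E d → ℂ) := (Lp.stronglyMeasurable u).measurable
  have mF : Measurable ((𝓕 u : L2 d) : E d → ℂ) := (Lp.stronglyMeasurable _).measurable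
  calc heatForm s u
      = ∫⁻ y, ∫⁻ x, ENNReal.ofReal (Real.exp (-(4 * s)⁻¹ * ‖x - y‖ ^ 2)) *
          ‖u x - u y‖ₑ ^ 2 := by
        refine lintegral_lintegral_swap (Measurable.aemeasurable ?_)
        fun_prop
    _ = ∫⁻ y, ∫⁻ z, ENNReal.ofReal (Real.exp (-(4 * s)⁻¹ * ‖z‖ ^ 2)) *
          ‖u (y + z) - u y‖ₑ ^ 2 := by
        refine lintegral_congr fun y => ?_
        rw [← lintegral_add_left_eq_self _ y]
        simp
    _ = ∫⁻ z, ∫⁻ y, ENNReal.ofReal (Real.exp (-(4 * s)⁻¹ * ‖z‖ ^ 2)) *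
          ‖u (y + z) - u y‖ₑ ^ 2 := by
        refine lintegral_lintegral_swap (Measurable.aemeasurable ?_)
        fun_prop
    _ = ∫⁻ z, ∫⁻ ξ, ENNReal.ofReal (Real.exp (-(4 * s)⁻¹ * ‖z‖ ^ 2)) *
          ‖(Real.fourierChar (inner ℝ z ξ) : ℂ) - 1‖ₑ ^ 2 * ‖(𝓕 u : L2 d) ξ‖ₑ ^ 2 := by
        refine lintegral_congr fun z => ?_
        rw [lintegral_const_mul' _ _ ENNReal.ofReal_ne_top, lintegral_translate_sub,
          ← lintegral_const_mul' _ _ ENNReal.ofReal_ne_top]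
        simp only [mul_assoc]
    _ = ∫⁻ ξ, ∫⁻ z, ENNReal.ofReal (Real.exp (-(4 * s)⁻¹ * ‖z‖ ^ 2)) *
          ‖(Real.fourierChar (inner ℝ z ξ) : ℂ) - 1‖ₑ ^ 2 * ‖(𝓕 u : L2 d) ξ‖ₑ ^ 2 := by
        refine lintegral_lintegral_swap (Measurable.aemeasurable ?_)
        have : Measurable fun p : E d × E d => (Real.fourierChar (inner ℝ p.1 p.2) : ℂ) :=
          (continuous_subtype_val.comp (Real.continuous_fourierChar.comp (by fun_prop))).measurable
        fun_prop
    _ = ENNReal.ofReal (2 * (4 * Real.pi * s) ^ ((d : ℝ) / 2)) * heatEnergy s u := by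
        rw [heatEnergy, ← lintegral_const_mul' _ _ ENNReal.ofReal_ne_top]
        refine lintegral_congr fun ξ => ?_
        rw [lintegral_mul_const' _ _ (by simp), lintegral_gaussian_mul_fourierChar_sub_one hb,
          ← mul_assoc (ENNReal.ofReal _) (ENNReal.ofReal _),
          ← ENNReal.ofReal_mul (by positivity)]
        congr 2
        rw [show Real.pi / (4 * s)⁻¹ = 4 * Real.pi * s by field_simp,
          show ‖(2 * Real.pi) • ξ‖ ^ 2 / (4 * (4 * s)⁻¹) = s * ‖(2 * Real.pi) • ξ‖ ^ 2 by
            field_simp]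
        ring

end Heat

/-! ### Subordination of `√(t + m²) - m` to the heat semigroup -/

section Subordination

theorem psi_nonneg {m t : ℝ} (ht : 0 ≤ t) : 0 ≤ psi m t := by
  have : |m| ≤ √(t + m ^ 2) := by rw [← Real.sqrt_sq_eq_abs]; exact Real.sqrt_le_sqrt (by linarith)
  rw [psi]; linarith [le_abs_self m]

theorem lintegral_rpow_neg_half_mul_exp {r : ℝ} (hr : 0 < r) :
    ∫⁻ s in Set.Ioi (0 : ℝ), ENNReal.ofReal (s ^ (-(1 / 2) : ℝ) * Real.exp (-(r * s))) =
      ENNReal.ofReal (√Real.pi * r ^ (-(1 / 2) : ℝ)) := by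
  have h := Real.integral_rpow_mul_exp_neg_mul_Ioi (a := 1 / 2) (by norm_num) hr
  have hv : (1 / r) ^ (1 / 2 : ℝ) * Real.Gamma (1 / 2) = √Real.pi * r ^ (-(1 / 2) : ℝ) := by
    rw [Real.Gamma_one_half_eq, one_div, Real.inv_rpow hr.le, Real.rpow_neg hr.le, mul_comm]
  rw [hv, show (1 / 2 - 1 : ℝ) = -(1 / 2) by norm_num] at h
  have pos : 0 < √Real.pi * r ^ (-(1 / 2) : ℝ) :=
    mul_pos (Real.sqrt_pos.2 Real.pi_pos) (Real.rpow_pos_of_pos hr _)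
  rw [← h, ← ofReal_integral_eq_lintegral_ofReal]
  · exact Integrable.of_integral_ne_zero (by rw [h]; exact pos.ne')
  · filter_upwards [ae_restrict_mem measurableSet_Ioi] with s hs
    exact mul_nonneg (Real.rpow_nonneg (le_of_lt hs) _) (Real.exp_pos _).le

theorem lintegral_Ioc_rpow_neg_half {a b : ℝ} (ha : 0 ≤ a) (hab : a ≤ b) :
    ∫⁻ r in Set.Ioc a b, ENNReal.ofReal (√Real.pi * r ^ (-(1 / 2) : ℝ)) =
      ENNReal.ofReal (2 * √Real.pi * (√b - √a)) := by
  have h : ∫ r in a..b, r ^ (-(1 / 2) : ℝ) = 2 * (√b - √a) := by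
    rw [integral_rpow (Or.inl (by norm_num)), Real.sqrt_eq_rpow, Real.sqrt_eq_rpow]
    norm_num
    ring
  have hi : IntervalIntegrable (fun r : ℝ => r ^ (-(1 / 2) : ℝ)) volume a b :=
    intervalIntegral.intervalIntegrable_rpow' (by norm_num)
  rw [intervalIntegral.integral_of_le hab] at h
  rw [intervalIntegrable_iff_integrableOn_Ioc_of_le hab] at hi
  rw [← ofReal_integral_eq_lintegral_ofReal (hi.const_mul _), integral_const_mul, h]
  · congr 1; ring
  · filter_upwards [ae_restrict_mem measurableSet_Ioc] with r hr
    exact mul_nonneg (Real.sqrt_nonneg _) (Real.rpow_nonneg (ha.trans hr.1.le) _)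

/-- `ψ_m` as a superposition of the functions `1 - e^{-st}` with positive weights. -/
theorem lintegral_subordination {m t : ℝ} (hm : 0 ≤ m) (ht : 0 ≤ t) :
    ∫⁻ s in Set.Ioi (0 : ℝ), ENNReal.ofReal (Real.exp (-(m ^ 2 * s)) * s ^ (-(3 / 2) : ℝ)) *
      ENNReal.ofReal (1 - Real.exp (-(s * t))) = ENNReal.ofReal (2 * √Real.pi * psi m t) := by
  -- `e^{-m²s} (1 - e^{-st}) / s` is the integral of `e^{-rs}` over `m² < r ≤ m² + t`
  have inner : ∀ s ∈ Set.Ioi (0 : ℝ),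
      ENNReal.ofReal (Real.exp (-(m ^ 2 * s)) * s ^ (-(3 / 2) : ℝ)) *
        ENNReal.ofReal (1 - Real.exp (-(s * t))) =
      ∫⁻ r in Set.Ioc (m ^ 2) (m ^ 2 + t),
        ENNReal.ofReal (s ^ (-(1 / 2) : ℝ) * Real.exp (-(r * s))) := by
    intro s hs
    have hs : 0 < s := hs
    have h1 : ∫ r in (m ^ 2)..(m ^ 2 + t), Real.exp (-(r * s)) =
        (Real.exp (-(m ^ 2 * s)) - Real.exp (-((m ^ 2 + t) * s))) / s := by
      have hd : ∀ r ∈ Set.uIcc (m ^ 2) (m ^ 2 + t),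
          HasDerivAt (fun r => -(Real.exp (-(r * s))) / s) (Real.exp (-(r * s))) r := by
        intro r _
        have := ((((hasDerivAt_id r).mul_const s).neg.exp).neg).div_const s
        simp only [id, one_mul] at this
        refine this.congr_deriv ?_
        field_simp
        simp [mul_comm]
      rw [intervalIntegral.integral_eq_sub_of_hasDerivAt hd
        (Continuous.intervalIntegrable (by fun_prop) _ _)]
      ring
    rw [← ENNReal.ofReal_mul (by positivity), ← ofReal_integral_eq_lintegral_ofReal,
      ← intervalIntegral.integral_of_le (by linarith), intervalIntegral.integral_const_mul, h1]
    · congr 1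
      rw [show (-(1 / 2) : ℝ) = -(3 / 2) + 1 by norm_num, Real.rpow_add hs, Real.rpow_one,
        show -((m ^ 2 + t) * s) = -(m ^ 2 * s) + -(s * t) by ring, Real.exp_add]
      field_simp
    · exact (Continuous.integrableOn_Icc (by fun_prop)).mono_set Set.Ioc_subset_Icc_self
    · filter_upwards with r
      positivity
  rw [setLIntegral_congr_fun measurableSet_Ioi inner, lintegral_lintegral_swap
    (Measurable.aemeasurable (by fun_prop))]
  have h2 : ∀ r ∈ Set.Ioc (m ^ 2) (m ^ 2 + t), ∫⁻ s in Set.Ioi (0 : ℝ),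
      ENNReal.ofReal (s ^ (-(1 / 2) : ℝ) * Real.exp (-(r * s))) =
      ENNReal.ofReal (√Real.pi * r ^ (-(1 / 2) : ℝ)) := fun r hr =>
    lintegral_rpow_neg_half_mul_exp (lt_of_le_of_lt (sq_nonneg m) hr.1)
  rw [setLIntegral_congr_fun measurableSet_Ioc h2,
    lintegral_Ioc_rpow_neg_half (sq_nonneg m) (by linarith), Real.sqrt_sq hm, psi, add_comm t]

end Subordination

/-! ### The quadratic form under a change of variables -/

noncomputable section Energy

variable {d : ℕ}

/-- `q_m(u)` with values in `[0, ∞]`, defined on all of `L²`. -/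
def energy (m : ℝ) (u : L2 d) : ℝ≥0∞ :=
  ∫⁻ ξ : E d, ENNReal.ofReal (psi m (‖(2 * Real.pi) • ξ‖ ^ 2)) * ‖(𝓕 u : L2 d) ξ‖ₑ ^ 2

theorem measurable_psi_symbol (m : ℝ) :
    Measurable fun ξ : E d => psi m (‖(2 * Real.pi) • ξ‖ ^ 2) := by
  unfold psi; fun_prop

/-- `q_m` as a superposition of heat energies. -/
theorem energy_eq {m : ℝ} (hm : 0 ≤ m) (u : L2 d) :
    ENNReal.ofReal (2 * √Real.pi) * energy m u =
      ∫⁻ s in Set.Ioi (0 : ℝ), ENNReal.ofReal (Real.exp (-(m ^ 2 * s)) * s ^ (-(3 / 2) : ℝ)) *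
        heatEnergy s u := by
  have mF : Measurable ((𝓕 u : L2 d) : E d → ℂ) := (Lp.stronglyMeasurable _).measurable
  have h1 : ∀ s : ℝ, ENNReal.ofReal (Real.exp (-(m ^ 2 * s)) * s ^ (-(3 / 2) : ℝ)) *
      heatEnergy s u = ∫⁻ ξ, ENNReal.ofReal (Real.exp (-(m ^ 2 * s)) * s ^ (-(3 / 2) : ℝ)) *
        ENNReal.ofReal (1 - Real.exp (-(s * ‖(2 * Real.pi) • ξ‖ ^ 2))) *
          ‖(𝓕 u : L2 d) ξ‖ₑ ^ 2 := by
    intro s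
    rw [heatEnergy, ← lintegral_const_mul' _ _ ENNReal.ofReal_ne_top]
    simp only [mul_assoc]
  simp only [h1]
  rw [lintegral_lintegral_swap (Measurable.aemeasurable (by fun_prop)), energy,
    ← lintegral_const_mul' _ _ ENNReal.ofReal_ne_top]
  refine lintegral_congr fun ξ => ?_
  rw [lintegral_mul_const' _ _ (by simp), lintegral_subordination hm (by positivity), ← mul_assoc,
    ← ENNReal.ofReal_mul (by positivity)]

/-- A measure preserving `L`-Lipschitz change of variables increases each heat energy at most by
the factor `L^{d+2}`. -/
theorem heatEnergy_comp_le {T : E d → E d} (hT : MeasurePreserving T volume volume) {L : ℝ}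
    (hL : 1 ≤ L) (hTL : ∀ x y, ‖T x - T y‖ ≤ L * ‖x - y‖) {s : ℝ} (hs : 0 < s) (v : L2 d) :
    heatEnergy s (Lp.compMeasurePreserving T hT v) ≤
      ENNReal.ofReal (L ^ (d + 2)) * heatEnergy s v := by
  have hL0 : 0 < L := by linarith
  set u := Lp.compMeasurePreserving T hT v with hu
  have mv : Measurable (v : E d → ℂ) := (Lp.stronglyMeasurable v).measurable
  have hs' : 0 < s / L ^ 2 := by positivity
  have ae : ∀ᵐ x, u x = v (T x) := Lp.coeFn_compMeasurePreserving v hT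
  -- the kernel `e^{-|x-y|²/4s}` is radially decreasing
  have h1 : heatForm (s / L ^ 2) u ≤ heatForm s v := by
    have e : heatForm s v = ∫⁻ x, ∫⁻ y,
        ENNReal.ofReal (Real.exp (-(4 * s)⁻¹ * ‖T x - T y‖ ^ 2)) * ‖v (T x) - v (T y)‖ₑ ^ 2 := by
      rw [heatForm, ← hT.lintegral_comp (Measurable.lintegral_prod_right (by fun_prop))]
      refine lintegral_congr fun x => ?_
      rw [← hT.lintegral_comp (by fun_prop)]
    rw [e, heatForm]
    refine lintegral_mono_ae ?_
    filter_upwards [ae] with x hx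
    refine lintegral_mono_ae ?_
    filter_upwards [ae] with y hy
    rw [hx, hy]
    gcongr ENNReal.ofReal (Real.exp ?_) * _
    have : ‖T x - T y‖ ^ 2 ≤ L ^ 2 * ‖x - y‖ ^ 2 := by
      rw [← mul_pow]; exact pow_le_pow_left₀ (norm_nonneg _) (hTL x y) 2
    rw [neg_mul, neg_mul, neg_le_neg_iff]
    calc (4 * s)⁻¹ * ‖T x - T y‖ ^ 2 ≤ (4 * s)⁻¹ * (L ^ 2 * ‖x - y‖ ^ 2) := by gcongr
      _ = (4 * (s / L ^ 2))⁻¹ * ‖x - y‖ ^ 2 := by field_simp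
  rw [heatForm_eq hs', heatForm_eq hs] at h1
  -- concavity of `1 - e^{-t}`
  have h2 : heatEnergy s u ≤ ENNReal.ofReal (L ^ 2) * heatEnergy (s / L ^ 2) u := by
    rw [heatEnergy, heatEnergy, ← lintegral_const_mul' _ _ ENNReal.ofReal_ne_top]
    refine lintegral_mono fun ξ => ?_
    rw [← mul_assoc, ← ENNReal.ofReal_mul (by positivity)]
    gcongr ENNReal.ofReal ?_ * _
    set t := ‖(2 * Real.pi) • ξ‖ ^ 2
    have hb := one_add_mul_self_le_rpow_one_add (s := Real.exp (-(s / L ^ 2 * t)) - 1)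
      (by linarith [Real.exp_pos (-(s / L ^ 2 * t))]) (p := L ^ 2) (one_le_pow₀ hL)
    rw [add_sub_cancel, ← Real.exp_mul, show -(s / L ^ 2 * t) * L ^ 2 = -(s * t) by
      field_simp] at hb
    linarith
  have e3 : ENNReal.ofReal (2 * (4 * Real.pi * s) ^ ((d : ℝ) / 2)) =
      ENNReal.ofReal (2 * (4 * Real.pi * (s / L ^ 2)) ^ ((d : ℝ) / 2)) *
        ENNReal.ofReal (L ^ d) := by
    rw [← ENNReal.ofReal_mul (by positivity)]
    congr 1
    have e4 : (L ^ 2) ^ ((d : ℝ) / 2) = L ^ d := by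
      rw [← Real.rpow_natCast L 2, ← Real.rpow_mul hL0.le,
        show ((2 : ℕ) : ℝ) * ((d : ℝ) / 2) = (d : ℝ) by push_cast; ring, Real.rpow_natCast]
    rw [show 4 * Real.pi * s = 4 * Real.pi * (s / L ^ 2) * L ^ 2 by field_simp,
      Real.mul_rpow (by positivity) (by positivity), e4, ← mul_assoc 2]
  rw [e3, mul_assoc (ENNReal.ofReal _), ENNReal.mul_le_mul_iff_right
    (by rw [ne_eq, ENNReal.ofReal_eq_zero, not_le]; positivity) ENNReal.ofReal_ne_top] at h1
  calc heatEnergy s u ≤ ENNReal.ofReal (L ^ 2) * heatEnergy (s / L ^ 2) u := h2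
    _ ≤ ENNReal.ofReal (L ^ 2) * (ENNReal.ofReal (L ^ d) * heatEnergy s v) := by gcongr
    _ = _ := by rw [← mul_assoc, ← ENNReal.ofReal_mul (by positivity), ← pow_add, add_comm 2 d]

theorem energy_comp_le {T : E d → E d} (hT : MeasurePreserving T volume volume) {L : ℝ}
    (hL : 1 ≤ L) (hTL : ∀ x y, ‖T x - T y‖ ≤ L * ‖x - y‖) {m : ℝ} (hm : 0 ≤ m) (v : L2 d) :
    energy m (Lp.compMeasurePreserving T hT v) ≤ ENNReal.ofReal (L ^ (d + 2)) * energy m v := by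
  have pos : 0 < 2 * √Real.pi := by positivity
  rw [← ENNReal.mul_le_mul_iff_right (a := ENNReal.ofReal (2 * √Real.pi))
    (by rw [ne_eq, ENNReal.ofReal_eq_zero, not_le]; exact pos) ENNReal.ofReal_ne_top,
    mul_left_comm, energy_eq hm, energy_eq hm, ← lintegral_const_mul' _ _ ENNReal.ofReal_ne_top]
  refine setLIntegral_mono' measurableSet_Ioi fun s hs => ?_
  rw [mul_left_comm]
  gcongr
  exact heatEnergy_comp_le hT hL hTL hs v

theorem enorm_fourier (u : L2 d) : ‖(𝓕 u : L2 d)‖ₑ = ‖u‖ₑ := by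
  rw [← ofReal_norm, ← ofReal_norm, Lp.norm_fourier_eq]

theorem heatEnergy_le_enorm_sq (s : ℝ) (u : L2 d) : heatEnergy s u ≤ ‖u‖ₑ ^ 2 := by
  rw [← enorm_fourier, enorm_sq_eq_lintegral, heatEnergy]
  refine lintegral_mono fun ξ => mul_le_of_le_one_left' ?_
  rw [ENNReal.ofReal_le_one]
  linarith [Real.exp_pos (-(s * ‖(2 * Real.pi) • ξ‖ ^ 2))]

/-- A bound for `q_0(u)` from bounds for the heat energies: small times are controlled by the
hypothesis, large times by the `L²` norm. -/
theorem energy_zero_le {u v : L2 d} {c A : ℝ≥0∞}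
    (h : ∀ s : ℝ, 0 < s → heatEnergy s u ≤ c * heatEnergy s v + A * ENNReal.ofReal s)
    {σ : ℝ} (hσ : 0 < σ) :
    energy 0 u ≤ c * energy 0 v + A * ENNReal.ofReal √σ + ‖u‖ₑ ^ 2 * ENNReal.ofReal (√σ)⁻¹ := by
  have one_le : 1 ≤ √Real.pi := by
    rw [Real.one_le_sqrt]; linarith [Real.pi_gt_three]
  have pos : 0 < 2 * √Real.pi := by positivity
  have hw : ∀ w : L2 d, ENNReal.ofReal (2 * √Real.pi) * energy 0 w =
      ∫⁻ s in Set.Ioi (0 : ℝ), ENNReal.ofReal (s ^ (-(3 / 2) : ℝ)) * heatEnergy s w := by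
    intro w
    rw [energy_eq le_rfl]
    simp
  have I1 : ∫⁻ s in Set.Ioc 0 σ, ENNReal.ofReal (s ^ (-(1 / 2) : ℝ)) = ENNReal.ofReal (2 * √σ) := by
    have h0 := lintegral_Ioc_rpow_neg_half le_rfl hσ.le
    simp only [ENNReal.ofReal_mul (Real.sqrt_nonneg Real.pi)] at h0
    rw [lintegral_const_mul' _ _ ENNReal.ofReal_ne_top, Real.sqrt_zero, sub_zero,
      show 2 * √Real.pi * √σ = √Real.pi * (2 * √σ) by ring,
      ENNReal.ofReal_mul (Real.sqrt_nonneg Real.pi)] at h0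
    rwa [ENNReal.mul_right_inj _ ENNReal.ofReal_ne_top] at h0
    rw [ne_eq, ENNReal.ofReal_eq_zero, not_le]; positivity
  have I2 : ∫⁻ s in Set.Ioi σ, ENNReal.ofReal (s ^ (-(3 / 2) : ℝ)) =
      ENNReal.ofReal (2 * (√σ)⁻¹) := by
    rw [← ofReal_integral_eq_lintegral_ofReal, integral_Ioi_rpow_of_lt (by norm_num) hσ]
    · congr 1
      rw [show (-(3 / 2) + 1 : ℝ) = -(1 / 2) by norm_num, Real.rpow_neg hσ.le, Real.sqrt_eq_rpow]
      ring
    · exact integrableOn_Ioi_rpow_of_lt (by norm_num) hσ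
    · filter_upwards [ae_restrict_mem measurableSet_Ioi] with s hs
      exact Real.rpow_nonneg (hσ.le.trans (le_of_lt hs)) _
  have mE : Measurable fun s : ℝ => heatEnergy s v := by
    have mF : Measurable ((𝓕 v : L2 d) : E d → ℂ) := (Lp.stronglyMeasurable _).measurable
    unfold heatEnergy
    exact Measurable.lintegral_prod_right (by fun_prop)
  rw [← ENNReal.mul_le_mul_iff_right (a := ENNReal.ofReal (2 * √Real.pi))
    (by rw [ne_eq, ENNReal.ofReal_eq_zero, not_le]; exact pos) ENNReal.ofReal_ne_top, hw]
  calc ∫⁻ s in Set.Ioi (0 : ℝ), ENNReal.ofReal (s ^ (-(3 / 2) : ℝ)) * heatEnergy s u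
      ≤ ∫⁻ s in Set.Ioi (0 : ℝ), (c * (ENNReal.ofReal (s ^ (-(3 / 2) : ℝ)) * heatEnergy s v) +
          ((Set.Ioc 0 σ).indicator (fun s => A * ENNReal.ofReal (s ^ (-(1 / 2) : ℝ))) s +
           (Set.Ioi σ).indicator (fun s => ‖u‖ₑ ^ 2 * ENNReal.ofReal (s ^ (-(3 / 2) : ℝ))) s)) := by
        refine setLIntegral_mono' measurableSet_Ioi fun s (hs : 0 < s) => ?_
        rcases le_or_gt s σ with hsσ | hsσ
        · rw [Set.indicator_of_mem (show s ∈ Set.Ioc 0 σ from ⟨hs, hsσ⟩)]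
          refine (mul_le_mul_right (h s hs) _).trans ?_
          rw [mul_add, mul_left_comm, mul_left_comm _ A, ← ENNReal.ofReal_mul (by positivity),
            show s ^ (-(3 / 2) : ℝ) * s = s ^ (-(1 / 2) : ℝ) by
              rw [show (-(1 / 2) : ℝ) = -(3 / 2) + 1 by norm_num, Real.rpow_add hs, Real.rpow_one]]
          gcongr
          exact le_self_add
        · rw [Set.indicator_of_mem (show s ∈ Set.Ioi σ from hsσ), mul_comm (‖u‖ₑ ^ 2)]
          refine (mul_le_mul_right (heatEnergy_le_enorm_sq s u) _).trans ?_
          exact le_add_self.trans (le_add_self)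
    _ = c * (ENNReal.ofReal (2 * √Real.pi) * energy 0 v) + (A * ENNReal.ofReal (2 * √σ) +
          ‖u‖ₑ ^ 2 * ENNReal.ofReal (2 * (√σ)⁻¹)) := by
        rw [lintegral_add_left (by fun_prop), lintegral_add_left, hw, ← I1, ← I2,
          lintegral_const_mul _ (by fun_prop), lintegral_indicator measurableSet_Ioc,
          lintegral_indicator measurableSet_Ioi, Measure.restrict_restrict measurableSet_Ioc,
          Measure.restrict_restrict measurableSet_Ioi,
          Set.inter_eq_left.2 Set.Ioc_subset_Ioi_self,
          Set.inter_eq_left.2 (Set.Ioi_subset_Ioi hσ.le), lintegral_const_mul _ (by fun_prop),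
          lintegral_const_mul _ (by fun_prop)]
        exact Measurable.indicator (by fun_prop) measurableSet_Ioc
    _ ≤ _ := by
        rw [mul_add, mul_add, mul_left_comm c, mul_left_comm _ A, mul_left_comm _ (‖u‖ₑ ^ 2),
          add_assoc, ← ENNReal.ofReal_mul pos.le, ← ENNReal.ofReal_mul pos.le]
        gcongr <;> nlinarith

end Energy

/-! ### The spaces `H^{1/2}` and `H_0^{1/2}` -/

noncomputable section SobolevHalf

variable {d : ℕ}

theorem enorm_add_sq_le {F : Type*} [NormedAddCommGroup F] (a b : F) :
    ‖a + b‖ₑ ^ 2 ≤ 2 * ‖a‖ₑ ^ 2 + 2 * ‖b‖ₑ ^ 2 := by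
  have e : (2 : ℝ≥0∞) = ENNReal.ofReal 2 := by norm_num
  rw [enorm_sq_eq_ofReal, enorm_sq_eq_ofReal, enorm_sq_eq_ofReal, e,
    ← ENNReal.ofReal_mul zero_le_two, ← ENNReal.ofReal_mul zero_le_two,
    ← ENNReal.ofReal_add (by positivity) (by positivity)]
  refine ENNReal.ofReal_le_ofReal ?_
  have h := pow_le_pow_left₀ (norm_nonneg _) (norm_add_le a b) 2
  nlinarith [sq_nonneg (‖a‖ - ‖b‖)]

theorem lintegral_weight_fourier_add_le (W : E d → ℝ≥0∞) (hW : Measurable W) (u v : L2 d) :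
    ∫⁻ ξ, W ξ * ‖(𝓕 (u + v) : L2 d) ξ‖ₑ ^ 2 ≤
      2 * (∫⁻ ξ, W ξ * ‖(𝓕 u : L2 d) ξ‖ₑ ^ 2) + 2 * ∫⁻ ξ, W ξ * ‖(𝓕 v : L2 d) ξ‖ₑ ^ 2 := by
  have mu : Measurable ((𝓕 u : L2 d) : E d → ℂ) := (Lp.stronglyMeasurable _).measurable
  have mv : Measurable ((𝓕 v : L2 d) : E d → ℂ) := (Lp.stronglyMeasurable _).measurable
  rw [← lintegral_const_mul _ (by fun_prop), ← lintegral_const_mul _ (by fun_prop),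
    ← lintegral_add_left (by fun_prop)]
  refine lintegral_mono_ae ?_
  have e : (𝓕 (u + v) : L2 d) = 𝓕 u + 𝓕 v := map_add (Lp.fourierTransformₗᵢ (E d) ℂ) u v
  rw [e]
  filter_upwards [Lp.coeFn_add (𝓕 u : L2 d) (𝓕 v)] with ξ h
  rw [h, Pi.add_apply, mul_left_comm 2, mul_left_comm 2, ← mul_add]
  gcongr
  exact enorm_add_sq_le _ _

/-- `‖u‖² + q_0(u)`, the square of a norm equivalent to the one of `H^{1/2}(ℝ^d)`. -/
def halfNormSq (u : L2 d) : ℝ≥0∞ := ‖u‖ₑ ^ 2 + energy 0 u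

theorem sobolevHalfSq_le (u : L2 d) : sobolevHalfSq u ≤ halfNormSq u := by
  have mu : Measurable ((𝓕 u : L2 d) : E d → ℂ) := (Lp.stronglyMeasurable _).measurable
  rw [halfNormSq, ← enorm_fourier, enorm_sq_eq_lintegral, sobolevHalfSq, energy,
    ← lintegral_add_left (by fun_prop)]
  refine lintegral_mono fun ξ => ?_
  nth_rewrite 2 [← one_mul (‖(𝓕 u : L2 d) ξ‖ₑ ^ 2)]
  rw [← add_mul, ← ENNReal.ofReal_one, ← ENNReal.ofReal_add zero_le_one
    (psi_nonneg (by positivity))]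
  gcongr
  have h1 : psi 0 (‖(2 * Real.pi) • ξ‖ ^ 2) = 2 * Real.pi * ‖ξ‖ := by
    rw [psi, norm_smul, Real.norm_of_nonneg (by positivity)]
    norm_num
    exact Real.sqrt_sq (by positivity)
  rw [h1, Real.sqrt_le_left (by positivity)]
  have : 1 ≤ Real.pi := by linarith [Real.pi_gt_three]
  have h2 : ‖ξ‖ ≤ 2 * Real.pi * ‖ξ‖ := le_mul_of_one_le_left (norm_nonneg _) (by linarith)
  nlinarith [norm_nonneg ξ]

theorem halfNormSq_le (u : L2 d) : halfNormSq u ≤ ENNReal.ofReal (1 + 2 * Real.pi) *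
    sobolevHalfSq u := by
  have mu : Measurable ((𝓕 u : L2 d) : E d → ℂ) := (Lp.stronglyMeasurable _).measurable
  rw [halfNormSq, ← enorm_fourier, enorm_sq_eq_lintegral, sobolevHalfSq, energy,
    ← lintegral_add_left (by fun_prop), ← lintegral_const_mul' _ _ ENNReal.ofReal_ne_top]
  refine lintegral_mono fun ξ => ?_
  nth_rewrite 1 [← one_mul (‖(𝓕 u : L2 d) ξ‖ₑ ^ 2)]
  rw [← add_mul, ← ENNReal.ofReal_one, ← ENNReal.ofReal_add zero_le_one
    (psi_nonneg (by positivity)), ← mul_assoc, ← ENNReal.ofReal_mul (by positivity)]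
  gcongr
  have h1 : psi 0 (‖(2 * Real.pi) • ξ‖ ^ 2) = 2 * Real.pi * ‖ξ‖ := by
    rw [psi, norm_smul, Real.norm_of_nonneg (by positivity)]
    norm_num
    exact Real.sqrt_sq (by positivity)
  rw [h1]
  have h2 : 1 ≤ √(1 + ‖ξ‖ ^ 2) := by rw [Real.one_le_sqrt]; nlinarith [norm_nonneg ξ]
  have h3 : ‖ξ‖ ≤ √(1 + ‖ξ‖ ^ 2) := Real.le_sqrt_of_sq_le (by linarith)
  have := mul_le_mul_of_nonneg_left h3 (by positivity : (0 : ℝ) ≤ 2 * Real.pi)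
  nlinarith

theorem sobolevHalfSq_add_le (u v : L2 d) :
    sobolevHalfSq (u + v) ≤ 2 * sobolevHalfSq u + 2 * sobolevHalfSq v :=
  lintegral_weight_fourier_add_le _ (by fun_prop) u v

/-- `H_0^{1/2}` is closed in `H^{1/2}`. -/
theorem memH0Half_of_approx {Ω : Set (E d)} {u : L2 d}
    (h : ∀ ε : ℝ≥0∞, 0 < ε → ∃ w, MemH0Half Ω w ∧ sobolevHalfSq (u - w) < ε) : MemH0Half Ω u := by
  intro ε hε
  have hε' : 0 < ε / 4 := ENNReal.div_pos hε.ne' (by norm_num)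
  obtain ⟨w, hw, h1⟩ := h (ε / 4) hε'
  obtain ⟨η, hη, c1, c2, c3, h2⟩ := hw (ε / 4) hε'
  refine ⟨η, hη, c1, c2, c3, ?_⟩
  rw [← sub_add_sub_cancel u w]
  refine (sobolevHalfSq_add_le _ _).trans_lt ?_
  rw [← mul_add]
  have : ε = 2 * (ε / 4 + ε / 4) := by
    rw [← two_mul, ← mul_assoc, ← ENNReal.mul_comm_div, show (2 * 2 : ℝ≥0∞) = 4 by norm_num,
      ENNReal.div_self (by norm_num) (by norm_num), one_mul]
  rw [this]
  exact ENNReal.mul_lt_mul_right (by norm_num) (by norm_num) (ENNReal.add_lt_add h1 h2)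

theorem lintegral_gaussian_second_moment {s : ℝ} (hs : 0 < s) :
    ∫⁻ z : E d, ENNReal.ofReal (Real.exp (-(4 * s)⁻¹ * ‖z‖ ^ 2)) * ‖z‖ₑ ^ 2 ≤
      ENNReal.ofReal (2 * (4 * Real.pi * s) ^ ((d : ℝ) / 2)) *
        ENNReal.ofReal (4 * 2 ^ ((d : ℝ) / 2) * s) := by
  have hb : 0 < (8 * s)⁻¹ := by positivity
  have pos : 0 < (Real.pi / (8 * s)⁻¹) ^ ((Module.finrank ℝ (E d) : ℝ) / 2) := by positivity
  have i := GaussianFourier.integral_rexp_neg_mul_sq_norm (V := E d) hb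
  calc ∫⁻ z : E d, ENNReal.ofReal (Real.exp (-(4 * s)⁻¹ * ‖z‖ ^ 2)) * ‖z‖ₑ ^ 2
      ≤ ∫⁻ z : E d, ENNReal.ofReal (8 * s) * ENNReal.ofReal (Real.exp (-(8 * s)⁻¹ * ‖z‖ ^ 2)) := by
        refine lintegral_mono fun z => ?_
        rw [enorm_sq_eq_ofReal, ← ENNReal.ofReal_mul (by positivity),
          ← ENNReal.ofReal_mul (by positivity)]
        refine ENNReal.ofReal_le_ofReal ?_
        have h1 := Real.add_one_le_exp ((8 * s)⁻¹ * ‖z‖ ^ 2)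
        have h2 : ‖z‖ ^ 2 ≤ 8 * s * Real.exp ((8 * s)⁻¹ * ‖z‖ ^ 2) := by
          calc ‖z‖ ^ 2 = 8 * s * ((8 * s)⁻¹ * ‖z‖ ^ 2) := by field_simp
            _ ≤ _ := by gcongr; linarith
        calc _ ≤ Real.exp (-(4 * s)⁻¹ * ‖z‖ ^ 2) *
              (8 * s * Real.exp ((8 * s)⁻¹ * ‖z‖ ^ 2)) := by gcongr
          _ = 8 * s * Real.exp (-(4 * s)⁻¹ * ‖z‖ ^ 2 + (8 * s)⁻¹ * ‖z‖ ^ 2) := by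
            rw [Real.exp_add]; ring
          _ = _ := by congr 2; field_simp; ring
    _ = ENNReal.ofReal (8 * s) * ENNReal.ofReal
          ((Real.pi / (8 * s)⁻¹) ^ ((Module.finrank ℝ (E d) : ℝ) / 2)) := by
        rw [lintegral_const_mul' _ _ ENNReal.ofReal_ne_top, ← i,
          ofReal_integral_eq_lintegral_ofReal]
        · exact Integrable.of_integral_ne_zero (by rw [i]; exact pos.ne')
        · filter_upwards with z
          positivity
    _ ≤ _ := by
        rw [← ENNReal.ofReal_mul (by positivity), ← ENNReal.ofReal_mul (by positivity)]
        refine ENNReal.ofReal_le_ofReal (le_of_eq ?_)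
        rw [finrank_euclideanSpace_fin,
          show Real.pi / (8 * s)⁻¹ = 4 * Real.pi * s * 2 by field_simp; ring,
          Real.mul_rpow (by positivity) (by positivity)]
        ring

/-- A pointwise bound for the differences of `v` bounds its heat energy. -/
theorem heatEnergy_le_of_pointwise {u v : L2 d} {c : ℝ≥0∞} (hc : c ≠ ⊤) {G : E d → ℝ≥0∞}
    (hG : Measurable G)
    (h : ∀ᵐ x, ∀ᵐ y, ‖v x - v y‖ₑ ^ 2 ≤ c * ‖u x - u y‖ₑ ^ 2 + ‖x - y‖ₑ ^ 2 * (G x + G y))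
    {s : ℝ} (hs : 0 < s) :
    heatEnergy s v ≤ c * heatEnergy s u +
      ENNReal.ofReal (8 * 2 ^ ((d : ℝ) / 2)) * (∫⁻ x, G x) * ENNReal.ofReal s := by
  have mu : Measurable (u : E d → ℂ) := (Lp.stronglyMeasurable u).measurable
  set k : E d → ℝ≥0∞ := fun z => ENNReal.ofReal (Real.exp (-(4 * s)⁻¹ * ‖z‖ ^ 2)) with hk
  have mk : Measurable k := by fun_prop
  set J : ℝ≥0∞ := ∫⁻ z : E d, k z * ‖z‖ₑ ^ 2 with hJ
  have hsym : ∀ x y : E d, k (x - y) * ‖x - y‖ₑ ^ 2 = k (y - x) * ‖y - x‖ₑ ^ 2 := fun x y => by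
    simp only [hk]
    rw [norm_sub_rev, ← enorm_neg, neg_sub]
  have hJ1 : ∀ x : E d, ∫⁻ y, k (x - y) * ‖x - y‖ₑ ^ 2 = J := by
    intro x
    simp only [hsym x]
    exact lintegral_sub_right_eq_self (fun z => k z * ‖z‖ₑ ^ 2) x
  have hJ2 : ∀ y : E d, ∫⁻ x, k (x - y) * ‖x - y‖ₑ ^ 2 = J := fun y =>
    lintegral_sub_right_eq_self (fun z => k z * ‖z‖ₑ ^ 2) y
  have key : heatForm s v ≤ c * heatForm s u + 2 * (J * ∫⁻ x, G x) := by
    calc heatForm s v ≤ ∫⁻ x, ∫⁻ y, (c * (k (x - y) * ‖u x - u y‖ₑ ^ 2) +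
          (k (x - y) * ‖x - y‖ₑ ^ 2 * G x + k (x - y) * ‖x - y‖ₑ ^ 2 * G y)) := by
          refine lintegral_mono_ae ?_
          filter_upwards [h] with x hx
          refine lintegral_mono_ae ?_
          filter_upwards [hx] with y hy
          refine (mul_le_mul_right hy _).trans (le_of_eq ?_)
          simp only [hk]
          ring
      _ = c * heatForm s u + ((∫⁻ x, ∫⁻ y, k (x - y) * ‖x - y‖ₑ ^ 2 * G x) +
            ∫⁻ x, ∫⁻ y, k (x - y) * ‖x - y‖ₑ ^ 2 * G y) := by
          rw [heatForm, ← lintegral_const_mul' _ _ hc, ← lintegral_add_left (by fun_prop),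
            ← lintegral_add_left (by fun_prop)]
          refine lintegral_congr fun x => ?_
          rw [lintegral_add_left (by fun_prop), lintegral_add_left (by fun_prop),
            lintegral_const_mul' _ _ hc]
      _ = c * heatForm s u + 2 * (J * ∫⁻ x, G x) := by
          have e1 : ∫⁻ x, ∫⁻ y, k (x - y) * ‖x - y‖ₑ ^ 2 * G x = J * ∫⁻ x, G x := by
            rw [← lintegral_const_mul _ hG]
            refine lintegral_congr fun x => ?_
            rw [lintegral_mul_const _ (by fun_prop), hJ1]
          have e2 : ∫⁻ x, ∫⁻ y, k (x - y) * ‖x - y‖ₑ ^ 2 * G y = J * ∫⁻ x, G x := by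
            rw [lintegral_lintegral_swap (Measurable.aemeasurable (by fun_prop)),
              ← lintegral_const_mul _ hG]
            refine lintegral_congr fun x => ?_
            rw [lintegral_mul_const _ (by fun_prop), hJ2]
          rw [e1, e2, two_mul]
  set Z := ENNReal.ofReal (2 * (4 * Real.pi * s) ^ ((d : ℝ) / 2)) with hZ
  have Z0 : Z ≠ 0 := by rw [hZ, ne_eq, ENNReal.ofReal_eq_zero, not_le]; positivity
  have Zt : Z ≠ ⊤ := ENNReal.ofReal_ne_top
  rw [heatForm_eq hs, heatForm_eq hs, ← hZ] at key
  rw [← ENNReal.mul_le_mul_iff_right Z0 Zt]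
  refine key.trans ?_
  have hJle : J ≤ Z * ENNReal.ofReal (4 * 2 ^ ((d : ℝ) / 2) * s) :=
    lintegral_gaussian_second_moment hs
  calc c * (Z * heatEnergy s u) + 2 * (J * ∫⁻ x, G x)
      ≤ c * (Z * heatEnergy s u) +
        2 * (Z * ENNReal.ofReal (4 * 2 ^ ((d : ℝ) / 2) * s) * ∫⁻ x, G x) := by gcongr
    _ = _ := by
      have e : ENNReal.ofReal (8 * 2 ^ ((d : ℝ) / 2)) * ENNReal.ofReal s =
          2 * ENNReal.ofReal (4 * 2 ^ ((d : ℝ) / 2) * s) := by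
        rw [show (2 : ℝ≥0∞) = ENNReal.ofReal 2 by norm_num, ← ENNReal.ofReal_mul (by positivity),
          ← ENNReal.ofReal_mul (by positivity)]
        congr 1; ring
      rw [mul_right_comm (ENNReal.ofReal (8 * _)), e]
      ring

/-- Multiplication by a compactly supported Lipschitz function is bounded on `H^{1/2}`. -/
theorem exists_halfNormSq_mulL2_le {χ : E d → ℝ} {B K : ℝ} (hχ : Continuous χ)
    (hs : HasCompactSupport χ) (hB : ∀ x, |χ x| ≤ B) (hK : ∀ x y, |χ x - χ y| ≤ K * ‖x - y‖) :
    ∃ C : ℝ≥0∞, C ≠ ⊤ ∧ ∀ u : L2 d, halfNormSq (mulL2 χ u) ≤ C * halfNormSq u := by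
  have hB0 : 0 ≤ B := (abs_nonneg _).trans (hB 0)
  set c := ENNReal.ofReal (B ^ 2)
  set k := ENNReal.ofReal (K ^ 2)
  set A := ENNReal.ofReal (8 * 2 ^ ((d : ℝ) / 2)) * (2 * k)
  refine ⟨2 * c + A + 2 * c, by finiteness, fun u => ?_⟩
  have mu : Measurable (u : E d → ℂ) := (Lp.stronglyMeasurable u).measurable
  have ae := mulL2_ae χ hχ hs u
  have hχe : ∀ x, ‖(χ x : ℂ)‖ₑ ^ 2 ≤ c := fun x => by
    rw [enorm_sq_eq_ofReal, Complex.norm_real, Real.norm_eq_abs]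
    exact ENNReal.ofReal_le_ofReal (pow_le_pow_left₀ (abs_nonneg _) (hB x) 2)
  have norm_le : ‖mulL2 χ u‖ₑ ^ 2 ≤ c * ‖u‖ₑ ^ 2 := by
    rw [enorm_sq_eq_lintegral, enorm_sq_eq_lintegral, ← lintegral_const_mul' _ _
      ENNReal.ofReal_ne_top]
    refine lintegral_mono_ae ?_
    filter_upwards [ae] with x hx
    rw [hx, enorm_mul, mul_pow]
    exact mul_le_mul_left (hχe x) _
  have heat : ∀ s : ℝ, 0 < s → heatEnergy s (mulL2 χ u) ≤
      2 * c * heatEnergy s u + A * ‖u‖ₑ ^ 2 * ENNReal.ofReal s := by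
    intro s hs'
    refine (heatEnergy_le_of_pointwise (u := u) (c := 2 * c) (G := fun x => 2 * k * ‖u x‖ₑ ^ 2)
      (by finiteness) (by fun_prop) ?_ hs').trans (le_of_eq ?_)
    · filter_upwards [ae] with x hx
      filter_upwards [ae] with y hy
      rw [hx, hy, show (χ x : ℂ) * u x - χ y * u y =
        χ x * (u x - u y) + ((χ x - χ y : ℝ) : ℂ) * u y by push_cast; ring]
      refine (enorm_add_sq_le _ _).trans ?_
      rw [enorm_mul, enorm_mul, mul_pow, mul_pow, mul_assoc 2 c]
      have h1 : ‖((χ x - χ y : ℝ) : ℂ)‖ₑ ^ 2 ≤ k * ‖x - y‖ₑ ^ 2 := by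
        rw [enorm_sq_eq_ofReal, enorm_sq_eq_ofReal, ← ENNReal.ofReal_mul (sq_nonneg _),
          Complex.norm_real, Real.norm_eq_abs, ← mul_pow]
        exact ENNReal.ofReal_le_ofReal (pow_le_pow_left₀ (abs_nonneg _) (hK x y) 2)
      refine add_le_add (mul_le_mul_right (mul_le_mul_left (hχe x) _) _) ?_
      calc 2 * (‖((χ x - χ y : ℝ) : ℂ)‖ₑ ^ 2 * ‖u y‖ₑ ^ 2)
          ≤ 2 * (k * ‖x - y‖ₑ ^ 2 * ‖u y‖ₑ ^ 2) := by gcongr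
        _ = ‖x - y‖ₑ ^ 2 * (2 * k * ‖u y‖ₑ ^ 2) := by ring
        _ ≤ _ := by gcongr; exact le_add_self
    · rw [lintegral_const_mul _ (by fun_prop), ← enorm_sq_eq_lintegral]
      ring
  have h := energy_zero_le heat one_pos
  simp only [Real.sqrt_one, inv_one, ENNReal.ofReal_one, mul_one] at h
  calc halfNormSq (mulL2 χ u) ≤ c * ‖u‖ₑ ^ 2 + (2 * c * energy 0 u + A * ‖u‖ₑ ^ 2 +
        c * ‖u‖ₑ ^ 2) := add_le_add norm_le (h.trans (by gcongr))
    _ ≤ c * ‖u‖ₑ ^ 2 + (2 * c * energy 0 u + A * ‖u‖ₑ ^ 2 + c * ‖u‖ₑ ^ 2) +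
        (2 * c * ‖u‖ₑ ^ 2 + A * energy 0 u + 2 * c * energy 0 u) := le_self_add
    _ = _ := by rw [halfNormSq]; ring

/-- Compactly supported Lipschitz functions in `U` belong to `H_0^{1/2}(U)`: their mollifications
converge in `L²`, with a uniform Lipschitz bound, and `H^{1/2}` interpolates between the two. -/
theorem memH0Half_of_lipschitz {U : Set (E d)} (hU : IsOpen U) {f : E d → ℂ} {K : ℝ}
    (hf : ∀ x y, ‖f x - f y‖ ≤ K * ‖x - y‖) (hs : HasCompactSupport f) (hsU : tsupport f ⊆ U)
    (hm : MemLp f 2 (volume : Measure (E d))) : MemH0Half U (hm.toLp f) := by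
  have hK : 0 ≤ |K| := abs_nonneg _
  have hf' : ∀ x y, ‖f x - f y‖ ≤ |K| * ‖x - y‖ := fun x y =>
    (hf x y).trans (mul_le_mul_of_nonneg_right (le_abs_self K) (norm_nonneg _))
  have cf : Continuous f := by
    have : LipschitzWith (Real.toNNReal |K|) f := LipschitzWith.of_dist_le_mul fun x y => by
      rw [dist_eq_norm, dist_eq_norm, Real.coe_toNNReal _ hK]; exact hf' x y
    exact this.continuous
  obtain ⟨δ, hδ, hδU⟩ := (show IsCompact (tsupport f) from hs).exists_cthickening_subset_open hU hsU
  set S := Metric.cthickening δ (tsupport f) with hS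
  have cS : IsCompact S := (show IsCompact (tsupport f) from hs).cthickening
  have mS : MeasurableSet S := cS.isClosed.measurableSet
  have vS : volume S ≠ ⊤ := cS.measure_lt_top.ne
  have fS : ∀ x, x ∉ S → f x = 0 := fun x hx => by
    by_contra h
    exact hx (Metric.self_subset_cthickening _ (subset_tsupport f h))
  set A : ℝ≥0∞ := ENNReal.ofReal (8 * 2 ^ ((d : ℝ) / 2)) *
    (ENNReal.ofReal ((2 * |K|) ^ 2) * volume S) with hA
  have hAt : A ≠ ⊤ := by finiteness
  -- the mollification at scale `r`; the parameter `σ` separates small from large times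
  have main : ∀ r : ℝ, 0 < r → r ≤ δ → ∃ (η : E d → ℂ) (hη : MemLp η 2 volume),
      ContDiff ℝ ∞ η ∧ HasCompactSupport η ∧ tsupport η ⊆ U ∧ ∀ σ : ℝ, 0 < σ →
        halfNormSq (hm.toLp f - hη.toLp η) ≤ A * ENNReal.ofReal √σ +
          ENNReal.ofReal ((|K| * r) ^ 2) * (volume S * (1 + ENNReal.ofReal (√σ)⁻¹)) := by
    intro r hr hrδ
    let ρ : ContDiffBump (0 : E d) := ⟨r / 2, r, by linarith, by linarith⟩
    set η : E d → ℂ := convolution (ρ.normed volume) f (ContinuousLinearMap.lsmul ℝ ℝ) volume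
      with hη
    have lf : LocallyIntegrable f (volume : Measure (E d)) := cf.locallyIntegrable
    have η1 : ContDiff ℝ ∞ η := ρ.hasCompactSupport_normed.contDiff_convolution_left _
      ρ.contDiff_normed lf
    have ηS : tsupport η ⊆ S := by
      refine closure_minimal ?_ cS.isClosed
      refine (support_convolution_subset _).trans ?_
      rw [ρ.support_normed_eq]
      rintro _ ⟨a, ha, b, hb, rfl⟩
      refine Metric.mem_cthickening_of_dist_le _ b δ _ (subset_tsupport f hb) ?_
      have ha' : ‖a‖ < r := by simpa using ha
      simp only [dist_eq_norm, add_sub_cancel_right]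
      linarith
    have η2 : HasCompactSupport η := cS.of_isClosed_subset (isClosed_tsupport η) ηS
    have ηm : MemLp η 2 volume := η1.continuous.memLp_of_hasCompactSupport η2
    have close : ∀ x, ‖f x - η x‖ ≤ |K| * r := by
      intro x
      rw [norm_sub_rev, ← dist_eq_norm]
      refine ρ.dist_normed_convolution_le cf.aestronglyMeasurable fun y hy => ?_
      rw [dist_eq_norm]
      refine (hf' y x).trans (mul_le_mul_of_nonneg_left ?_ hK)
      have : dist y x < r := hy
      rw [← dist_eq_norm]; exact this.le
    have ηL : ∀ x y, ‖η x - η y‖ ≤ |K| * ‖x - y‖ := by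
      intro x y
      have i : ∀ x : E d, Integrable fun t => ρ.normed volume t • f (x - t) := by
        intro x
        refine Continuous.integrable_of_hasCompactSupport ?_ ?_
        · exact ρ.continuous_normed.smul (cf.comp (by fun_prop))
        · exact ρ.hasCompactSupport_normed.smul_right
      have e : ∀ x, η x = ∫ t, ρ.normed volume t • f (x - t) := fun x => rfl
      rw [e, e, ← integral_sub (i x) (i y)]
      calc ‖∫ t, (ρ.normed volume t • f (x - t) - ρ.normed volume t • f (y - t))‖
          ≤ ∫ t, ρ.normed volume t * (|K| * ‖x - y‖) := by
            refine norm_integral_le_of_norm_le (ρ.integrable_normed.mul_const _) ?_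
            filter_upwards with t
            rw [← smul_sub, norm_smul, Real.norm_of_nonneg (ρ.nonneg_normed t)]
            refine mul_le_mul_of_nonneg_left ?_ (ρ.nonneg_normed t)
            simpa using hf' (x - t) (y - t)
        _ = |K| * ‖x - y‖ := by rw [integral_mul_const, ρ.integral_normed, one_mul]
    refine ⟨η, ηm, η1, η2, ηS.trans hδU, fun σ hσ => ?_⟩
    set g := hm.toLp f - ηm.toLp η with hg
    have ae : ∀ᵐ x, g x = f x - η x := by
      filter_upwards [Lp.coeFn_sub (hm.toLp f) (ηm.toLp η), hm.coeFn_toLp, ηm.coeFn_toLp]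
        with x h1 h2 h3
      rw [h1, Pi.sub_apply, h2, h3]
    have gS : ∀ x, x ∉ S → f x - η x = 0 := fun x hx => by
      rw [fS x hx, image_eq_zero_of_notMem_tsupport fun h => hx (ηS h), sub_zero]
    have n1 : ‖g‖ₑ ^ 2 ≤ ENNReal.ofReal ((|K| * r) ^ 2) * volume S := by
      rw [enorm_sq_eq_lintegral, ← setLIntegral_const, ← lintegral_indicator mS]
      refine lintegral_mono_ae ?_
      filter_upwards [ae] with x hx
      rw [hx]
      by_cases h : x ∈ S
      · rw [Set.indicator_of_mem h, enorm_sq_eq_ofReal]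
        exact ENNReal.ofReal_le_ofReal (pow_le_pow_left₀ (norm_nonneg _) (close x) 2)
      · simp [gS x h]
    have heat : ∀ s : ℝ, 0 < s → heatEnergy s g ≤ 0 * heatEnergy s g + A * ENNReal.ofReal s := by
      intro s hs'
      refine (heatEnergy_le_of_pointwise (u := g) (c := 0) ENNReal.zero_ne_top
        (G := S.indicator fun _ => ENNReal.ofReal ((2 * |K|) ^ 2))
        (measurable_const.indicator mS) ?_ hs').trans (le_of_eq ?_)
      · filter_upwards [ae] with x hx
        filter_upwards [ae] with y hy
        rw [hx, hy, zero_mul, zero_add]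
        have L : ‖f x - η x - (f y - η y)‖ₑ ^ 2 ≤
            ‖x - y‖ₑ ^ 2 * ENNReal.ofReal ((2 * |K|) ^ 2) := by
          rw [enorm_sq_eq_ofReal, enorm_sq_eq_ofReal, ← ENNReal.ofReal_mul (sq_nonneg _), ← mul_pow]
          refine ENNReal.ofReal_le_ofReal (pow_le_pow_left₀ (norm_nonneg _) ?_ 2)
          rw [sub_sub_sub_comm]
          refine (norm_sub_le _ _).trans ?_
          linarith [hf' x y, ηL x y]
        by_cases h1 : x ∈ S
        · rw [Set.indicator_of_mem h1]
          exact L.trans (mul_le_mul_right le_self_add _)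
        · by_cases h2 : y ∈ S
          · rw [Set.indicator_of_mem h2]
            exact L.trans (mul_le_mul_right le_add_self _)
          · simp [gS x h1, gS y h2]
      · rw [lintegral_indicator_const mS]
    have h := energy_zero_le heat hσ
    rw [zero_mul, zero_add] at h
    calc halfNormSq g ≤ ‖g‖ₑ ^ 2 + (A * ENNReal.ofReal √σ + ‖g‖ₑ ^ 2 * ENNReal.ofReal (√σ)⁻¹) :=
          add_le_add le_rfl h
      _ = A * ENNReal.ofReal √σ + ‖g‖ₑ ^ 2 * (1 + ENNReal.ofReal (√σ)⁻¹) := by ring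
      _ ≤ _ := by rw [← mul_assoc]; gcongr
  intro ε hε
  have hε2 : 0 < ε / 2 := ENNReal.div_pos hε.ne' (by norm_num)
  obtain ⟨σ, hσ, hσ1⟩ : ∃ σ : ℝ, 0 < σ ∧ A * ENNReal.ofReal √σ < ε / 2 := by
    have t : Tendsto (fun σ : ℝ => A * ENNReal.ofReal √σ) (𝓝[>] 0) (𝓝 (A * ENNReal.ofReal √0)) := by
      refine ENNReal.Tendsto.const_mul ?_ (Or.inr hAt)
      exact (ENNReal.continuous_ofReal.comp Real.continuous_sqrt).continuousWithinAt
    simp only [Real.sqrt_zero, ENNReal.ofReal_zero, mul_zero] at t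
    obtain ⟨σ, h1, h2⟩ := ((t.eventually (gt_mem_nhds hε2)).and self_mem_nhdsWithin).exists
    exact ⟨σ, h2, h1⟩
  set X := volume S * (1 + ENNReal.ofReal (√σ)⁻¹)
  have hX : X ≠ ⊤ := by finiteness
  obtain ⟨r, ⟨hr1, hr2⟩, hr3⟩ : ∃ r : ℝ, r ∈ Set.Ioc 0 δ ∧
      ENNReal.ofReal ((|K| * r) ^ 2) * X < ε / 2 := by
    have t : Tendsto (fun r : ℝ => ENNReal.ofReal ((|K| * r) ^ 2) * X) (𝓝[>] 0)
        (𝓝 (ENNReal.ofReal ((|K| * 0) ^ 2) * X)) := by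
      refine ENNReal.Tendsto.mul_const ?_ (Or.inr hX)
      exact (ENNReal.continuous_ofReal.comp (by fun_prop)).continuousWithinAt
    simp only [mul_zero, ne_eq, OfNat.ofNat_ne_zero, not_false_eq_true, zero_pow,
      ENNReal.ofReal_zero, zero_mul] at t
    obtain ⟨r, h1, h2⟩ := ((t.eventually (gt_mem_nhds hε2)).and (Ioc_mem_nhdsGT hδ)).exists
    exact ⟨r, h2, h1⟩
  obtain ⟨η, hη, c1, c2, c3, c4⟩ := main r hr1 hr2
  refine ⟨η, hη, c1, c2, c3, (sobolevHalfSq_le _).trans_lt ((c4 σ hσ).trans_lt ?_)⟩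
  calc _ < ε / 2 + ε / 2 := ENNReal.add_lt_add hσ1 hr3
    _ = ε := ENNReal.add_halves ε

end SobolevHalf

/-! ### `H_0^{1/2}` under a change of variables -/

section Transfer

variable {d : ℕ}

theorem exists_lipschitz_cutoff {K V : Set (E d)} (hK : IsCompact K) (hV : IsOpen V)
    (hKV : K ⊆ V) : ∃ (χ : E d → ℝ) (k : ℝ), Continuous χ ∧ HasCompactSupport χ ∧ tsupport χ ⊆ V ∧
      (∀ x, |χ x| ≤ 1) ∧ (∀ x y, |χ x - χ y| ≤ k * ‖x - y‖) ∧ ∀ x ∈ K, χ x = 1 := by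
  obtain ⟨δ, hδ, hδV⟩ := hK.exists_cthickening_subset_open hV hKV
  obtain ⟨χ, h1, h2, h3, h4⟩ := exists_contMDiff_support_eq_eq_one_iff
    (modelWithCornersSelf ℝ (E d))
    (n := 1) (Metric.isOpen_thickening (δ := δ) (E := K)) hK.isClosed
    (Metric.self_subset_thickening hδ K)
  have h1 : ContDiff ℝ 1 χ := h1.contDiff
  have hsub : tsupport χ ⊆ Metric.cthickening δ K := by
    refine closure_minimal ?_ Metric.isClosed_cthickening
    rw [h3]; exact Metric.thickening_subset_cthickening δ K
  have hc : HasCompactSupport χ := hK.cthickening.of_isClosed_subset (isClosed_tsupport χ) hsub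
  obtain ⟨C, hC⟩ := h1.lipschitzWith_of_hasCompactSupport hc one_ne_zero
  refine ⟨χ, C, h1.continuous, hc, hsub.trans hδV, fun x => ?_, fun x y => ?_, fun x hx =>
    (h4 x).1 hx⟩
  · have := h2 (Set.mem_range_self x)
    rw [abs_of_nonneg this.1]; exact this.2
  · have := hC.dist_le_mul x y
    rwa [Real.dist_eq, dist_eq_norm] at this

theorem mulL2_sub {φ : E d → ℝ} (hφ : Continuous φ) (hs : HasCompactSupport φ) (u v : L2 d) :
    mulL2 φ (u - v) = mulL2 φ u - mulL2 φ v := by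
  ext1
  filter_upwards [mulL2_ae φ hφ hs (u - v), mulL2_ae φ hφ hs u, mulL2_ae φ hφ hs v,
    Lp.coeFn_sub u v, Lp.coeFn_sub (mulL2 φ u) (mulL2 φ v)] with x h1 h2 h3 h4 h5
  rw [h1, h5, Pi.sub_apply, h2, h3, h4, Pi.sub_apply, mul_sub]

theorem continuous_of_norm_sub_le {F F' : Type*} [NormedAddCommGroup F] [NormedAddCommGroup F']
    {f : F → F'} {k : ℝ} (h : ∀ x y, ‖f x - f y‖ ≤ k * ‖x - y‖) : Continuous f := by
  have : LipschitzWith (Real.toNNReal k) f := LipschitzWith.of_dist_le_mul fun x y => by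
    rw [dist_eq_norm, dist_eq_norm]
    exact (h x y).trans (mul_le_mul_of_nonneg_right (Real.le_coe_toNNReal k) (norm_nonneg _))
  exact this.continuous

theorem halfNormSq_comp_le {S : E d → E d} (hS : MeasurePreserving S volume volume) {L : ℝ}
    (hL : 1 ≤ L) (hSL : ∀ x y, ‖S x - S y‖ ≤ L * ‖x - y‖) (v : L2 d) :
    halfNormSq (Lp.compMeasurePreserving S hS v) ≤ ENNReal.ofReal (L ^ (d + 2)) * halfNormSq v := by
  rw [halfNormSq, halfNormSq, mul_add]
  refine add_le_add ?_ (energy_comp_le hS hL hSL le_rfl v)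
  have : ‖Lp.compMeasurePreserving S hS v‖ₑ = ‖v‖ₑ := by
    rw [← ofReal_norm, ← ofReal_norm, Lp.norm_compMeasurePreserving]
  rw [this]
  refine le_mul_of_one_le_left' ?_
  rw [ENNReal.one_le_ofReal]
  exact one_le_pow₀ hL

/-- Invariance of `H_0^{1/2}` under a bi-Lipschitz, measure preserving change of variables that
maps `Ω` to `Ω'` near the support of the function. -/
theorem memH0Half_comp {Ω Ω' V K : Set (E d)} (hΩ' : IsOpen Ω') (hV : IsOpen V) {T S : E d → E d}
    (hS : MeasurePreserving S volume volume) {L : ℝ} (hL : 1 ≤ L)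
    (hTL : ∀ x y, ‖T x - T y‖ ≤ L * ‖x - y‖) (hSL : ∀ x y, ‖S x - S y‖ ≤ L * ‖x - y‖)
    (hTS : ∀ y, T (S y) = y) (hmap : ∀ x ∈ Ω ∩ V, T x ∈ Ω')
    (hK : IsCompact K) (hKV : K ⊆ V) {u : L2 d} (hu : ∀ᵐ x, x ∉ K → u x = 0)
    (hm : MemH0Half Ω u) : MemH0Half Ω' (Lp.compMeasurePreserving S hS u) := by
  obtain ⟨χ, k, χ1, χ2, χ3, χ4, χ5, χ6⟩ := exists_lipschitz_cutoff hK hV hKV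
  obtain ⟨C, hC, hCle⟩ := exists_halfNormSq_mulL2_le χ1 χ2 χ4 χ5
  have cT := continuous_of_norm_sub_le hTL
  have cS := continuous_of_norm_sub_le hSL
  have χu : mulL2 χ u = u := by
    ext1
    filter_upwards [mulL2_ae χ χ1 χ2 u, hu] with x h1 h2
    rw [h1]
    by_cases hx : x ∈ K
    · simp [χ6 x hx]
    · simp [h2 hx]
  refine memH0Half_of_approx fun ε hε => ?_
  set X := ENNReal.ofReal (L ^ (d + 2)) * (C * ENNReal.ofReal (1 + 2 * Real.pi)) with hX
  have hXt : X ≠ ⊤ := by finiteness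
  obtain ⟨η, hη, c1, c2, c3, c4⟩ := hm (ε / (X + 1)) (ENNReal.div_pos hε.ne' (by finiteness))
  -- only Lipschitz, but supported in `Ω'`
  set f : E d → ℂ := fun y => (χ (S y) : ℂ) * η (S y) with hf
  have fsupp : Function.support f ⊆ T '' (tsupport η ∩ tsupport χ) := by
    intro y hy
    refine ⟨S y, ⟨?_, ?_⟩, hTS y⟩
    · refine subset_tsupport _ fun h => hy ?_
      simp [hf, h]
    · refine subset_tsupport _ fun h => hy ?_
      simp [hf, h]
  have cK : IsCompact (T '' (tsupport η ∩ tsupport χ)) :=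
    (IsCompact.inter_right c2 (isClosed_tsupport χ)).image cT
  have fts : tsupport f ⊆ T '' (tsupport η ∩ tsupport χ) := closure_minimal fsupp cK.isClosed
  have f2 : HasCompactSupport f := cK.of_isClosed_subset (isClosed_tsupport f) fts
  have fΩ : tsupport f ⊆ Ω' := by
    refine fts.trans ?_
    rintro _ ⟨x, ⟨h1, h2⟩, rfl⟩
    exact hmap x ⟨c3 h1, χ3 h2⟩
  obtain ⟨k', hk'⟩ := (c1.of_le (by simp) : ContDiff ℝ 1 η).lipschitzWith_of_hasCompactSupport c2
    one_ne_zero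
  obtain ⟨M, hM⟩ := c2.exists_bound_of_continuous c1.continuous
  have M0 : 0 ≤ M := (norm_nonneg _).trans (hM 0)
  have fL : ∀ x y, ‖f x - f y‖ ≤ (k' + |k| * M) * L * ‖x - y‖ := by
    intro x y
    have e : f x - f y = (χ (S x) : ℂ) * (η (S x) - η (S y)) +
        ((χ (S x) - χ (S y) : ℝ) : ℂ) * η (S y) := by
      simp only [hf]; push_cast; ring
    rw [e]
    refine (norm_add_le _ _).trans ?_
    rw [norm_mul, norm_mul, Complex.norm_real, Complex.norm_real, Real.norm_eq_abs,
      Real.norm_eq_abs]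
    have h1 : ‖η (S x) - η (S y)‖ ≤ k' * ‖S x - S y‖ := by
      have := hk'.dist_le_mul (S x) (S y)
      rwa [dist_eq_norm, dist_eq_norm] at this
    have h2 : |χ (S x) - χ (S y)| ≤ |k| * ‖S x - S y‖ :=
      (χ5 _ _).trans (mul_le_mul_of_nonneg_right (le_abs_self k) (norm_nonneg _))
    calc |χ (S x)| * ‖η (S x) - η (S y)‖ + |χ (S x) - χ (S y)| * ‖η (S y)‖
        ≤ 1 * (k' * ‖S x - S y‖) + |k| * ‖S x - S y‖ * M := by
          gcongr
          · exact χ4 _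
          · exact hM _
      _ = (k' + |k| * M) * ‖S x - S y‖ := by ring
      _ ≤ (k' + |k| * M) * (L * ‖x - y‖) := by
          gcongr
          exact hSL x y
      _ = _ := by ring
  have fm : MemLp f 2 volume := (continuous_of_norm_sub_le fL).memLp_of_hasCompactSupport f2
  refine ⟨fm.toLp f, memH0Half_of_lipschitz hΩ' fL f2 fΩ fm, ?_⟩
  have e : Lp.compMeasurePreserving S hS u - fm.toLp f =
      Lp.compMeasurePreserving S hS (mulL2 χ (u - hη.toLp η)) := by
    rw [mulL2_sub χ1 χ2, χu, map_sub]
    congr 1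
    ext1
    filter_upwards [fm.coeFn_toLp, Lp.coeFn_compMeasurePreserving (mulL2 χ (hη.toLp η)) hS,
      hS.quasiMeasurePreserving.ae (mulL2_ae χ χ1 χ2 (hη.toLp η)),
      hS.quasiMeasurePreserving.ae hη.coeFn_toLp] with x h1 h2 h3 h4
    rw [h1, h2, Function.comp_apply, h3, h4]
  rw [e]
  calc sobolevHalfSq _ ≤ ENNReal.ofReal (L ^ (d + 2)) *
        (C * (ENNReal.ofReal (1 + 2 * Real.pi) * sobolevHalfSq (u - hη.toLp η))) :=
      (sobolevHalfSq_le _).trans ((halfNormSq_comp_le hS hL hSL _).trans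
        (mul_le_mul_right ((hCle _).trans (mul_le_mul_right (halfNormSq_le _) _)) _))
    _ = X * sobolevHalfSq (u - hη.toLp η) := by rw [hX]; ring
    _ ≤ (X + 1) * sobolevHalfSq (u - hη.toLp η) := by gcongr; exact le_self_add
    _ < (X + 1) * (ε / (X + 1)) :=
      ENNReal.mul_lt_mul_right (by simp) (by finiteness) c4
    _ ≤ ε := ENNReal.mul_div_le

end Transfer

/-! ### The Fourier integral on `L¹ ∩ L²` -/

section FourierIntegral

variable {d : ℕ}

/-- On `L¹ ∩ L²` the Fourier transform is given by the Fourier integral. -/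
theorem fourier_ae_eq_integral (u : L2 d) (hu : Integrable u volume) :
    ∀ᵐ ξ, (𝓕 u : L2 d) ξ = 𝓕 (u : E d → ℂ) ξ := by
  have hcont : Continuous (𝓕 (u : E d → ℂ)) :=
    VectorFourier.fourierIntegral_continuous Real.continuous_fourierChar
      (L := innerₗ (E d)) continuous_inner hu
  refine ae_eq_of_integral_contDiff_smul_eq ((Lp.memLp _).locallyIntegrable (by norm_num))
    hcont.locallyIntegrable fun g hg1 hg2 => ?_
  have c1 : ContDiff ℝ ∞ fun x => (g x : ℂ) := Complex.ofRealCLM.contDiff.comp hg1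
  have c2 : HasCompactSupport fun x => (g x : ℂ) := hg2.comp_left Complex.ofReal_zero
  set G : SchwartzMap (E d) ℂ := c2.toSchwartzMap c1 with hG
  have hGg : ∀ x, G x = (g x : ℂ) := fun x => rfl
  have h1 := congrArg (fun T => T G) (Lp.fourier_toTemperedDistribution_eq u)
  simp only [TemperedDistribution.fourier_apply, Lp.toTemperedDistribution_apply] at h1
  have h2 := VectorFourier.integral_fourierIntegral_smul_eq_flip (L := innerₗ (E d))
    (μ := volume) (ν := volume) (f := (G : E d → ℂ)) (g := (u : E d → ℂ))
    Real.continuous_fourierChar continuous_inner G.integrable hu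
  have e : (innerₗ (E d)).flip = innerₗ (E d) := by
    ext x y; simp
  rw [e] at h2
  have h3 : ∫ ξ, g ξ • (𝓕 u : L2 d) ξ = ∫ ξ, G ξ • (𝓕 u : L2 d) ξ := by
    simp only [hGg]; rfl
  have h4 : ∫ ξ, g ξ • 𝓕 (u : E d → ℂ) ξ = ∫ ξ, G ξ • 𝓕 (u : E d → ℂ) ξ := by
    simp only [hGg]; rfl
  rw [h3, h4, ← h1]
  exact h2

end FourierIntegral

/-! ### A phase space bound for localized traces -/

section LocalTrace

variable {d : ℕ}

theorem integrable_mulL2 {φ : E d → ℝ} (hφ : Continuous φ) (hs : HasCompactSupport φ) (v : L2 d) :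
    Integrable (mulL2 φ v) volume := by
  have h1 : MemLp (fun x => (φ x : ℂ)) 2 (volume : Measure (E d)) :=
    (Complex.continuous_ofReal.comp hφ).memLp_of_hasCompactSupport
      (hs.comp_left Complex.ofReal_zero)
  refine (h1.integrable_mul (Lp.memLp v)).congr ?_
  filter_upwards [mulL2_ae φ hφ hs v] with x hx
  rw [hx, Pi.mul_apply]

/-- The density of `φ S S* φ` in momentum space is at most `‖φ‖²`: the Fourier coefficients of
`φ S b_i` at `ξ` are the inner products of `S b_i` with `e^{2πi⟨x,ξ⟩} φ`, and Bessel's inequality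
applies. -/
theorem sum_enorm_fourier_mulL2_sq_le {φ : E d → ℝ} (hφ : Continuous φ) (hs : HasCompactSupport φ)
    {ι : Type} (b : HilbertBasis ι ℂ (L2 d)) (S : L2 d →L[ℂ] L2 d) (hS : ‖S‖ ≤ 1)
    (F : Finset ι) : ∀ᵐ ξ, ∑ i ∈ F, ‖(𝓕 (mulL2 φ (S (b i))) : L2 d) ξ‖ₑ ^ 2 ≤
      ∫⁻ x, ENNReal.ofReal (φ x ^ 2) := by
  have key : ∀ i, ∀ᵐ ξ, (𝓕 (mulL2 φ (S (b i))) : L2 d) ξ =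
      𝓕 (mulL2 φ (S (b i)) : E d → ℂ) ξ := fun i =>
    fourier_ae_eq_integral _ (integrable_mulL2 hφ hs _)
  have key' : ∀ᵐ ξ, ∀ i ∈ F, (𝓕 (mulL2 φ (S (b i))) : L2 d) ξ =
      𝓕 (mulL2 φ (S (b i)) : E d → ℂ) ξ := (Finset.eventually_all F).2 fun i _ => key i
  filter_upwards [key'] with ξ hξ
  have ce : Continuous fun x : E d => (Real.fourierChar (inner ℝ x ξ) : ℂ) :=
    continuous_subtype_val.comp (Real.continuous_fourierChar.comp (by fun_prop))
  have he : MemLp (fun x => (Real.fourierChar (inner ℝ x ξ) : ℂ) * (φ x : ℂ)) 2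
      (volume : Measure (E d)) := by
    refine Continuous.memLp_of_hasCompactSupport ?_ ?_
    · exact ce.mul (Complex.continuous_ofReal.comp hφ)
    · exact (hs.comp_left Complex.ofReal_zero).mul_left
  set e := he.toLp _
  have h1 : ∀ i, 𝓕 (mulL2 φ (S (b i)) : E d → ℂ) ξ = inner ℂ e (S (b i)) := by
    intro i
    rw [L2.inner_def, Real.fourier_eq]
    refine integral_congr_ae ?_
    filter_upwards [mulL2_ae φ hφ hs (S (b i)), he.coeFn_toLp] with x h2 h3
    rw [h2, h3, RCLike.inner_apply, map_mul, Complex.conj_ofReal, Circle.smul_def,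
      AddChar.map_neg_eq_inv, Circle.coe_inv_eq_conj, smul_eq_mul]
    ring
  have ne : ‖e‖ₑ ^ 2 = ∫⁻ x, ENNReal.ofReal (φ x ^ 2) := by
    rw [enorm_sq_eq_lintegral]
    refine lintegral_congr_ae ?_
    filter_upwards [he.coeFn_toLp] with x hx
    rw [hx, enorm_sq_eq_ofReal, norm_mul, norm_fourierChar_coe, one_mul, Complex.norm_real,
      Real.norm_eq_abs, sq_abs]
  calc ∑ i ∈ F, ‖(𝓕 (mulL2 φ (S (b i))) : L2 d) ξ‖ₑ ^ 2
      = ∑ i ∈ F, ENNReal.ofReal (‖inner ℂ (b i) (S.adjoint e)‖ ^ 2) := by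
        refine Finset.sum_congr rfl fun i hi => ?_
        rw [hξ i hi, h1, ← ContinuousLinearMap.adjoint_inner_left, enorm_sq_eq_ofReal,
          norm_inner_symm]
    _ = ENNReal.ofReal (∑ i ∈ F, ‖inner ℂ (b i) (S.adjoint e)‖ ^ 2) :=
        (ENNReal.ofReal_sum_of_nonneg fun _ _ => sq_nonneg _).symm
    _ ≤ ENNReal.ofReal (‖S.adjoint e‖ ^ 2) :=
        ENNReal.ofReal_le_ofReal (b.orthonormal.sum_inner_products_le _)
    _ ≤ ENNReal.ofReal (‖e‖ ^ 2) := by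
        refine ENNReal.ofReal_le_ofReal (pow_le_pow_left₀ (norm_nonneg _) ?_ 2)
        have := S.adjoint.le_of_opNorm_le (c := 1) (by rwa [LinearIsometryEquiv.norm_map]) e
        simpa using this
    _ = _ := by rw [← enorm_sq_eq_ofReal, ne]

theorem setOf_symbol_le_subset {μ h : ℝ} (hμ : 0 ≤ μ) (hh : 0 < h) :
    {ξ : E d | h * psi (μ / h) (‖(2 * Real.pi) • ξ‖ ^ 2) ≤ 2} ⊆
      Metric.closedBall 0 (√(1 + μ) / h) := by
  intro ξ hξ
  simp only [Set.mem_ofPred_eq, psi] at hξ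
  rw [mem_closedBall_zero_iff, le_div_iff₀ hh]
  refine Real.le_sqrt_of_sq_le ?_
  set t := ‖(2 * Real.pi) • ξ‖ ^ 2 with ht
  have h1 : √(t + (μ / h) ^ 2) ≤ (2 + μ) / h := by
    rw [le_div_iff₀ hh]
    have : h * (μ / h) = μ := by field_simp
    nlinarith
  rw [Real.sqrt_le_left (by positivity)] at h1
  have h2 : t ≤ (4 + 4 * μ) / h ^ 2 := by
    have : ((2 + μ) / h) ^ 2 - (μ / h) ^ 2 = (4 + 4 * μ) / h ^ 2 := by field_simp; ring
    linarith
  rw [le_div_iff₀ (by positivity)] at h2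
  have h3 : t = 4 * Real.pi ^ 2 * ‖ξ‖ ^ 2 := by
    rw [ht, norm_smul, Real.norm_of_nonneg (by positivity)]; ring
  have h4 : 1 ≤ Real.pi ^ 2 := by nlinarith [Real.pi_gt_three]
  have h5 : 0 ≤ (‖ξ‖ * h) ^ 2 := sq_nonneg _
  rw [h3] at h2
  nlinarith [mul_le_mul_of_nonneg_right h4 h5]

/-- A bound of Berezin--Li--Yau type for `Tr(φ (h A - 2) φ)_-`: the symbol `h ψ - 2` is at least `-2`
and is negative only on a ball of radius `√(1 + μ) / h`. -/
theorem sum_norm_sq_sub_energy_le {φ : E d → ℝ} (hφ : Continuous φ) (hs : HasCompactSupport φ)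
    {μ h : ℝ} (hμ : 0 ≤ μ) (hh : 0 < h) {ι : Type} (b : HilbertBasis ι ℂ (L2 d))
    (S : L2 d →L[ℂ] L2 d) (hS : ‖S‖ ≤ 1) (hfin : ∀ i, energy (μ / h) (mulL2 φ (S (b i))) ≠ ⊤)
    (F : Finset ι) :
    ∑ i ∈ F, (2 * ‖mulL2 φ (S (b i))‖ ^ 2 - h * (energy (μ / h) (mulL2 φ (S (b i)))).toReal) ≤
      2 * (∫ x, φ x ^ 2) * (volume.real (Metric.closedBall (0 : E d) 1) *
        ((1 + μ) ^ ((d : ℝ) / 2) / h ^ d)) := by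
  set B := {ξ : E d | h * psi (μ / h) (‖(2 * Real.pi) • ξ‖ ^ 2) ≤ 2} with hB
  have mB : MeasurableSet B :=
    measurableSet_le ((measurable_psi_symbol _).const_mul h) measurable_const
  have hsq : Integrable (fun x => φ x ^ 2) (volume : Measure (E d)) := by
    refine Continuous.integrable_of_hasCompactSupport (by fun_prop) ?_
    exact hs.comp_left (g := fun t : ℝ => t ^ 2) (by simp)
  have eφ : ∫⁻ x, ENNReal.ofReal (φ x ^ 2) = ENNReal.ofReal (∫ x, φ x ^ 2) :=
    (ofReal_integral_eq_lintegral_ofReal hsq (Eventually.of_forall fun _ => sq_nonneg _)).symm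
  have I0 : 0 ≤ ∫ x, φ x ^ 2 := integral_nonneg fun _ => sq_nonneg _
  have vB : volume B ≤ ENNReal.ofReal (volume.real (Metric.closedBall (0 : E d) 1) *
        ((1 + μ) ^ ((d : ℝ) / 2) / h ^ d)) := by
    refine (measure_mono (setOf_symbol_le_subset hμ hh)).trans (le_of_eq ?_)
    rw [Measure.addHaar_closedBall' _ _ (by positivity), finrank_euclideanSpace_fin, mul_comm,
      ENNReal.ofReal_mul measureReal_nonneg, ofReal_measureReal measure_closedBall_lt_top.ne,
      div_pow, Real.sqrt_eq_rpow, ← Real.rpow_natCast, ← Real.rpow_mul (by positivity)]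
    congr 4
    ring
  -- pointwise in momentum space: `2 ≤ h ψ + 2·1_B`
  have one : ∀ i, ENNReal.ofReal (2 * ‖mulL2 φ (S (b i))‖ ^ 2) ≤
      ENNReal.ofReal (h * (energy (μ / h) (mulL2 φ (S (b i)))).toReal) +
        2 * ∫⁻ ξ in B, ‖(𝓕 (mulL2 φ (S (b i))) : L2 d) ξ‖ₑ ^ 2 := by
    intro i
    set u := mulL2 φ (S (b i))
    have mu : Measurable ((𝓕 u : L2 d) : E d → ℂ) := (Lp.stronglyMeasurable _).measurable
    rw [ENNReal.ofReal_mul zero_le_two, ← enorm_sq_eq_ofReal, ENNReal.ofReal_mul hh.le,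
      ENNReal.ofReal_toReal (hfin i), energy, ← lintegral_const_mul' _ _ ENNReal.ofReal_ne_top,
      ← lintegral_const_mul' _ _ (by norm_num), ← lintegral_indicator mB,
      ← lintegral_add_right _ (Measurable.indicator (by fun_prop) mB), ← enorm_fourier,
      enorm_sq_eq_lintegral, ← lintegral_const_mul' _ _ ENNReal.ofReal_ne_top]
    refine lintegral_mono fun ξ => ?_
    have e2 : ENNReal.ofReal 2 = 2 := by norm_num
    by_cases hξ : ξ ∈ B
    · simp only [Set.indicator_of_mem hξ, e2]
      exact le_add_self
    · simp only [Set.indicator_of_notMem hξ, add_zero]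
      rw [← mul_assoc, ← ENNReal.ofReal_mul hh.le]
      gcongr
      simp only [hB, Set.mem_ofPred_eq, not_le] at hξ
      exact hξ.le
  have dens : ∑ i ∈ F, ∫⁻ ξ in B, ‖(𝓕 (mulL2 φ (S (b i))) : L2 d) ξ‖ₑ ^ 2 ≤
      ENNReal.ofReal (∫ x, φ x ^ 2) * volume B := by
    have mu : ∀ i, Measurable ((𝓕 (mulL2 φ (S (b i))) : L2 d) : E d → ℂ) := fun i =>
      (Lp.stronglyMeasurable _).measurable
    rw [← lintegral_finsetSum _ (fun i _ => by have := mu i; fun_prop), ← setLIntegral_const, ← eφ]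
    refine lintegral_mono_ae (ae_restrict_of_ae ?_)
    exact sum_enorm_fourier_mulL2_sq_le hφ hs b S hS F
  rw [Finset.sum_sub_distrib, sub_le_iff_le_add', ← ENNReal.ofReal_le_ofReal_iff (by positivity),
    ENNReal.ofReal_sum_of_nonneg fun _ _ => by positivity, ENNReal.ofReal_add (by positivity)
    (by positivity), ENNReal.ofReal_sum_of_nonneg fun _ _ => by positivity]
  calc _ ≤ ∑ i ∈ F, (ENNReal.ofReal (h * (energy (μ / h) (mulL2 φ (S (b i)))).toReal) +
        2 * ∫⁻ ξ in B, ‖(𝓕 (mulL2 φ (S (b i))) : L2 d) ξ‖ₑ ^ 2) :=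
        Finset.sum_le_sum fun i _ => one i
    _ ≤ _ := by
      rw [Finset.sum_add_distrib, ← Finset.mul_sum]
      refine add_le_add le_rfl ?_
      rw [mul_assoc 2, ENNReal.ofReal_mul zero_le_two, ENNReal.ofReal_mul I0,
        show ENNReal.ofReal 2 = 2 by norm_num]
      exact mul_le_mul_right (dens.trans (mul_le_mul_right vB _)) _

end LocalTrace

/-! ### The form domain -/

section FormDomain

variable {d : ℕ}

theorem psi_le_psi_zero {m t : ℝ} (hm : 0 ≤ m) (ht : 0 ≤ t) : psi m t ≤ psi 0 t := by
  rw [psi, psi, sub_le_iff_le_add, Real.sqrt_le_left (by simp; positivity)]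
  simp only [ne_eq, OfNat.ofNat_ne_zero, not_false_eq_true, zero_pow, add_zero, sub_zero]
  nlinarith [Real.sq_sqrt ht, mul_nonneg (Real.sqrt_nonneg t) hm]

theorem psi_zero_le (m t : ℝ) : psi 0 t ≤ m + psi m t := by
  rw [psi, psi, add_sub_cancel, sub_zero]
  exact Real.sqrt_le_sqrt (by nlinarith)

theorem energy_le_energy_zero {m : ℝ} (hm : 0 ≤ m) (u : L2 d) : energy m u ≤ energy 0 u := by
  refine lintegral_mono fun ξ => ?_
  gcongr
  exact psi_le_psi_zero hm (by positivity)

theorem energy_zero_le_add {m : ℝ} (hm : 0 ≤ m) (u : L2 d) :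
    energy 0 u ≤ ENNReal.ofReal m * ‖u‖ₑ ^ 2 + energy m u := by
  have mu : Measurable ((𝓕 u : L2 d) : E d → ℂ) := (Lp.stronglyMeasurable _).measurable
  rw [← enorm_fourier, enorm_sq_eq_lintegral, energy, energy,
    ← lintegral_const_mul' _ _ ENNReal.ofReal_ne_top, ← lintegral_add_left (by fun_prop)]
  refine lintegral_mono fun ξ => ?_
  rw [← add_mul, ← ENNReal.ofReal_add hm (psi_nonneg (by positivity))]
  gcongr
  exact psi_zero_le _ _

theorem sobolevHalfSq_ne_top_of_contDiff {η : E d → ℂ} (h1 : ContDiff ℝ ∞ η)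
    (h2 : HasCompactSupport η) (hη : MemLp η 2 (volume : Measure (E d))) :
    sobolevHalfSq (hη.toLp η) ≠ ⊤ := by
  obtain ⟨k, hk⟩ := (h1.of_le (by simp) : ContDiff ℝ 1 η).lipschitzWith_of_hasCompactSupport h2
    one_ne_zero
  set S := tsupport η
  have mS : MeasurableSet S := (isClosed_tsupport η).measurableSet
  have vS : volume S ≠ ⊤ := (show IsCompact S from h2).measure_lt_top.ne
  have heat : ∀ s : ℝ, 0 < s → heatEnergy s (hη.toLp η) ≤ 0 * heatEnergy s (hη.toLp η) +
      (ENNReal.ofReal (8 * 2 ^ ((d : ℝ) / 2)) * ((k : ℝ≥0∞) ^ 2 * volume S)) *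
        ENNReal.ofReal s := by
    intro s hs
    refine (heatEnergy_le_of_pointwise (u := hη.toLp η) (c := 0) ENNReal.zero_ne_top
        (G := S.indicator fun _ => (k : ℝ≥0∞) ^ 2) (measurable_const.indicator mS) ?_ hs).trans
      (le_of_eq ?_)
    · filter_upwards [hη.coeFn_toLp] with x hx
      filter_upwards [hη.coeFn_toLp] with y hy
      rw [hx, hy, zero_mul, zero_add]
      have L : ‖η x - η y‖ₑ ^ 2 ≤ ‖x - y‖ₑ ^ 2 * (k : ℝ≥0∞) ^ 2 := by
        have := hk.edist_le_mul x y
        rw [edist_eq_enorm_sub, edist_eq_enorm_sub] at this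
        calc _ ≤ (k * ‖x - y‖ₑ) ^ 2 := by gcongr
          _ = _ := by ring
      by_cases hxS : x ∈ S
      · rw [Set.indicator_of_mem hxS]
        exact L.trans (mul_le_mul_right le_self_add _)
      · by_cases hyS : y ∈ S
        · rw [Set.indicator_of_mem hyS]
          exact L.trans (mul_le_mul_right le_add_self _)
        · simp [image_eq_zero_of_notMem_tsupport hxS, image_eq_zero_of_notMem_tsupport hyS]
    · rw [lintegral_indicator_const mS]
  have h := energy_zero_le heat one_pos
  rw [zero_mul, zero_add] at h
  refine ne_top_of_le_ne_top ?_ (sobolevHalfSq_le _)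
  refine ENNReal.add_ne_top.2 ⟨by finiteness, ne_top_of_le_ne_top ?_ h⟩
  finiteness

theorem MemH0Half.sobolevHalfSq_ne_top {Ω : Set (E d)} {u : L2 d} (hu : MemH0Half Ω u) :
    sobolevHalfSq u ≠ ⊤ := by
  obtain ⟨η, hη, c1, c2, -, c4⟩ := hu 1 one_pos
  have h := sobolevHalfSq_add_le (u - hη.toLp η) (hη.toLp η)
  rw [sub_add_cancel] at h
  refine ne_top_of_le_ne_top ?_ h
  have := sobolevHalfSq_ne_top_of_contDiff c1 c2 hη
  have := c4.ne_top
  finiteness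

theorem MemH0Half.energy_ne_top {Ω : Set (E d)} {u : L2 d} (hu : MemH0Half Ω u) {m : ℝ}
    (hm : 0 ≤ m) : energy m u ≠ ⊤ := by
  have := hu.sobolevHalfSq_ne_top
  refine ne_top_of_le_ne_top ?_ ((energy_le_energy_zero hm u).trans
    ((le_add_self).trans (halfNormSq_le u)))
  finiteness

theorem memH0Half_zero (Ω : Set (E d)) : MemH0Half Ω (0 : L2 d) := by
  intro ε hε
  refine ⟨0, MemLp.zero, contDiff_const, HasCompactSupport.zero, by simp [tsupport], ?_⟩
  have e : (0 : L2 d) - (MemLp.zero : MemLp (0 : E d → ℂ) 2 volume).toLp 0 = 0 := by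
    rw [MemLp.toLp_zero, sub_zero]
  have z : (𝓕 (0 : L2 d) : L2 d) = 0 := map_zero (Lp.fourierTransformₗᵢ (E d) ℂ)
  have : sobolevHalfSq (0 : L2 d) = 0 := by
    rw [sobolevHalfSq, z]
    refine (lintegral_congr_ae ?_).trans (lintegral_zero)
    filter_upwards [Lp.coeFn_zero ℂ 2 (volume : Measure (E d))] with ξ h
    rw [h]; simp
  rw [e, this]; exact hε

theorem MemH0Half.add {Ω : Set (E d)} {u v : L2 d} (hu : MemH0Half Ω u) (hv : MemH0Half Ω v) :
    MemH0Half Ω (u + v) := by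
  intro ε hε
  have hε' : 0 < ε / 4 := ENNReal.div_pos hε.ne' (by norm_num)
  obtain ⟨η, hη, c1, c2, c3, c4⟩ := hu (ε / 4) hε'
  obtain ⟨ζ, hζ, e1, e2, e3, e4⟩ := hv (ε / 4) hε'
  refine ⟨η + ζ, hη.add hζ, c1.add e1, c2.add e2, ?_, ?_⟩
  · exact (tsupport_add η ζ).trans (Set.union_subset c3 e3)
  · rw [MemLp.toLp_add hη hζ, add_sub_add_comm]
    refine (sobolevHalfSq_add_le _ _).trans_lt ?_
    rw [← mul_add]
    have : ε = 2 * (ε / 4 + ε / 4) := by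
      rw [← two_mul, ← mul_assoc, ← ENNReal.mul_comm_div, show (2 * 2 : ℝ≥0∞) = 4 by norm_num,
        ENNReal.div_self (by norm_num) (by norm_num), one_mul]
    rw [this]
    exact ENNReal.mul_lt_mul_right (by norm_num) (by norm_num) (ENNReal.add_lt_add c4 e4)

theorem sobolevHalfSq_smul (c : ℂ) (u : L2 d) :
    sobolevHalfSq (c • u) = ‖c‖ₑ ^ 2 * sobolevHalfSq u := by
  have e : (𝓕 (c • u) : L2 d) = c • (𝓕 u : L2 d) := map_smul (Lp.fourierTransformₗᵢ (E d) ℂ) c u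
  rw [sobolevHalfSq, sobolevHalfSq, e, ← lintegral_const_mul' _ _ (by simp)]
  refine lintegral_congr_ae ?_
  filter_upwards [Lp.coeFn_smul c (𝓕 u : L2 d)] with ξ h
  rw [h, Pi.smul_apply, enorm_smul, mul_pow, mul_left_comm]

theorem MemH0Half.smul {Ω : Set (E d)} {u : L2 d} (c : ℂ) (hu : MemH0Half Ω u) :
    MemH0Half Ω (c • u) := by
  intro ε hε
  obtain ⟨η, hη, c1, c2, c3, c4⟩ := hu (ε / (‖c‖ₑ ^ 2 + 1))
    (ENNReal.div_pos hε.ne' (by finiteness))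
  refine ⟨c • η, hη.const_smul c, c1.const_smul c, ?_, ?_, ?_⟩
  · exact c2.smul_left (f := fun _ : E d => c)
  · refine (closure_mono fun x hx => ?_).trans c3
    exact fun h => hx (by simp [h])
  · rw [MemLp.toLp_const_smul c hη, ← smul_sub, sobolevHalfSq_smul]
    calc _ ≤ (‖c‖ₑ ^ 2 + 1) * sobolevHalfSq (u - hη.toLp η) := by gcongr; exact le_self_add
      _ < (‖c‖ₑ ^ 2 + 1) * (ε / (‖c‖ₑ ^ 2 + 1)) :=
        ENNReal.mul_lt_mul_right (by simp) (by finiteness) c4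
      _ ≤ ε := ENNReal.mul_div_le

end FormDomain

/-! ### The localized form is closed -/

section LocalForm

variable {d : ℕ}

/-- The square root of the symbol of `√(-Δ + m²) - m`, as a complex number. -/
noncomputable def sqrtSymbol (m : ℝ) (ξ : E d) : ℂ :=
  (√(psi m (‖(2 * Real.pi) • ξ‖ ^ 2)) : ℝ)

theorem measurable_sqrtSymbol (m : ℝ) : Measurable (sqrtSymbol m : E d → ℂ) :=
  Complex.measurable_ofReal.comp ((measurable_psi_symbol m).sqrt)

theorem enorm_sqrtSymbol_sq (m : ℝ) (ξ : E d) :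
    ‖sqrtSymbol m ξ‖ₑ ^ 2 = ENNReal.ofReal (psi m (‖(2 * Real.pi) • ξ‖ ^ 2)) := by
  rw [enorm_sq_eq_ofReal, sqrtSymbol, Complex.norm_real, Real.norm_of_nonneg (Real.sqrt_nonneg _),
    Real.sq_sqrt (psi_nonneg (by positivity))]

theorem energy_eq_enorm_sq {m : ℝ} {u f : L2 d}
    (hf : ∀ᵐ ξ, f ξ = sqrtSymbol m ξ * (𝓕 u : L2 d) ξ) : energy m u = ‖f‖ₑ ^ 2 := by
  rw [enorm_sq_eq_lintegral, energy]
  refine lintegral_congr_ae ?_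
  filter_upwards [hf] with ξ h
  rw [h, enorm_mul, mul_pow, enorm_sqrtSymbol_sq]

theorem exists_sqrtSymbol_mul {m : ℝ} {u : L2 d} (hu : energy m u ≠ ⊤) :
    ∃ f : L2 d, ∀ᵐ ξ, f ξ = sqrtSymbol m ξ * (𝓕 u : L2 d) ξ := by
  have mF : AEStronglyMeasurable (fun ξ : E d => sqrtSymbol m ξ * (𝓕 u : L2 d) ξ) volume :=
    (measurable_sqrtSymbol m).aestronglyMeasurable.mul (Lp.aestronglyMeasurable _)
  have h : MemLp (fun ξ => sqrtSymbol m ξ * (𝓕 u : L2 d) ξ) 2 (volume : Measure (E d)) := by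
    refine ⟨mF, ?_⟩
    rw [eLpNorm_lt_top_iff_lintegral_rpow_enorm_lt_top (by norm_num) (by norm_num)]
    simp only [ENNReal.toReal_ofNat, ENNReal.rpow_ofNat, enorm_mul, mul_pow, enorm_sqrtSymbol_sq]
    exact hu.lt_top
  exact ⟨h.toLp _, h.coeFn_toLp⟩

theorem quadForm_eq_inner {m : ℝ} {u v f g : L2 d}
    (hf : ∀ᵐ ξ, f ξ = sqrtSymbol m ξ * (𝓕 u : L2 d) ξ)
    (hg : ∀ᵐ ξ, g ξ = sqrtSymbol m ξ * (𝓕 v : L2 d) ξ) : quadForm m u v = inner ℂ f g := by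
  rw [L2.inner_def, quadForm]
  refine integral_congr_ae ?_
  filter_upwards [hf, hg] with ξ h1 h2
  have e : (psi m (‖(2 * Real.pi) • ξ‖ ^ 2) : ℂ) = sqrtSymbol m ξ * sqrtSymbol m ξ := by
    rw [sqrtSymbol, ← Complex.ofReal_mul, Real.mul_self_sqrt (psi_nonneg (by positivity))]
  rw [h1, h2, e, RCLike.inner_apply, RCLike.inner_apply, map_mul,
    show starRingEnd ℂ (sqrtSymbol m ξ) = sqrtSymbol m ξ from Complex.conj_ofReal _]
  ring

theorem quadForm_self {m : ℝ} {u : L2 d} (hu : energy m u ≠ ⊤) :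
    quadForm m u u = ((energy m u).toReal : ℂ) := by
  obtain ⟨f, hf⟩ := exists_sqrtSymbol_mul hu
  rw [quadForm_eq_inner hf hf, energy_eq_enorm_sq hf, inner_self_eq_norm_sq_to_K]
  simp

theorem localForm_self_re {μ h : ℝ} {φ : E d → ℝ} {v : L2 d}
    (hv : energy (μ / h) (mulL2 φ v) ≠ ⊤) :
    (localForm μ h φ v v).re =
      h * (energy (μ / h) (mulL2 φ v)).toReal - ‖mulL2 φ v‖ ^ 2 := by
  rw [localForm, quadForm_self hv, inner_self_eq_norm_sq_to_K]
  norm_cast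

/-- The relation `f = σ g` with an unbounded multiplier `σ ≥ 0` in terms of bounded operators. -/
theorem exists_bounded_multipliers {σ : E d → ℝ} (σ0 : ∀ ξ, 0 ≤ σ ξ) (mσ : Measurable σ) :
    ∃ A₁ A₂ : L2 d →L[ℂ] L2 d, ∀ f g, A₁ f = A₂ g ↔ ∀ᵐ ξ, f ξ = (σ ξ : ℂ) * g ξ := by
  obtain ⟨A₁, -, hA₁⟩ := exists_boundedMul (d := d) (f := fun ξ => (((1 + σ ξ)⁻¹ : ℝ) : ℂ)) (C := 1)
    (Complex.measurable_ofReal.comp (by fun_prop)).aestronglyMeasurable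
    (fun ξ => by
      have := σ0 ξ
      rw [Complex.norm_real, Real.norm_of_nonneg (by positivity)]
      exact inv_le_one_of_one_le₀ (by linarith))
  obtain ⟨A₂, -, hA₂⟩ := exists_boundedMul (d := d) (f := fun ξ => ((σ ξ * (1 + σ ξ)⁻¹ : ℝ) : ℂ))
    (C := 1) (Complex.measurable_ofReal.comp (by fun_prop)).aestronglyMeasurable
    (fun ξ => by
      have := σ0 ξ
      rw [Complex.norm_real, Real.norm_of_nonneg (by positivity), mul_inv_le_iff₀ (by positivity)]
      linarith)
  refine ⟨A₁, A₂, fun f g => ?_⟩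
  have nz : ∀ ξ, ((1 + σ ξ : ℝ) : ℂ) ≠ 0 := fun ξ => by
    have := σ0 ξ
    exact Complex.ofReal_ne_zero.2 (by positivity)
  constructor
  · intro e
    have h1 := hA₁ f
    rw [e] at h1
    filter_upwards [h1, hA₂ g] with ξ h2 h3
    rw [h3] at h2
    have := nz ξ
    push_cast at h2 this
    field_simp at h2
    exact h2.symm
  · intro e
    ext1
    filter_upwards [hA₁ f, hA₂ g, e] with ξ h1 h2 h3
    rw [h1, h2, h3]
    push_cast
    ring

theorem sobolevHalfSq_le_of_sqrtSymbol {m : ℝ} (hm : 0 ≤ m) {u f : L2 d}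
    (hf : ∀ᵐ ξ, f ξ = sqrtSymbol m ξ * (𝓕 u : L2 d) ξ) :
    sobolevHalfSq u ≤ (1 + ENNReal.ofReal m) * ‖u‖ₑ ^ 2 + ‖f‖ₑ ^ 2 := by
  refine (sobolevHalfSq_le _).trans ?_
  rw [halfNormSq]
  refine (add_le_add le_rfl (energy_zero_le_add hm _)).trans (le_of_eq ?_)
  rw [energy_eq_enorm_sq hf]; ring

/-- The negative part of `φ H φ` exists, because the form is closed: the graph of
`v ↦ √h √ψ 𝓕(φ v)` on the form domain is closed in `L² × L²`, hence a Hilbert space. -/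
theorem exists_isNegPart_localForm (Ω : Set (E d)) {φ : E d → ℝ} (hφ : Continuous φ)
    (hs : HasCompactSupport φ) {μ h : ℝ} (hμ : 0 ≤ μ) (hh : 0 < h) :
    ∃ N : L2 d →L[ℂ] L2 d, IsNegPart (localDomain Ω φ) (localForm μ h φ) N := by
  obtain ⟨M, hM⟩ := hs.exists_bound_of_continuous hφ
  have hm : 0 ≤ μ / h := by positivity
  set m := μ / h with hmdef
  obtain ⟨Φ, -, hΦ⟩ := exists_boundedMul (d := d) (f := fun x => (φ x : ℂ)) (C := M)
    (Complex.continuous_ofReal.comp hφ).aestronglyMeasurable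
    (fun x => by rw [Complex.norm_real]; exact hM x)
  have hΦ' : ∀ v, mulL2 φ v = Φ v := fun v => by
    ext1
    filter_upwards [hΦ v, mulL2_ae φ hφ hs v] with x h1 h2
    rw [h1, h2]
  obtain ⟨A₁, A₂, rel'⟩ := exists_bounded_multipliers (d := d)
    (σ := fun ξ => √(psi m (‖(2 * Real.pi) • ξ‖ ^ 2))) (fun ξ => Real.sqrt_nonneg _)
    (measurable_psi_symbol m).sqrt
  have rel : ∀ f g : L2 d, A₁ f = A₂ g ↔ ∀ᵐ ξ, f ξ = sqrtSymbol m ξ * g ξ := rel'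
  set 𝔉 : L2 d →L[ℂ] L2 d := (Lp.fourierTransformₗᵢ (E d) ℂ).toLinearIsometry.toContinuousLinearMap
  have h𝔉 : ∀ u, 𝔉 u = 𝓕 u := fun u => rfl
  set k : ℂ := ((√h : ℝ) : ℂ)
  have k0 : k ≠ 0 := Complex.ofReal_ne_zero.2 (Real.sqrt_pos.2 hh).ne'
  have kk : starRingEnd ℂ k * k = h := by
    rw [Complex.conj_ofReal, ← Complex.ofReal_mul, Real.mul_self_sqrt hh.le]
  -- the graph of the form: pairs `(v, √h f)` with `f = √ψ 𝓕(φ v)`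
  let G : Submodule ℂ (WithLp 2 (L2 d × L2 d)) :=
    { carrier := {p | MemH0Half Ω (Φ p.fst) ∧ A₁ (k⁻¹ • p.snd) = A₂ (𝔉 (Φ p.fst))}
      add_mem' := fun {p q} hp hq => by
        refine ⟨?_, ?_⟩
        · rw [WithLp.add_fst, map_add]; exact hp.1.add hq.1
        · rw [WithLp.add_fst, WithLp.add_snd, smul_add]
          simp only [map_add]
          rw [hp.2, hq.2]
      zero_mem' := by
        refine ⟨?_, ?_⟩
        · rw [WithLp.zero_fst, map_zero]; exact memH0Half_zero Ω
        · rw [WithLp.zero_fst, WithLp.zero_snd, smul_zero]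
          simp only [map_zero]
      smul_mem' := fun c p hp => by
        refine ⟨?_, ?_⟩
        · rw [WithLp.smul_fst, map_smul]; exact hp.1.smul c
        · rw [WithLp.smul_fst, WithLp.smul_snd, smul_comm]
          simp only [map_smul]
          rw [← hp.2]; simp only [map_smul] }
  have memG : ∀ p, p ∈ G ↔ MemH0Half Ω (Φ p.fst) ∧ A₁ (k⁻¹ • p.snd) = A₂ (𝔉 (Φ p.fst)) :=
    fun p => Iff.rfl
  have closed : IsClosed (G : Set (WithLp 2 (L2 d × L2 d))) := by
    refine isSeqClosed_iff_isClosed.1 fun x y hx hxy => ?_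
    have p1 : Tendsto (fun j => (x j).fst) atTop (𝓝 y.fst) :=
      ((WithLp.fstL 2 ℂ (L2 d) (L2 d)).continuous.tendsto y).comp hxy
    have p2 : Tendsto (fun j => (x j).snd) atTop (𝓝 y.snd) :=
      ((WithLp.sndL 2 ℂ (L2 d) (L2 d)).continuous.tendsto y).comp hxy
    have y2 : A₁ (k⁻¹ • y.snd) = A₂ (𝔉 (Φ y.fst)) := by
      refine tendsto_nhds_unique ((A₁.continuous.tendsto _).comp (p2.const_smul k⁻¹)) ?_
      refine Tendsto.congr (fun j => ((memG _).1 (hx j)).2.symm) ?_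
      exact ((A₂.comp (𝔉.comp Φ)).continuous.tendsto _).comp p1
    refine (memG _).2 ⟨memH0Half_of_approx fun ε hε => ?_, y2⟩
    have bound : ∀ j, sobolevHalfSq (Φ y.fst - Φ (x j).fst) ≤
        (1 + ENNReal.ofReal m) * ‖Φ y.fst - Φ (x j).fst‖ₑ ^ 2 +
          ‖k⁻¹ • y.snd - k⁻¹ • (x j).snd‖ₑ ^ 2 := by
      intro j
      refine sobolevHalfSq_le_of_sqrtSymbol hm ?_
      rw [← h𝔉, ← rel, map_sub, y2, ((memG _).1 (hx j)).2]
      simp only [map_sub]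
    have l3 : ∀ {z : ℕ → L2 d}, Tendsto z atTop (𝓝 0) →
        Tendsto (fun j => ‖z j‖ₑ ^ 2) atTop (𝓝 0) := by
      intro z hz
      have := ((continuous_enorm.tendsto (0 : L2 d)).comp hz)
      rw [enorm_zero] at this
      simpa using ENNReal.Tendsto.pow (n := 2) this
    have l1 : Tendsto (fun j => Φ y.fst - Φ (x j).fst) atTop (𝓝 0) := by
      simpa using ((Φ.continuous.tendsto _).comp p1).const_sub (Φ y.fst)
    have l2 : Tendsto (fun j => k⁻¹ • y.snd - k⁻¹ • (x j).snd) atTop (𝓝 0) := by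
      simpa using (p2.const_smul k⁻¹).const_sub (k⁻¹ • y.snd)
    have lim : Tendsto (fun j => (1 + ENNReal.ofReal m) * ‖Φ y.fst - Φ (x j).fst‖ₑ ^ 2 +
          ‖k⁻¹ • y.snd - k⁻¹ • (x j).snd‖ₑ ^ 2) atTop (𝓝 0) := by
      simpa using (ENNReal.Tendsto.const_mul (l3 l1) (Or.inr (by finiteness))).add (l3 l2)
    obtain ⟨j, hj⟩ := (lim.eventually (gt_mem_nhds hε)).exists
    exact ⟨Φ (x j).fst, ((memG _).1 (hx j)).1, (bound j).trans_lt hj⟩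
  have : CompleteSpace G := closed.completeSpace_coe
  let J : G →L[ℂ] L2 d := (WithLp.fstL 2 ℂ (L2 d) (L2 d)).comp G.subtypeL
  have hJ : ∀ x : G, J x = (x : WithLp 2 (L2 d × L2 d)).fst := fun x => rfl
  have hrange : Set.range J = localDomain Ω φ := by
    ext v
    constructor
    · rintro ⟨x, rfl⟩
      have := ((memG x).1 x.2).1
      change MemH0Half Ω (mulL2 φ (J x))
      rw [hΦ', hJ]; exact this
    · intro hv
      have hv : MemH0Half Ω (mulL2 φ v) := hv
      rw [hΦ'] at hv
      obtain ⟨f, hf⟩ := exists_sqrtSymbol_mul (hv.energy_ne_top hm)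
      have hx : WithLp.toLp 2 (v, k • f) ∈ G := by
        refine (memG _).2 ⟨hv, ?_⟩
        change A₁ (k⁻¹ • k • f) = A₂ (𝔉 (Φ v))
        rw [inv_smul_smul₀ k0, rel, h𝔉]
        exact hf
      exact ⟨⟨_, hx⟩, hJ _⟩
  rw [← hrange]
  refine exists_isNegPart_of_sub J Φ _ fun x y => ?_
  have fx := (rel _ _).1 ((memG x).1 x.2).2
  have fy := (rel _ _).1 ((memG y).1 y.2).2
  have hin : inner ℂ x y = inner ℂ (J x) (J y) + inner ℂ (x : WithLp 2 (L2 d × L2 d)).snd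
      (y : WithLp 2 (L2 d × L2 d)).snd := by
    rw [Submodule.coe_inner, WithLp.prod_inner_apply]
    rfl
  have q : (h : ℂ) * quadForm m (Φ (J x)) (Φ (J y)) =
      inner ℂ (x : WithLp 2 (L2 d × L2 d)).snd (y : WithLp 2 (L2 d × L2 d)).snd := by
    rw [hJ, hJ, quadForm_eq_inner fx fy, ← kk, ← mul_inv_cancel_left₀ k0 (inner ℂ
      (x : WithLp 2 (L2 d × L2 d)).snd (y : WithLp 2 (L2 d × L2 d)).snd), inner_smul_left,
      inner_smul_right, map_inv₀]
    have k1 : starRingEnd ℂ k ≠ 0 := (map_ne_zero _).2 k0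
    field_simp
  rw [localForm, hΦ', hΦ', ← hmdef, q, hin]
  ring

end LocalForm

/-! ### Comparison of localized traces -/

section TraceComparison

variable {d : ℕ}

theorem localDomain.energy_ne_top {Ω : Set (E d)} {φ : E d → ℝ} {v : L2 d}
    (hv : v ∈ localDomain Ω φ) {m : ℝ} (hm : 0 ≤ m) : energy m (mulL2 φ v) ≠ ⊤ :=
  MemH0Half.energy_ne_top hv hm

/-- The trace of the negative part of `φ (h A - 1) φ` is finite. -/
theorem exists_hasTrace_localForm {Ω : Set (E d)} {φ : E d → ℝ} (hφ : Continuous φ)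
    (hs : HasCompactSupport φ) {μ h : ℝ} (hμ : 0 ≤ μ) (hh : 0 < h) {N : L2 d →L[ℂ] L2 d}
    (hN : IsNegPart (localDomain Ω φ) (localForm μ h φ) N) : ∃ t, HasTrace N t := by
  obtain ⟨s, b, -⟩ := exists_hilbertBasis ℂ (L2 d)
  obtain ⟨t, ht, -⟩ := hN.exists_hasTrace_of_forall_contraction b _ (by
    intro S hS hSD F
    have hfin := fun i => localDomain.energy_ne_top (hSD (b i)) (m := μ / h) (by positivity)
    refine le_trans (Finset.sum_le_sum fun i _ => ?_)
      (sum_norm_sq_sub_energy_le hφ hs hμ hh b S hS hfin F)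
    rw [localForm_self_re (hfin i)]
    nlinarith [sq_nonneg ‖mulL2 φ (S (b i))‖])
  exact ⟨t, ht⟩

/-- Multiplication commutes with a change of variables. -/
theorem mulL2_comp {φ φ' : E d → ℝ} (hφ : Continuous φ) (hs : HasCompactSupport φ)
    (hφ' : Continuous φ') (hs' : HasCompactSupport φ') {S : E d → E d}
    (hS : MeasurePreserving S volume volume) (hφS : ∀ y, φ' y = φ (S y)) (v : L2 d) :
    mulL2 φ' (Lp.compMeasurePreserving S hS v) = Lp.compMeasurePreserving S hS (mulL2 φ v) := by
  ext1
  filter_upwards [mulL2_ae φ' hφ' hs' (Lp.compMeasurePreserving S hS v),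
    Lp.coeFn_compMeasurePreserving v hS, Lp.coeFn_compMeasurePreserving (mulL2 φ v) hS,
    hS.quasiMeasurePreserving.ae (mulL2_ae φ hφ hs v)] with x h1 h2 h3 h4
  rw [h1, h2, h3, Function.comp_apply, Function.comp_apply, h4, hφS]

/-- One-sided comparison of the traces under a change of variables `S` with Lipschitz constant `L`:
`h q - 1 ≥ (1 - 2ε) (h q' - 1) + ε (h q' - 2)` for `q ≥ (1 - ε) q'`. -/
theorem trace_le_trace_comp {Ω Ω' : Set (E d)} {φ φ' : E d → ℝ} (hφ : Continuous φ)
    (hs : HasCompactSupport φ) (hφ' : Continuous φ') (hs' : HasCompactSupport φ') {S : E d → E d}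
    (hS : MeasurePreserving S volume volume) {L : ℝ} (hL : 1 ≤ L)
    (hSL : ∀ x y, ‖S x - S y‖ ≤ L * ‖x - y‖) (hφS : ∀ y, φ' y = φ (S y))
    (hD : ∀ v ∈ localDomain Ω φ, Lp.compMeasurePreserving S hS v ∈ localDomain Ω' φ')
    {μ h : ℝ} (hμ : 0 ≤ μ) (hh : 0 < h) {N N' : L2 d →L[ℂ] L2 d} {t t' : ℝ}
    (hN : IsNegPart (localDomain Ω φ) (localForm μ h φ) N) (ht : HasTrace N t)
    (hN' : IsNegPart (localDomain Ω' φ') (localForm μ h φ') N') (ht' : HasTrace N' t')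
    (hε : 2 * (1 - (L ^ (d + 2))⁻¹) ≤ 1) :
    t - t' ≤ (1 - (L ^ (d + 2))⁻¹) * (2 * (∫ x, φ' x ^ 2) *
      (volume.real (Metric.closedBall (0 : E d) 1) * ((1 + μ) ^ ((d : ℝ) / 2) / h ^ d))) := by
  have hm : 0 ≤ μ / h := by positivity
  have hLd : 1 ≤ L ^ (d + 2) := one_le_pow₀ hL
  set ε := 1 - (L ^ (d + 2))⁻¹ with hεdef
  have ε0 : 0 ≤ ε := sub_nonneg.2 (inv_le_one_of_one_le₀ hLd)
  have hLε : (1 - ε) * L ^ (d + 2) = 1 := by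
    rw [hεdef, sub_sub_cancel, inv_mul_cancel₀ (by positivity)]
  set U : L2 d →L[ℂ] L2 d := (Lp.compMeasurePreservingₗᵢ ℂ S hS).toContinuousLinearMap
  have hU : ∀ v, U v = Lp.compMeasurePreserving S hS v := fun v => rfl
  have t0 : 0 ≤ t' := by
    obtain ⟨s, b, -⟩ := exists_hilbertBasis ℂ (L2 d)
    simpa using ht'.sum_le b hN'.isPositive 0 (by simp) ∅
  have main := hN.trace_le_of_form_le hN' (θ := 1 - 2 * ε) (ε := ε)
    (a₃ := fun v w => (h : ℂ) * quadForm (μ / h) (mulL2 φ' v) (mulL2 φ' w) -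
      2 * inner ℂ (mulL2 φ' v) (mulL2 φ' w))
    (K := 2 * (∫ x, φ' x ^ 2) *
      (volume.real (Metric.closedBall (0 : E d) 1) * ((1 + μ) ^ ((d : ℝ) / 2) / h ^ d)))
    ht ht' U (LinearIsometry.norm_toContinuousLinearMap_le _) hD (by linarith) ε0 ?_ ?_
  · nlinarith [mul_nonneg ε0 t0]
  · intro v hv
    have e1 := localDomain.energy_ne_top hv hm
    have e2 := localDomain.energy_ne_top (hD v hv) hm
    have key : (energy (μ / h) (mulL2 φ' (U v))).toReal ≤
        L ^ (d + 2) * (energy (μ / h) (mulL2 φ v)).toReal := by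
      have := energy_comp_le hS hL hSL hm (mulL2 φ v)
      rw [← mulL2_comp hφ hs hφ' hs' hS hφS] at this
      have := ENNReal.toReal_mono (by finiteness) this
      rwa [ENNReal.toReal_mul, ENNReal.toReal_ofReal (by positivity)] at this
    have nrm : ‖mulL2 φ' (U v)‖ = ‖mulL2 φ v‖ := by
      rw [hU, mulL2_comp hφ hs hφ' hs' hS hφS, Lp.norm_compMeasurePreserving]
    rw [← hU] at e2
    have a3 : ((h : ℂ) * quadForm (μ / h) (mulL2 φ' (U v)) (mulL2 φ' (U v)) -
        2 * inner ℂ (mulL2 φ' (U v)) (mulL2 φ' (U v))).re =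
        h * (energy (μ / h) (mulL2 φ' (U v))).toReal - 2 * ‖mulL2 φ' (U v)‖ ^ 2 := by
      rw [quadForm_self e2, inner_self_eq_norm_sq_to_K]
      simp [← Complex.ofReal_pow]
    rw [localForm_self_re e1, localForm_self_re e2, a3, nrm]
    have h3 := mul_le_mul_of_nonneg_left key (show 0 ≤ h * (1 - ε) from
      mul_nonneg hh.le (by linarith))
    have h4 : h * (1 - ε) * (L ^ (d + 2) * (energy (μ / h) (mulL2 φ v)).toReal) =
        h * (energy (μ / h) (mulL2 φ v)).toReal := by
      rw [mul_assoc h, ← mul_assoc (1 - ε), hLε, one_mul]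
    rw [h4] at h3
    nlinarith
  · intro ι b T hT hTD F
    have hfin := fun i => localDomain.energy_ne_top (hTD (b i)) hm
    refine le_trans (le_of_eq (Finset.sum_congr rfl fun i _ => ?_))
      (sum_norm_sq_sub_energy_le hφ' hs' hμ hh b T hT hfin F)
    rw [quadForm_self (hfin i), inner_self_eq_norm_sq_to_K, ← neg_sub
      (h * (energy (μ / h) (mulL2 φ' (T (b i)))).toReal)]
    simp [← Complex.ofReal_pow]

end TraceComparison

/-! ### The coordinates `(x', x_d)` -/

section Coordinates

variable {n : ℕ}

/-- `x ↦ x'` as a continuous linear map. -/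
noncomputable def horizL (n : ℕ) : E (n + 1) →L[ℝ] E n :=
  LinearMap.toContinuousLinearMap
    { toFun := horiz
      map_add' := fun x y => by ext i; simp [horiz]
      map_smul' := fun c x => by ext i; simp [horiz] }

/-- `x ↦ x_d` as a continuous linear form. -/
noncomputable def vertL (n : ℕ) : E (n + 1) →L[ℝ] ℝ :=
  LinearMap.toContinuousLinearMap
    { toFun := vert
      map_add' := fun x y => by simp [vert]
      map_smul' := fun c x => by simp [vert] }

/-- `(x', s) ↦ (x', s)` as a continuous linear map. -/
noncomputable def ptL (n : ℕ) : E n × ℝ →L[ℝ] E (n + 1) :=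
  LinearMap.toContinuousLinearMap
    { toFun := fun p => pt p.1 p.2
      map_add' := fun x y => by
        ext i; refine Fin.lastCases ?_ (fun j => ?_) i <;> simp [pt]
      map_smul' := fun c x => by
        ext i; refine Fin.lastCases ?_ (fun j => ?_) i <;> simp [pt] }

@[simp] theorem horizL_apply (x : E (n + 1)) : horizL n x = horiz x := rfl

@[simp] theorem vertL_apply (x : E (n + 1)) : vertL n x = vert x := rfl

@[simp] theorem ptL_apply (p : E n × ℝ) : ptL n p = pt p.1 p.2 := rfl

theorem horiz_sub (x y : E (n + 1)) : horiz (x - y) = horiz x - horiz y := map_sub (horizL n) x y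

theorem vert_sub (x y : E (n + 1)) : vert (x - y) = vert x - vert y := map_sub (vertL n) x y

theorem pt_sub (x y : E n) (s t : ℝ) : pt x s - pt y t = pt (x - y) (s - t) :=
  (map_sub (ptL n) (x, s) (y, t)).symm

@[simp] theorem horiz_zero : horiz (0 : E (n + 1)) = 0 := map_zero (horizL n)

@[simp] theorem vert_zero : vert (0 : E (n + 1)) = 0 := map_zero (vertL n)

@[simp] theorem pt_zero_zero : pt (0 : E n) 0 = 0 := map_zero (ptL n)

theorem norm_sq_eq_horiz_vert (x : E (n + 1)) : ‖x‖ ^ 2 = ‖horiz x‖ ^ 2 + vert x ^ 2 := by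
  rw [EuclideanSpace.norm_sq_eq, EuclideanSpace.norm_sq_eq, Fin.sum_univ_castSucc]
  simp [horiz, vert]

theorem norm_horiz_le (x : E (n + 1)) : ‖horiz x‖ ≤ ‖x‖ :=
  (sq_le_sq₀ (norm_nonneg _) (norm_nonneg _)).1 (by
    rw [norm_sq_eq_horiz_vert x]; nlinarith [sq_nonneg (vert x)])

theorem abs_vert_le (x : E (n + 1)) : |vert x| ≤ ‖x‖ := by
  refine abs_le_of_sq_le_sq ?_ (norm_nonneg _)
  rw [norm_sq_eq_horiz_vert x]; nlinarith [sq_nonneg ‖horiz x‖]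

theorem norm_pt_sq (x : E n) (s : ℝ) : ‖pt x s‖ ^ 2 = ‖x‖ ^ 2 + s ^ 2 := by
  rw [norm_sq_eq_horiz_vert, horiz_pt, vert_pt]

theorem norm_pt_zero (s : ℝ) : ‖pt (0 : E n) s‖ = |s| := by
  have := norm_pt_sq (0 : E n) s
  rw [norm_zero] at this
  rw [← abs_of_nonneg (norm_nonneg (pt (0 : E n) s))]
  exact (sq_eq_sq_iff_abs_eq_abs _ _).1 (by rw [this]; ring)

@[fun_prop] theorem continuous_horiz : Continuous (horiz : E (n + 1) → E n) :=
  (horizL n).continuous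

@[fun_prop] theorem continuous_vert : Continuous (vert : E (n + 1) → ℝ) := (vertL n).continuous

@[fun_prop] theorem continuous_pt {X : Type*} [TopologicalSpace X] {f : X → E n} {g : X → ℝ}
    (hf : Continuous f) (hg : Continuous g) : Continuous fun x => pt (f x) (g x) :=
  (ptL n).continuous.comp (hf.prodMk hg)

theorem measurePreserving_pt : MeasurePreserving (fun p : E n × ℝ => pt p.1 p.2) := by
  have h1 : MeasurePreserving (fun p : E n × ℝ => (p.2, p.1.ofLp)) :=
    Measure.measurePreserving_swap.comp
      ((PiLp.volume_preserving_ofLp (Fin n)).prod (MeasurePreserving.id volume))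
  have h2 := (volume_preserving_piFinSuccAbove (fun _ : Fin (n + 1) => ℝ) (Fin.last n)).symm
  have h3 := (PiLp.volume_preserving_toLp (Fin (n + 1))).comp (h2.comp h1)
  convert h3 using 1
  ext p i
  refine Fin.lastCases ?_ (fun j => ?_) i <;> simp [pt, MeasurableEquiv.piFinSuccAbove]

theorem measurePreserving_horiz_vert :
    MeasurePreserving (fun x : E (n + 1) => (horiz x, vert x)) := by
  have m : Measurable (fun x : E (n + 1) => (horiz x, vert x)) := by fun_prop
  refine ⟨m, ?_⟩
  rw [← (measurePreserving_pt (n := n)).map_eq, Measure.map_map m measurePreserving_pt.measurable]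
  convert Measure.map_id
  ext1 p
  simp

theorem measurePreserving_affineIsometryEquiv {d : ℕ} (κ : E d ≃ᵃⁱ[ℝ] E d) :
    MeasurePreserving κ := by
  have := κ.toIsometryEquiv.measurePreserving_euclideanHausdorffMeasure d
  rwa [EuclideanSpace.euclideanHausdorffMeasure_eq_volume] at this

theorem measurePreserving_tau {g : E n → ℝ} (hg : Measurable g) :
    MeasurePreserving (tau g) := by
  have h1 : MeasurePreserving (fun p : E n × ℝ => (p.1, p.2 - g p.1)) := 
    MeasurePreserving.skew_product (g := fun a b => b - g a) (MeasurePreserving.id volume)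
      (by fun_prop) (ae_of_all _ fun a => (measurePreserving_sub_right volume (g a)).map_eq)
  exact measurePreserving_pt.comp (h1.comp measurePreserving_horiz_vert)

theorem tau_symm (g : E n → ℝ) : (tau g).symm = tau (-g) := by
  ext x : 1
  simp [tau]

theorem norm_tau_sub_le {g : E n → ℝ} {K : ℝ} (hg : ∀ x y, |g x - g y| ≤ K * ‖x - y‖)
    (hK : 0 ≤ K) (x y : E (n + 1)) : ‖tau g x - tau g y‖ ≤ (1 + K) * ‖x - y‖ := by
  have e : tau g x - tau g y = (x - y) - pt 0 (g (horiz x) - g (horiz y)) := by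
    rw [← pt_horiz_vert (x - y), pt_sub, horiz_sub, vert_sub]
    simp only [tau, Equiv.coe_fn_mk, pt_sub, sub_zero]
    congr 1; ring
  rw [e, add_mul, one_mul]
  refine (norm_sub_le _ _).trans (add_le_add le_rfl ?_)
  rw [norm_pt_zero]
  refine (hg _ _).trans (mul_le_mul_of_nonneg_left ?_ hK)
  rw [← horiz_sub]; exact norm_horiz_le _

end Coordinates

/-! ### Localized operators under a change of variables -/

section ChangeOfVariables

variable {d : ℕ}

theorem mulL2_ae_eq_zero {φ : E d → ℝ} (hφ : Continuous φ) (hs : HasCompactSupport φ)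
    (v : L2 d) : ∀ᵐ x : E d, x ∉ tsupport φ → mulL2 φ v x = 0 := by
  filter_upwards [mulL2_ae φ hφ hs v] with x h hx
  rw [h, image_eq_zero_of_notMem_tsupport hx, Complex.ofReal_zero, zero_mul]

/-- A volume preserving change of variables of `ℝ^d` with Lipschitz constant `L` in both
directions. -/
structure BiLipschitzChange (d : ℕ) (L : ℝ) extends E d ≃ E d where
  measurePreserving : MeasurePreserving toFun
  measurePreserving_symm : MeasurePreserving invFun
  norm_sub_le : ∀ x y, ‖toFun x - toFun y‖ ≤ L * ‖x - y‖
  norm_symm_sub_le : ∀ x y, ‖invFun x - invFun y‖ ≤ L * ‖x - y‖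

namespace BiLipschitzChange

variable {L : ℝ} (T : BiLipschitzChange d L)

/-- The inverse change of variables. -/
def symm : BiLipschitzChange d L where
  toEquiv := T.toEquiv.symm
  measurePreserving := T.measurePreserving_symm
  measurePreserving_symm := T.measurePreserving
  norm_sub_le := T.norm_symm_sub_le
  norm_symm_sub_le := T.norm_sub_le

theorem continuous : Continuous T.toFun := continuous_of_norm_sub_le T.norm_sub_le

/-- A bi-Lipschitz change of variables as a homeomorphism. -/
def homeomorph : E d ≃ₜ E d where
  toEquiv := T.toEquiv
  continuous_toFun := T.continuous
  continuous_invFun := T.symm.continuous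

theorem hasCompactSupport_comp {φ : E d → ℝ} (hs : HasCompactSupport φ) :
    HasCompactSupport fun y => φ (T.invFun y) :=
  hs.comp_homeomorph T.homeomorph.symm

theorem tsupport_comp_subset {φ : E d → ℝ} {y : E d}
    (hy : y ∈ tsupport fun y => φ (T.invFun y)) : T.invFun y ∈ tsupport φ :=
  tsupport_comp_subset_preimage φ T.symm.continuous hy

theorem integral_comp (f : E d → ℝ) : ∫ x, f (T.toFun x) = ∫ y, f y :=
  T.measurePreserving.integral_comp T.homeomorph.measurableEmbedding f

theorem mem_localDomain_comp {Ω Ω' V : Set (E d)} (hΩ' : IsOpen Ω') (hV : IsOpen V) (hL : 1 ≤ L)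
    (hmap : ∀ x ∈ Ω ∩ V, T.toFun x ∈ Ω') {φ : E d → ℝ} (hφ : Continuous φ)
    (hs : HasCompactSupport φ) (hsV : tsupport φ ⊆ V) {v : L2 d} (hv : v ∈ localDomain Ω φ) :
    Lp.compMeasurePreserving T.invFun T.measurePreserving_symm v ∈
      localDomain Ω' fun y => φ (T.invFun y) := by
  change MemH0Half Ω' (mulL2 _ _)
  have c' : Continuous fun y => φ (T.invFun y) := hφ.comp T.symm.continuous
  rw [mulL2_comp hφ hs c' (T.hasCompactSupport_comp hs) T.measurePreserving_symm fun y => rfl]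
  exact memH0Half_comp hΩ' hV T.measurePreserving_symm hL T.norm_sub_le T.norm_symm_sub_le
    T.right_inv hmap hs hsV (mulL2_ae_eq_zero hφ hs v) hv

/-- The traces of the localized operators on `Ω` and `Ω'` are close if `L` is close to `1`, for a
change of variables that maps `Ω` to `Ω'` near the support of `φ`. -/
theorem abs_trace_sub_trace_le {Ω Ω' V : Set (E d)} (hΩ : IsOpen Ω) (hΩ' : IsOpen Ω')
    (hV : IsOpen V) (hL : 1 ≤ L) (hmap : ∀ x ∈ V, x ∈ Ω ↔ T.toFun x ∈ Ω') {φ φ' : E d → ℝ}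
    (hφ : Continuous φ) (hs : HasCompactSupport φ) (hsV : tsupport φ ⊆ V)
    (hφ' : ∀ y, φ' y = φ (T.invFun y)) {μ h : ℝ} (hμ : 0 ≤ μ) (hh : 0 < h)
    {N N' : L2 d →L[ℂ] L2 d} {t t' : ℝ}
    (hN : IsNegPart (localDomain Ω φ) (localForm μ h φ) N) (ht : HasTrace N t)
    (hN' : IsNegPart (localDomain Ω' φ') (localForm μ h φ') N') (ht' : HasTrace N' t')
    (hε : 2 * (1 - (L ^ (d + 2))⁻¹) ≤ 1) :
    |t - t'| ≤ (1 - (L ^ (d + 2))⁻¹) * (2 * (∫ x, φ x ^ 2) *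
      (volume.real (Metric.closedBall (0 : E d) 1) * ((1 + μ) ^ ((d : ℝ) / 2) / h ^ d))) := by
  obtain rfl : φ' = fun y => φ (T.invFun y) := funext hφ'
  have c' : Continuous fun y => φ (T.invFun y) := hφ.comp T.symm.continuous
  have s' := T.hasCompactSupport_comp hs
  have hφφ : ∀ x, φ x = φ (T.invFun (T.toFun x)) := fun x => by rw [T.left_inv x]
  rw [abs_sub_le_iff]
  constructor
  · have := trace_le_trace_comp hφ hs c' s' T.measurePreserving_symm hL T.norm_symm_sub_le
      (fun _ => rfl) (fun v => T.mem_localDomain_comp hΩ' hV hL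
        (fun x hx => (hmap x hx.2).1 hx.1) hφ hs hsV) hμ hh hN ht hN' ht' hε
    rwa [show ∫ y, φ (T.invFun y) ^ 2 = ∫ x, φ x ^ 2 from
      T.symm.integral_comp fun x => φ x ^ 2] at this
  · refine trace_le_trace_comp c' s' hφ hs T.measurePreserving hL T.norm_sub_le
      hφφ ?_ hμ hh hN' ht' hN ht hε
    intro v hv
    have := T.symm.mem_localDomain_comp (Ω := Ω') (Ω' := Ω) (V := T.invFun ⁻¹' V) hΩ
      (hV.preimage T.symm.continuous) hL ?_ c' s' (fun y hy => hsV (T.tsupport_comp_subset hy)) hv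
    · rwa [show (fun y => φ (T.invFun (T.symm.invFun y))) = φ from
        funext fun x => (hφφ x).symm] at this
    · rintro x ⟨hx, hxV⟩
      have := (hmap _ hxV).2
      rw [T.right_inv x] at this
      exact this hx

theorem setIntegral_comp {Ω Ω' V : Set (E d)} (hΩ : IsOpen Ω) (hΩ' : IsOpen Ω')
    (hmap : ∀ x ∈ V, x ∈ Ω ↔ T.toFun x ∈ Ω') {f : E d → ℝ} (hf : ∀ x ∉ V, f x = 0) :
    ∫ x in Ω, f x = ∫ y in Ω', f (T.invFun y) := by
  rw [← integral_indicator hΩ.measurableSet, ← integral_indicator hΩ'.measurableSet,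
    ← T.integral_comp (Set.indicator Ω' _)]
  congr 1 with x
  by_cases hx : x ∈ V
  · by_cases hxΩ : x ∈ Ω
    · rw [Set.indicator_of_mem hxΩ, Set.indicator_of_mem ((hmap x hx).1 hxΩ)]
      exact congrArg f (T.left_inv x).symm
    · rw [Set.indicator_of_notMem hxΩ, Set.indicator_of_notMem fun h => hxΩ ((hmap x hx).2 h)]
  · rw [Set.indicator_apply_eq_zero.2 fun _ => hf x hx, Set.indicator_apply_eq_zero.2 fun _ => ?_]
    rw [T.left_inv x, hf x hx]

end BiLipschitzChange

end ChangeOfVariables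

/-! ### The straightening map -/

section Straightening

variable {n : ℕ}

theorem norm_map_sub {d : ℕ} (κ : E d ≃ᵃⁱ[ℝ] E d) (x y : E d) : ‖κ x - κ y‖ = ‖x - y‖ := by
  rw [← dist_eq_norm, ← dist_eq_norm, κ.dist_map]

/-- `x ↦ τ(κ(x))` for Cartesian coordinates `κ` and a Lipschitz function `g`. -/
def straightening {K : ℝ} (κ : E (n + 1) ≃ᵃⁱ[ℝ] E (n + 1)) (g : E n → ℝ) (hK : 0 ≤ K)
    (hg : ∀ x y, |g x - g y| ≤ K * ‖x - y‖) : BiLipschitzChange (n + 1) (1 + K) where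
  toEquiv := κ.toEquiv.trans (tau g)
  measurePreserving := (measurePreserving_tau (continuous_of_norm_sub_le hg).measurable).comp
    (measurePreserving_affineIsometryEquiv κ)
  measurePreserving_symm := (measurePreserving_affineIsometryEquiv κ.symm).comp (by
    rw [tau_symm]
    exact measurePreserving_tau (continuous_of_norm_sub_le hg).measurable.neg)
  norm_sub_le x y := by
    refine (norm_tau_sub_le hg hK _ _).trans (le_of_eq ?_)
    congr 1
    exact norm_map_sub κ x y
  norm_symm_sub_le x y := by
    have h := norm_tau_sub_le (g := -g) (K := K)
      (fun x y => by simpa [abs_sub_comm, neg_add_eq_sub] using hg x y) hK x y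
    rw [← tau_symm] at h
    refine le_of_eq_of_le ?_ h
    exact norm_map_sub κ.symm _ _

variable {Ω : Set (E (n + 1))} {w : ℝ → ℝ} {z p : E (n + 1)} {l : ℝ}
  {κ : E (n + 1) ≃ᵃⁱ[ℝ] E (n + 1)} {g : E n → ℝ}

theorem projBall_eq (κ : E (n + 1) ≃ᵃⁱ[ℝ] E (n + 1)) (z : E (n + 1)) (l : ℝ) :
    projBall κ z l = Metric.ball (horiz (κ z)) l := by
  ext x'
  constructor
  · rintro ⟨x, hx, rfl⟩
    rw [mem_ball_iff_norm] at hx ⊢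
    calc _ = ‖horiz (κ x - κ z)‖ := by rw [horiz_sub]
      _ ≤ ‖κ x - κ z‖ := norm_horiz_le _
      _ = ‖x - z‖ := norm_map_sub κ x z
      _ < l := hx
  · intro hx
    rw [mem_ball_iff_norm] at hx
    refine ⟨κ.symm (pt x' (vert (κ z))), ?_, by simp⟩
    rw [mem_ball_iff_norm, ← norm_map_sub κ, κ.apply_symm_apply, ← pt_horiz_vert (κ z), pt_sub,
      pt_horiz_vert, sub_self]
    have := norm_pt_sq (x' - horiz (κ z)) 0
    rw [zero_pow two_ne_zero, add_zero] at this
    rwa [(sq_eq_sq₀ (norm_nonneg _) (norm_nonneg _)).1 this]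

/-- The function `φ'` is `φ ∘ (τ ∘ κ)⁻¹` for any extension `g'` of `g`: outside `D × ℝ` both vanish. -/
theorem straightened_eq_comp {g' : E n → ℝ} {K : ℝ} (hK : 0 ≤ K)
    (hg' : ∀ x y, |g' x - g' y| ≤ K * ‖x - y‖) (hgg : Set.EqOn g g' (projBall κ z l))
    {φ : E (n + 1) → ℝ} (hφ : ∀ x ∉ Metric.ball z l, φ x = 0) (y : E (n + 1)) :
    straightened κ g (projBall κ z l) φ y = φ ((straightening κ g' hK hg').invFun y) := by
  change _ = φ (κ.symm ((tau g').symm y))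
  rw [straightened]
  split_ifs with h
  · simp only [tau, Equiv.coe_fn_symm_mk, hgg h]
  · rw [hφ]
    intro hx
    refine h ⟨_, hx, ?_⟩
    simp [tau]

theorem tsupport_straightened_subset {g' : E n → ℝ} {K : ℝ} (hK : 0 ≤ K)
    (hg' : ∀ x y, |g' x - g' y| ≤ K * ‖x - y‖) {φ : E (n + 1) → ℝ}
    (hφ : tsupport φ ⊆ Metric.ball z l) {y : E (n + 1)}
    (hy : y ∈ tsupport fun y => φ ((straightening κ g' hK hg').invFun y)) :
    horiz y ∈ projBall κ z l := by
  refine ⟨_, hφ ((straightening κ g' hK hg').tsupport_comp_subset hy), ?_⟩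
  change horiz (κ (κ.symm ((tau g').symm y))) = horiz y
  simp [tau]

namespace IsBoundaryChart

theorem zero_mem (hc : IsBoundaryChart Ω w z l p κ g) : (0 : E n) ∈ projBall κ z l :=
  ⟨p, hc.mem_ball, by simp [hc.center]⟩

theorem radius_pos (hc : IsBoundaryChart Ω w z l p κ g) : 0 < l :=
  Metric.pos_of_mem_ball hc.mem_ball

theorem differentiableAt (hc : IsBoundaryChart Ω w z l p κ g)
    {x : E n} (hx : x ∈ projBall κ z l) : DifferentiableAt ℝ g x :=
  hc.differentiable.differentiableAt ((projBall_eq κ z l ▸ Metric.isOpen_ball).mem_nhds hx)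

/-- Both `0` and the points of `D_l` have distance at most `l` from the centre of `D_l`. -/
theorem norm_fderiv_le (hc : IsBoundaryChart Ω w z l p κ g)
    (hw : IsModulus w) {x : E n} (hx : x ∈ projBall κ z l) :
    ‖fderiv ℝ g x‖ ≤ 2 * w l := by
  have l0 := hc.radius_pos
  have hq : horiz (κ z) ∈ projBall κ z l := ⟨z, Metric.mem_ball_self l0, rfl⟩
  have key : ∀ y ∈ projBall κ z l, w ‖y - horiz (κ z)‖ ≤ w l := fun y hy => by
    rw [projBall_eq, mem_ball_iff_norm] at hy
    exact hw.mono (norm_nonneg _) l0.le hy.le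
  have h1 := (hc.modulus x hx _ hq).trans (key x hx)
  have h2 := (hc.modulus 0 hc.zero_mem _ hq).trans (key 0 hc.zero_mem)
  have h3 : fderiv ℝ g x = (fderiv ℝ g x - fderiv ℝ g (horiz (κ z))) -
      (fderiv ℝ g 0 - fderiv ℝ g (horiz (κ z))) := by
    rw [hc.fderiv_zero]; abel
  rw [h3, two_mul]
  exact (norm_sub_le _ _).trans (add_le_add h1 h2)

theorem exists_lipschitz_extension (hc : IsBoundaryChart Ω w z l p κ g) (hw : IsModulus w) :
    ∃ g' : E n → ℝ, (∀ x y, |g' x - g' y| ≤ 2 * w l * ‖x - y‖) ∧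
      Set.EqOn g g' (projBall κ z l) := by
  have w0 : 0 ≤ 2 * w l := mul_nonneg zero_le_two (hw.nonneg l hc.radius_pos.le)
  have hlip : LipschitzOnWith ⟨2 * w l, w0⟩ g (projBall κ z l) := by
    refine Convex.lipschitzOnWith_of_nnnorm_fderiv_le (𝕜 := ℝ) (fun x hx => hc.differentiableAt hx)
      (fun x hx => ?_) (projBall_eq κ z l ▸ convex_ball _ _)
    exact hc.norm_fderiv_le hw hx
  obtain ⟨g', h1, h2⟩ := hlip.extend_real
  refine ⟨g', fun x y => ?_, h2⟩
  have := h1.dist_le_mul x y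
  rwa [Real.dist_eq, dist_eq_norm] at this

theorem contDiffOn (hc : IsBoundaryChart Ω w z l p κ g)
    (hw : IsModulus w) : ContDiffOn ℝ 1 g (projBall κ z l) := by
  have ho : IsOpen (projBall κ z l) := projBall_eq κ z l ▸ Metric.isOpen_ball
  rw [show (1 : WithTop ℕ∞) = 0 + 1 from rfl, contDiffOn_succ_iff_fderiv_of_isOpen ho]
  refine ⟨hc.differentiable, by simp, contDiffOn_zero.2 fun x hx => ?_⟩
  rw [ContinuousWithinAt, tendsto_iff_norm_sub_tendsto_zero]
  refine squeeze_zero' (g := fun y => if y = x then 0 else w ‖y - x‖)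
    (.of_forall fun y => norm_nonneg _) ?_ ?_
  · filter_upwards [self_mem_nhdsWithin] with y hy
    split_ifs with h
    · simp [h]
    · exact hc.modulus y hy x hx
  · refine Metric.tendsto_nhdsWithin_nhds.2 fun ε hε => ?_
    obtain ⟨δ, hδ, h⟩ := Metric.tendsto_nhdsWithin_nhds.1 hw.tendsto_zero ε hε
    refine ⟨δ, hδ, fun y _ hyδ => ?_⟩
    split_ifs with hyx
    · simpa using hε
    · rw [dist_eq_norm] at hyδ
      exact h (norm_pos_iff.2 (sub_ne_zero.2 hyx)) (by simpa using hyδ)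

theorem mem_iff_straightening (hc : IsBoundaryChart Ω w z l p κ g)
    {g' : E n → ℝ} {K : ℝ} (hK : 0 ≤ K)
    (hg' : ∀ x y, |g' x - g' y| ≤ K * ‖x - y‖) (hgg : Set.EqOn g g' (projBall κ z l))
    {x : E (n + 1)} (hx : x ∈ Metric.ball z l) :
    x ∈ Ω ↔ (straightening κ g' hK hg').toFun x ∈ halfSpace n := by
  have h : horiz (κ x) ∈ projBall κ z l := ⟨x, hx, rfl⟩
  change _ ↔ 0 < vert (pt _ (vert (κ x) - g' (horiz (κ x))))
  rw [hc.mem_iff x hx, vert_pt, sub_pos, hgg h]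

theorem contDiff_straightened (hc : IsBoundaryChart Ω w z l p κ g)
    (hw : IsModulus w) {g' : E n → ℝ} {K : ℝ} (hK : 0 ≤ K)
    (hg' : ∀ x y, |g' x - g' y| ≤ K * ‖x - y‖) (hgg : Set.EqOn g g' (projBall κ z l))
    {φ : E (n + 1) → ℝ} (hφ : ContDiff ℝ 1 φ) (hs : tsupport φ ⊆ Metric.ball z l) :
    ContDiff ℝ 1 fun y => φ ((straightening κ g' hK hg').invFun y) := by
  have ho : IsOpen (projBall κ z l) := projBall_eq κ z l ▸ Metric.isOpen_ball
  refine contDiff_iff_contDiffAt.2 fun y => ?_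
  by_cases hy : y ∉ tsupport fun y => φ ((straightening κ g' hK hg').invFun y)
  · exact contDiffAt_const.congr_of_eventuallyEq (notMem_tsupport_iff_eventuallyEq.1 hy)
  have hy := tsupport_straightened_subset hK hg' hs (not_not.1 hy)
  have hg : ContDiffAt ℝ 1 g' (horiz y) :=
    ((hc.contDiffOn hw).contDiffAt (ho.mem_nhds hy)).congr_of_eventuallyEq
      (hgg.symm.eventuallyEq_of_mem (ho.mem_nhds hy))
  have h1 : ContDiffAt ℝ 1
      (fun y : E (n + 1) => ptL n (horizL n y, vertL n y + g' (horizL n y))) y :=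
    (ptL n).contDiff.contDiffAt.comp y ((horizL n).contDiff.contDiffAt.prodMk
      ((vertL n).contDiff.contDiffAt.add (hg.comp y (horizL n).contDiff.contDiffAt)))
  exact (hφ.comp κ.symm.toAffineIsometry.toContinuousAffineMap.contDiff).contDiffAt.comp y h1

end IsBoundaryChart

end Straightening

/-! ### Surface measure of a graph -/

section Surface

theorem euclideanHausdorffMeasure_image_le {X Y : Type*} [EMetricSpace X] [MeasurableSpace X]
    [BorelSpace X] [EMetricSpace Y] [MeasurableSpace Y] [BorelSpace Y] {K : NNReal} {f : X → Y}
    (hf : LipschitzWith K f) (n : ℕ) (s : Set X) :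
    (μHE[n] : Measure Y) (f '' s) ≤ (K : ℝ≥0∞) ^ n * (μHE[n] : Measure X) s := by
  rw [Measure.euclideanHausdorffMeasure_def, Measure.euclideanHausdorffMeasure_def,
    Measure.smul_apply, Measure.smul_apply, ENNReal.smul_def, ENNReal.smul_def, smul_eq_mul,
    smul_eq_mul, mul_left_comm]
  gcongr
  simpa using hf.hausdorffMeasure_image_le (Nat.cast_nonneg n) s

variable {n : ℕ}

/-- The parametrization of the graph of `g` in the coordinates `κ`. -/
noncomputable def graphMap (κ : E (n + 1) ≃ᵃⁱ[ℝ] E (n + 1)) (g : E n → ℝ) (x : E n) : E (n + 1) :=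
  κ.symm (pt x (g x))

variable {κ : E (n + 1) ≃ᵃⁱ[ℝ] E (n + 1)} {g : E n → ℝ} {K : ℝ}

theorem horiz_graphMap (x : E n) : horiz (κ (graphMap κ g x)) = x := by simp [graphMap]

theorem lipschitzWith_graphMap (hg : ∀ x y, |g x - g y| ≤ K * ‖x - y‖) :
    LipschitzWith (√(1 + K ^ 2)).toNNReal (graphMap κ g) := by
  refine LipschitzWith.of_dist_le' fun x y => ?_
  rw [dist_eq_norm, dist_eq_norm, graphMap, graphMap, norm_map_sub κ.symm, pt_sub]
  refine le_of_sq_le_sq ?_ (by positivity)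
  rw [norm_pt_sq, mul_pow, Real.sq_sqrt (by positivity), add_mul, one_mul,
    ← mul_pow, ← sq_abs (g x - g y)]
  gcongr
  exact hg x y

theorem isClosedEmbedding_graphMap (hg : ∀ x y, |g x - g y| ≤ K * ‖x - y‖) :
    IsClosedEmbedding (graphMap κ g) := by
  have hc : Continuous fun x => horiz (κ x) := continuous_horiz.comp κ.continuous
  exact Function.LeftInverse.isClosedEmbedding (f := fun x => horiz (κ x)) horiz_graphMap hc
    (lipschitzWith_graphMap hg).continuous

/-- The projection of the graph to `ℝ^{d-1}` does not increase distances. -/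
theorem volume_le_comap_graphMap (hg : ∀ x y, |g x - g y| ≤ K * ‖x - y‖) :
    (volume : Measure (E n)) ≤ (μHE[n] : Measure (E (n + 1))).comap (graphMap κ g) := by
  refine Measure.le_iff.2 fun s hs => ?_
  have me := (isClosedEmbedding_graphMap (κ := κ) hg).measurableEmbedding
  rw [me.comap_apply]
  have hP : LipschitzWith 1 fun x => horiz (κ x) := LipschitzWith.of_dist_le_mul fun x y => by
    rw [NNReal.coe_one, one_mul, dist_eq_norm, dist_eq_norm, ← horiz_sub, ← norm_map_sub κ x y]
    exact norm_horiz_le _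
  have := euclideanHausdorffMeasure_image_le hP n (graphMap κ g '' s)
  rw [Set.image_image] at this
  simpa [horiz_graphMap, EuclideanSpace.euclideanHausdorffMeasure_eq_volume] using this

theorem comap_graphMap_le (hg : ∀ x y, |g x - g y| ≤ K * ‖x - y‖) :
    (μHE[n] : Measure (E (n + 1))).comap (graphMap κ g) ≤
      ENNReal.ofReal (√(1 + K ^ 2) ^ n) • (volume : Measure (E n)) := by
  refine Measure.le_iff.2 fun s hs => ?_
  have me := (isClosedEmbedding_graphMap (κ := κ) hg).measurableEmbedding
  rw [me.comap_apply, Measure.smul_apply, smul_eq_mul, ENNReal.ofReal_pow (by positivity),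
    ← EuclideanSpace.euclideanHausdorffMeasure_eq_volume]
  exact euclideanHausdorffMeasure_image_le (lipschitzWith_graphMap hg) n s

/-- Integrals over the graph and over its projection differ at most by the factor
`(1 + K²)^{n/2}`. -/
theorem setIntegral_range_graphMap (hg : ∀ x y, |g x - g y| ≤ K * ‖x - y‖)
    {f : E (n + 1) → ℝ} (hf : Continuous f) (hs : HasCompactSupport f) (h0 : ∀ x, 0 ≤ f x) :
    IntegrableOn f (Set.range (graphMap κ g)) μHE[n] ∧
    ∫ x, f (graphMap κ g x) ≤ ∫ x in Set.range (graphMap κ g), f x ∂μHE[n] ∧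
    ∫ x in Set.range (graphMap κ g), f x ∂μHE[n] ≤ √(1 + K ^ 2) ^ n * ∫ x, f (graphMap κ g x) := by
  have ce := isClosedEmbedding_graphMap (κ := κ) hg
  have me := ce.measurableEmbedding
  have i1 : Integrable (fun x => f (graphMap κ g x)) :=
    (hf.comp ce.continuous).integrable_of_hasCompactSupport (hs.comp_isClosedEmbedding ce)
  have i2 := i1.smul_measure (c := ENNReal.ofReal (√(1 + K ^ 2) ^ n)) ENNReal.ofReal_ne_top
  have i3 := i2.mono_measure (comap_graphMap_le (κ := κ) hg)
  rw [IntegrableOn, ← me.map_comap, me.integrable_map_iff, me.integral_map]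
  refine ⟨i3, ?_, ?_⟩
  · exact integral_mono_measure (volume_le_comap_graphMap hg) (ae_of_all _ fun x => h0 _) i3
  · refine (integral_mono_measure (comap_graphMap_le hg) (ae_of_all _ fun x => h0 _) i2).trans ?_
    rw [integral_smul_measure, ENNReal.toReal_ofReal (by positivity), smul_eq_mul]

theorem IsBoundaryChart.indicator_frontier {Ω : Set (E (n + 1))} {w : ℝ → ℝ} {z p : E (n + 1)}
    {l : ℝ} (hc : IsBoundaryChart Ω w z l p κ g) {g' : E n → ℝ}
    (hgg : Set.EqOn g g' (projBall κ z l)) {f : E (n + 1) → ℝ}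
    (hf : ∀ x ∉ Metric.ball z l, f x = 0) :
    (frontier Ω).indicator f = (Set.range (graphMap κ g')).indicator f := by
  ext x
  by_cases hx : x ∈ Metric.ball z l
  · have e : x ∈ frontier Ω ↔ x ∈ Set.range (graphMap κ g') := by
      rw [hc.frontier_iff x hx, hgg ⟨x, hx, rfl⟩]
      constructor
      · intro h
        exact ⟨horiz (κ x), by rw [graphMap, ← h, pt_horiz_vert, κ.symm_apply_apply]⟩
      · rintro ⟨y, rfl⟩
        simp [graphMap]
    by_cases hxf : x ∈ frontier Ω
    · rw [Set.indicator_of_mem hxf, Set.indicator_of_mem (e.1 hxf)]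
    · rw [Set.indicator_of_notMem hxf, Set.indicator_of_notMem (mt e.2 hxf)]
  · rw [Set.indicator_apply_eq_zero.2 fun _ => hf x hx,
      Set.indicator_apply_eq_zero.2 fun _ => hf x hx]

theorem sqrt_one_add_sq_pow_sub_one_le {K : ℝ} (h0 : 0 ≤ K) (h1 : K ≤ 1) (n : ℕ) :
    √(1 + K ^ 2) ^ n - 1 ≤ 2 ^ n * K ^ 2 := by
  have k1 : K ^ 2 ≤ 1 := pow_le_one₀ h0 h1
  have k0 := sq_nonneg K
  have hs : √(1 + K ^ 2) ≤ 1 + K ^ 2 := by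
    rw [Real.sqrt_le_left (by positivity)]; nlinarith
  have : (1 + K ^ 2) ^ n ≤ 1 + (2 ^ n - 1) * K ^ 2 := by
    induction n with
    | zero => simp
    | succ n ih =>
      have : (1 : ℝ) ≤ 2 ^ n := one_le_pow₀ (by norm_num)
      calc (1 + K ^ 2) ^ (n + 1) ≤ (1 + (2 ^ n - 1) * K ^ 2) * (1 + K ^ 2) := by
            rw [pow_succ]; gcongr
        _ ≤ 1 + (2 ^ (n + 1) - 1) * K ^ 2 := by
            rw [pow_succ (2 : ℝ)]
            nlinarith [mul_nonneg (mul_nonneg k0 (sub_nonneg.2 k1)) (sub_nonneg.2 this)]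
  have := pow_le_pow_left₀ (Real.sqrt_nonneg _) hs n
  nlinarith

end Surface

/-! ### The estimates in boundary coordinates -/

section Estimates

theorem integral_sq_le {d : ℕ} {f : E d → ℝ} {M l : ℝ} {z : E d} (hl : 0 < l)
    (hf : ∀ x ∉ Metric.ball z l, f x = 0) (hM : ∀ x, |f x| ≤ M) :
    ∫ x, f x ^ 2 ≤ M ^ 2 * (volume.real (Metric.ball (0 : E d) 1) * l ^ d) := by
  have h1 : ∫ x in Metric.ball z l, f x ^ 2 = ∫ x, f x ^ 2 :=
    setIntegral_eq_integral_of_forall_compl_eq_zero fun x hx => by rw [hf x hx]; ring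
  have h2 := norm_setIntegral_le_of_norm_le_const (μ := volume) (s := Metric.ball z l)
    (f := fun x => f x ^ 2) (C := M ^ 2) measure_ball_lt_top fun x _ => by
      rw [Real.norm_of_nonneg (sq_nonneg _), ← sq_abs]
      exact pow_le_pow_left₀ (abs_nonneg _) (hM x) 2
  rw [h1] at h2
  refine (le_abs_self _).trans (h2.trans (le_of_eq ?_))
  rw [Measure.real, Measure.addHaar_ball_of_pos _ _ hl, ENNReal.toReal_mul,
    ENNReal.toReal_ofReal (by positivity)]
  simp [Measure.real, mul_comm]

theorem one_sub_inv_pow_le {K : ℝ} (h0 : 0 ≤ K) (h1 : K ≤ 1) (N : ℕ) :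
    1 - ((1 + K) ^ N)⁻¹ ≤ N * K := by
  have h2 : (1 - K) ≤ (1 + K)⁻¹ := by
    rw [← one_div, le_div_iff₀ (by linarith)]; nlinarith
  have h3 := one_add_mul_le_pow (a := -K) (by linarith) N
  have h4 := pow_le_pow_left₀ (by linarith) h2 N
  rw [inv_pow] at h4
  rw [← sub_eq_add_neg] at h3
  linarith

/-- The comparison of `Ω` with the half-space in boundary coordinates. -/
theorem exists_straightening_estimates {n : ℕ} {Ω : Set (E (n + 1))} (hΩo : IsOpen Ω) {w : ℝ → ℝ}
    (hw : IsModulus w) : ∃ c : ℝ, 0 < c ∧ ∃ C : ℝ, 0 < C ∧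
      ∀ (z : E (n + 1)) (l : ℝ), 0 < l → l ≤ c →
      ∀ (p : E (n + 1)) (κ : E (n + 1) ≃ᵃⁱ[ℝ] E (n + 1)) (g : E n → ℝ),
        IsBoundaryChart Ω w z l p κ g →
      ∀ (φ : E (n + 1) → ℝ) (M : ℝ), ContDiff ℝ 1 φ → tsupport φ ⊆ Metric.ball z l →
        (∀ x, |φ x| ≤ M) →
      ∀ φ' : E (n + 1) → ℝ, φ' = straightened κ g (projBall κ z l) φ →
        (ContDiff ℝ 1 φ' ∧ HasCompactSupport φ') ∧
        (∀ μ h : ℝ, 0 ≤ μ → 0 < h →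
          ∃ (N N' : L2 (n + 1) →L[ℂ] L2 (n + 1)) (t t' : ℝ),
            IsNegPart (localDomain Ω φ) (localForm μ h φ) N ∧ HasTrace N t ∧
            IsNegPart (localDomain (halfSpace n) φ') (localForm μ h φ') N' ∧ HasTrace N' t' ∧
            |t - t'| ≤ C * M ^ 2 * w l * l ^ (n + 1) * (1 + μ) ^ (((n : ℝ) + 1) / 2) /
              h ^ (n + 1)) ∧
        (∫ x in Ω, φ x ^ 2) = (∫ x in halfSpace n, φ' x ^ 2) ∧
        IntegrableOn (fun x => φ x ^ 2) (frontier Ω) μHE[n] ∧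
        0 ≤ (∫ x in frontier Ω, φ x ^ 2 ∂μHE[n]) - (∫ x' : E n, φ' (pt x' 0) ^ 2) ∧
        (∫ x in frontier Ω, φ x ^ 2 ∂μHE[n]) - (∫ x' : E n, φ' (pt x' 0) ^ 2) ≤
          C * M ^ 2 * w l ^ 2 * l ^ n := by
  set V₁ := volume.real (Metric.ball (0 : E (n + 1)) 1)
  set V₂ := volume.real (Metric.closedBall (0 : E (n + 1)) 1)
  set V₃ := volume.real (Metric.ball (0 : E n) 1)
  have hV₁ : 0 ≤ V₁ := measureReal_nonneg
  have hV₂ : 0 ≤ V₂ := measureReal_nonneg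
  have hV₃ : 0 ≤ V₃ := measureReal_nonneg
  -- for `l < δ`, `4 (d + 2) w(l) ≤ 1`, which makes `2ε ≤ 1` and the Lipschitz constant at most `1`
  obtain ⟨δ, hδ, hwδ⟩ := Metric.tendsto_nhdsWithin_nhds.1 hw.tendsto_zero
    (1 / (4 * (n + 3))) (by positivity)
  refine ⟨δ / 2, by positivity, 4 * (n + 3) * V₁ * V₂ + 2 ^ n * 4 * V₃ + 1, by positivity, ?_⟩
  intro z l l0 lc p κ g hc φ M hφ hsφ hM φ' hφ'
  have M0 : 0 ≤ M := (abs_nonneg _).trans (hM 0)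
  have w0 := hw.nonneg l l0.le
  have wl : w l * (4 * (n + 3)) ≤ 1 := by
    have := hwδ (x := l) l0 (by rw [Real.dist_eq, sub_zero, abs_of_pos l0]; linarith)
    rw [Real.dist_eq, sub_zero, abs_of_nonneg w0] at this
    rw [← le_div_iff₀ (by positivity)]
    exact this.le
  have n0 : (0 : ℝ) ≤ n := n.cast_nonneg
  have K0 : 0 ≤ 2 * w l := by positivity
  have K1 : 2 * w l ≤ 1 := by nlinarith
  have hcs : HasCompactSupport φ :=
    HasCompactSupport.of_support_subset_isCompact (isCompact_closedBall z l)
      ((subset_tsupport φ).trans (hsφ.trans Metric.ball_subset_closedBall))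
  have φ0 : ∀ x ∉ Metric.ball z l, φ x = 0 := fun x hx =>
    image_eq_zero_of_notMem_tsupport fun h => hx (hsφ h)
  obtain ⟨g', hg', hgg⟩ := hc.exists_lipschitz_extension hw
  have e := straightened_eq_comp (κ := κ) K0 hg' hgg φ0
  rw [← hφ'] at e
  set T := straightening κ g' K0 hg'
  have e' : φ' = fun y => φ (T.invFun y) := funext e
  have c1 : ContDiff ℝ 1 φ' := e' ▸ hc.contDiff_straightened hw K0 hg' hgg hφ hsφ
  have s1 : HasCompactSupport φ' := e' ▸ T.hasCompactSupport_comp hcs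
  have ho' : IsOpen (halfSpace n) := isOpen_lt continuous_const continuous_vert
  have hmap : ∀ x ∈ Metric.ball z l, x ∈ Ω ↔ T.toFun x ∈ halfSpace n := fun x hx =>
    hc.mem_iff_straightening K0 hg' hgg hx
  have eφ : ∀ x', φ' (pt x' 0) = φ (graphMap κ g' x') := fun x' => by
    rw [e]
    change φ (κ.symm (pt _ _)) = _
    simp [graphMap]
  obtain ⟨b1, b2, b3⟩ := setIntegral_range_graphMap (κ := κ) hg' (f := fun x => φ x ^ 2)
    (hφ.continuous.pow 2) (hcs.comp_left (g := fun t : ℝ => t ^ 2) (by simp))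
    fun x => sq_nonneg _
  have ind := hc.indicator_frontier hgg (f := fun x => φ x ^ 2) fun x hx => by
    rw [φ0 x hx]; ring
  have mF : MeasurableSet (frontier Ω) := isClosed_frontier.measurableSet
  have mR : MeasurableSet (Set.range (graphMap κ g')) :=
    (isClosedEmbedding_graphMap hg').isClosed_range.measurableSet
  rw [← integrable_indicator_iff mR, ← ind, integrable_indicator_iff mF] at b1
  rw [← integral_indicator mR, ← ind, integral_indicator mF] at b2 b3
  simp only [eφ]
  refine ⟨⟨c1, s1⟩, ?_, ?_, b1, sub_nonneg.2 b2, ?_⟩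
  · intro μ h hμ hh
    obtain ⟨N, hN⟩ := exists_isNegPart_localForm Ω hφ.continuous hcs hμ hh
    obtain ⟨N', hN'⟩ := exists_isNegPart_localForm (halfSpace n) c1.continuous s1 hμ hh
    obtain ⟨t, ht⟩ := exists_hasTrace_localForm hφ.continuous hcs hμ hh hN
    obtain ⟨t', ht'⟩ := exists_hasTrace_localForm c1.continuous s1 hμ hh hN'
    refine ⟨N, N', t, t', hN, ht, hN', ht', ?_⟩
    have hε := one_sub_inv_pow_le K0 K1 (n + 1 + 2)
    have hε' : ((n + 1 + 2 : ℕ) : ℝ) * (2 * w l) = 2 * (n + 3) * w l := by push_cast; ring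
    rw [hε'] at hε
    refine (T.abs_trace_sub_trace_le hΩo ho' Metric.isOpen_ball (by linarith) hmap hφ.continuous
      hcs hsφ e hμ hh hN ht hN' ht' (by linarith)).trans ?_
    have i1 := integral_sq_le l0 φ0 hM
    have i0 : 0 ≤ ∫ x, φ x ^ 2 := integral_nonneg fun x => sq_nonneg _
    have P0 : 0 ≤ (1 + μ) ^ (((n : ℝ) + 1) / 2) / h ^ (n + 1) := by positivity
    push_cast
    calc _ ≤ 2 * (n + 3) * w l * (2 * (M ^ 2 * (V₁ * l ^ (n + 1))) *
          (V₂ * ((1 + μ) ^ (((n : ℝ) + 1) / 2) / h ^ (n + 1)))) := by gcongr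
      _ = 4 * (n + 3) * V₁ * V₂ * (M ^ 2 * w l * l ^ (n + 1) *
          ((1 + μ) ^ (((n : ℝ) + 1) / 2) / h ^ (n + 1))) := by ring
      _ ≤ (4 * (n + 3) * V₁ * V₂ + 2 ^ n * 4 * V₃ + 1) * (M ^ 2 * w l * l ^ (n + 1) *
          ((1 + μ) ^ (((n : ℝ) + 1) / 2) / h ^ (n + 1))) := by
        gcongr
        nlinarith [mul_nonneg (pow_nonneg (zero_le_two (α := ℝ)) n) hV₃]
      _ = _ := by ring
  · simp only [e']
    exact T.setIntegral_comp (f := fun x => φ x ^ 2) hΩo ho' hmap fun x hx => by rw [φ0 x hx]; ring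
  · have i1 : ∫ x', φ (graphMap κ g' x') ^ 2 ≤ M ^ 2 * (V₃ * l ^ n) := by
      refine integral_sq_le (z := horiz (κ z)) l0 (fun x hx => φ0 _ fun h => hx ?_)
        fun x => hM _
      rw [← projBall_eq]
      exact ⟨_, h, horiz_graphMap x⟩
    have i0 : 0 ≤ ∫ x', φ (graphMap κ g' x') ^ 2 := integral_nonneg fun x => sq_nonneg _
    have k := sqrt_one_add_sq_pow_sub_one_le K0 K1 n
    calc _ ≤ (√(1 + (2 * w l) ^ 2) ^ n - 1) * ∫ x', φ (graphMap κ g' x') ^ 2 := by linarith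
      _ ≤ 2 ^ n * (2 * w l) ^ 2 * (M ^ 2 * (V₃ * l ^ n)) := by gcongr
      _ = 2 ^ n * 4 * V₃ * (M ^ 2 * w l ^ 2 * l ^ n) := by ring
      _ ≤ (4 * (n + 3) * V₁ * V₂ + 2 ^ n * 4 * V₃ + 1) * (M ^ 2 * w l ^ 2 * l ^ n) := by
        gcongr
        nlinarith [mul_nonneg (mul_nonneg (show (0 : ℝ) ≤ 4 * (n + 3) by positivity) hV₁) hV₂]
      _ = _ := by ring

end Estimates

/-! ### Level sets as graphs -/

section Graph

/-- A continuous function has a modulus of continuity on a compact set. -/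
theorem exists_isModulus {X Y : Type*} [NormedAddCommGroup X] [NormedAddCommGroup Y] {s : Set X}
    (hs : IsCompact s) {f : X → Y} (hf : Continuous f) :
    ∃ w : ℝ → ℝ, IsModulus w ∧ ∀ x ∈ s, ∀ y ∈ s, ‖f x - f y‖ ≤ w ‖x - y‖ := by
  obtain ⟨C, hC⟩ := hs.exists_bound_of_continuousOn hf.continuousOn
  set A : ℝ → Set ℝ := fun t => {a | ∃ x ∈ s, ∃ y ∈ s, ‖x - y‖ ≤ t ∧ a = ‖f x - f y‖}
  have bdd : ∀ t, BddAbove (A t) := fun t => ⟨C + C, by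
    rintro _ ⟨x, hx, y, hy, -, rfl⟩
    exact (norm_sub_le _ _).trans (add_le_add (hC x hx) (hC y hy))⟩
  have nonneg : ∀ t, 0 ≤ sSup (A t) := fun t => Real.sSup_nonneg (by
    rintro _ ⟨x, hx, y, hy, -, rfl⟩
    exact norm_nonneg _)
  refine ⟨fun t => sSup (A t), ⟨fun t _ => nonneg t, fun t _ t' _ h => ?_, ?_⟩, fun x hx y hy =>
    le_csSup (bdd _) ⟨x, hx, y, hy, le_rfl, rfl⟩⟩
  · refine Real.sSup_le ?_ (nonneg t')
    rintro _ ⟨x, hx, y, hy, hxy, rfl⟩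
    exact le_csSup (bdd t') ⟨x, hx, y, hy, hxy.trans h, rfl⟩
  · refine Metric.tendsto_nhdsWithin_nhds.2 fun ε hε => ?_
    obtain ⟨δ, hδ, h⟩ := Metric.uniformContinuousOn_iff.1
      (hs.uniformContinuousOn_of_continuous hf.continuousOn) (ε / 2) (by positivity)
    refine ⟨δ, hδ, fun t t0 ht => ?_⟩
    rw [Real.dist_eq, sub_zero] at ht ⊢
    rw [abs_of_nonneg (nonneg t)]
    refine lt_of_le_of_lt (Real.sSup_le ?_ (by positivity)) (half_lt_self hε)
    rintro _ ⟨x, hx, y, hy, hxy, rfl⟩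
    rw [← dist_eq_norm] at hxy ⊢
    exact (h x hx y hy (hxy.trans_lt ((le_abs_self t).trans_lt ht))).le

variable {n : ℕ}

theorem norm_pt_le (x : E n) (s : ℝ) : ‖pt x s‖ ≤ ‖x‖ + |s| := by
  refine le_of_sq_le_sq ?_ (by positivity)
  rw [norm_pt_sq, ← sq_abs s]
  nlinarith [mul_nonneg (norm_nonneg x) (abs_nonneg s)]

/-- The derivative of an implicitly defined function: if `F(x', g(x')) = 0` near `x` for a Lipschitz
function `g`, then `∇g = -∂'F / ∂_d F`. -/
theorem hasFDerivAt_of_implicit {F : E (n + 1) → ℝ} {g : E n → ℝ} {x : E n} {K : ℝ}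
    {F' : E (n + 1) →L[ℝ] ℝ} (hF : HasFDerivAt F F' (pt x (g x)))
    (hb : F' (pt 0 1) ≠ 0) (h0 : ∀ᶠ y in 𝓝 x, F (pt y (g y)) = 0)
    (hg : ∀ᶠ y in 𝓝 x, |g y - g x| ≤ K * ‖y - x‖) :
    HasFDerivAt g (-(F' (pt 0 1))⁻¹ •
      F'.comp ((ptL n).comp (ContinuousLinearMap.inl ℝ (E n) ℝ))) x := by
  have hG : (fun y => pt y (g y) - pt x (g x)) =O[𝓝 x] fun y => y - x := by
    refine Asymptotics.IsBigO.of_bound (1 + K) ?_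
    filter_upwards [hg] with y hy
    rw [pt_sub, add_mul, one_mul]
    exact (norm_pt_le _ _).trans (add_le_add le_rfl hy)
  have hGt : Tendsto (fun y => pt y (g y)) (𝓝 x) (𝓝 (pt x (g x))) := by
    rw [tendsto_iff_norm_sub_tendsto_zero]
    have : Tendsto (fun y => y - x) (𝓝 x) (𝓝 0) := by
      simpa using (by fun_prop : Continuous fun y : E n => y - x).tendsto x
    simpa using (hG.trans_tendsto this).norm
  have h1 := (hF.isLittleO.comp_tendsto hGt).trans_isBigO hG
  have h2 := h1.const_mul_left (-(F' (pt 0 1))⁻¹)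
  refine .of_isLittleO (h2.congr' ?_ .rfl)
  filter_upwards [h0] with y hy
  have hx := h0.self_of_nhds
  have e : pt y (g y) - pt x (g x) = pt (y - x) 0 + (g y - g x) • pt 0 1 := by
    rw [pt_sub]
    ext i; refine Fin.lastCases ?_ (fun j => ?_) i <;> simp [pt]
  simp only [Function.comp_apply, hy, hx, e, map_add, map_smul, smul_eq_mul,
    FunLike.coe_smul, Pi.smul_apply, ContinuousLinearMap.comp_apply, ContinuousLinearMap.inl_apply,
    ptL_apply]
  field_simp
  ring

/-- A quantitative implicit function theorem: where `∇F` is close to `a e_d` with `a ≥ 1`, the zero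
set of `F` is the graph of a function `g` whose gradient inherits the modulus of continuity of
`∇F`. -/
theorem exists_graph {F : E (n + 1) → ℝ} (hF : ContDiff ℝ 1 F) (F0 : F 0 = 0) {a l : ℝ}
    (ha : 1 ≤ a) (hl : 0 < l) (hFa : fderiv ℝ F 0 = a • vertL n) {w : ℝ → ℝ} (hw : IsModulus w)
    (hFw : ∀ x ∈ Metric.closedBall (0 : E (n + 1)) (4 * l), ∀ y ∈ Metric.closedBall 0 (4 * l),
      ‖fderiv ℝ F x - fderiv ℝ F y‖ ≤ w ‖x - y‖) (hwl : w (4 * l) ≤ 1 / 4) :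
    ∃ g : E n → ℝ, g 0 = 0 ∧ fderiv ℝ g 0 = 0 ∧ DifferentiableOn ℝ g (Metric.ball 0 (2 * l)) ∧
      (∀ x ∈ Metric.ball (0 : E n) (2 * l), ∀ y ∈ Metric.ball 0 (2 * l),
        ‖fderiv ℝ g x - fderiv ℝ g y‖ ≤ 2 * w (2 * ‖x - y‖)) ∧
      ∀ y, ‖y‖ < 2 * l → (0 < F y ↔ g (horiz y) < vert y) ∧ (F y = 0 ↔ vert y = g (horiz y)) := by
  have hFd : Differentiable ℝ F := hF.differentiable one_ne_zero
  have hA : ∀ x ∈ Metric.closedBall (0 : E (n + 1)) (4 * l),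
      ‖fderiv ℝ F x - a • vertL n‖ ≤ 1 / 4 := by
    intro x hx
    rw [← hFa]
    refine (hFw x hx 0 (Metric.mem_closedBall_self (by positivity))).trans (le_trans ?_ hwl)
    rw [mem_closedBall_zero_iff] at hx
    rw [sub_zero]
    exact hw.mono (norm_nonneg _) (by simp; positivity) hx
  -- `F` differs from the linear function `a x_d` by a function with Lipschitz constant `1/4`
  have key : ∀ x ∈ Metric.closedBall (0 : E (n + 1)) (4 * l), ∀ y ∈ Metric.closedBall 0 (4 * l),
      |F y - F x - a * vert (y - x)| ≤ 1 / 4 * ‖y - x‖ := fun x hx y hy =>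
    (convex_closedBall _ _).norm_image_sub_le_of_norm_fderiv_le' (𝕜 := ℝ) (φ := a • vertL n)
      (fun z _ => hFd z) hA hx hy
  have mem4 : ∀ (x : E n) (s : ℝ), ‖x‖ < 2 * l → |s| ≤ 2 * l →
      pt x s ∈ Metric.closedBall (0 : E (n + 1)) (4 * l) := fun x s hx hs => by
    rw [mem_closedBall_zero_iff]
    linarith [norm_pt_le x s]
  have mono : ∀ (x : E n) (s t : ℝ), ‖x‖ < 2 * l → |s| ≤ 2 * l → |t| ≤ 2 * l → s < t →
      F (pt x s) < F (pt x t) := fun x s t hx hs ht hst => by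
    have := key _ (mem4 x s hx hs) _ (mem4 x t hx ht)
    rw [pt_sub, sub_self, vert_pt, norm_pt_zero, abs_of_pos (sub_pos.2 hst)] at this
    nlinarith [(abs_le.1 this).1]
  have ex : ∀ x : E n, ∃ s, ‖x‖ < 2 * l → |s| ≤ 2 * l ∧ F (pt x s) = 0 := by
    intro x
    by_cases hx : ‖x‖ < 2 * l
    swap
    · exact ⟨0, fun h => absurd h hx⟩
    have l2 : |2 * l| = 2 * l := abs_of_pos (by positivity)
    have b0 : (0 : E (n + 1)) ∈ Metric.closedBall 0 (4 * l) :=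
      Metric.mem_closedBall_self (by positivity)
    have k1 := key 0 b0 _ (mem4 x (2 * l) hx l2.le)
    have k2 := key 0 b0 _ (mem4 x (-(2 * l)) hx (by rw [abs_neg, l2]))
    have n1 := norm_pt_le x (2 * l)
    have n2 := norm_pt_le x (-(2 * l))
    rw [abs_neg, l2] at n2
    rw [l2] at n1
    rw [F0, sub_zero, sub_zero, vert_pt] at k1 k2
    have hc : ContinuousOn (fun s => F (pt x s)) (Set.Icc (-(2 * l)) (2 * l)) :=
      (hF.continuous.comp (by fun_prop)).continuousOn
    obtain ⟨s, hs, hs0⟩ := intermediate_value_Icc (by linarith) hc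
      (show (0 : ℝ) ∈ Set.Icc _ _ from ⟨by nlinarith [(abs_le.1 k2).2], by
        nlinarith [(abs_le.1 k1).1]⟩)
    exact ⟨s, fun _ => ⟨abs_le.2 hs, hs0⟩⟩
  choose g hg using ex
  have main : ∀ y : E (n + 1), ‖y‖ < 2 * l →
      (0 < F y ↔ g (horiz y) < vert y) ∧ (F y = 0 ↔ vert y = g (horiz y)) := by
    intro y hy
    have hx := (norm_horiz_le y).trans_lt hy
    have hv := ((abs_vert_le y).trans hy.le)
    obtain ⟨h1, h2⟩ := hg _ hx
    have m1 := mono (horiz y) (g (horiz y)) (vert y) hx h1 hv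
    have m2 := mono (horiz y) (vert y) (g (horiz y)) hx hv h1
    rw [pt_horiz_vert, h2] at m1 m2
    have m3 : vert y = g (horiz y) → F y = 0 := fun h => by rw [← h2, ← h, pt_horiz_vert]
    rcases lt_trichotomy (vert y) (g (horiz y)) with h | h | h
    · exact ⟨⟨fun h' => absurd h' (m2 h).not_gt, fun h' => absurd h' h.not_gt⟩,
        ⟨fun h' => absurd h' (m2 h).ne, fun h' => absurd h' h.ne⟩⟩
    · exact ⟨⟨fun h' => absurd h' (m3 h).not_gt, fun h' => absurd h' h.not_gt⟩,
        ⟨fun _ => h, m3⟩⟩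
    · exact ⟨⟨fun _ => h, fun _ => m1 h⟩,
        ⟨fun h' => absurd h' (m1 h).ne', fun h' => absurd h' h.ne'⟩⟩
  -- `|g(y) - g(x)| ≤ |y - x| / 3` holds, but the constant `1` suffices
  have lip : ∀ x y : E n, ‖x‖ < 2 * l → ‖y‖ < 2 * l → |g y - g x| ≤ 1 * ‖y - x‖ := by
    intro x y hx hy
    have := key _ (mem4 x _ hx (hg x hx).1) _ (mem4 y _ hy (hg y hy).1)
    rw [(hg x hx).2, (hg y hy).2, pt_sub, vert_pt, sub_self, zero_sub, abs_neg, abs_mul,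
      abs_of_pos (by linarith : 0 < a)] at this
    have n1 := norm_pt_le (y - x) (g y - g x)
    nlinarith [abs_nonneg (g y - g x), norm_nonneg (y - x)]
  have gmem : ∀ x : E n, x ∈ Metric.ball (0 : E n) (2 * l) →
      pt x (g x) ∈ Metric.closedBall (0 : E (n + 1)) (4 * l) := fun x hx => by
    rw [mem_ball_zero_iff] at hx
    exact mem4 x _ hx (hg x hx).1
  have e1 : ‖pt (0 : E n) 1‖ = 1 := by rw [norm_pt_zero, abs_one]
  have hb : ∀ x ∈ Metric.ball (0 : E n) (2 * l), 3 / 4 ≤ fderiv ℝ F (pt x (g x)) (pt 0 1) := by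
    intro x hx
    have := (fderiv ℝ F (pt x (g x)) - a • vertL n).le_of_opNorm_le (hA _ (gmem x hx)) (pt 0 1)
    rw [e1, Real.norm_eq_abs] at this
    have := (abs_le.1 this).1
    simp at this
    linarith
  set ι : E n →L[ℝ] E (n + 1) := (ptL n).comp (ContinuousLinearMap.inl ℝ (E n) ℝ) with hι
  have ιa : ∀ v, ι v = pt v 0 := fun v => rfl
  have ιn : ‖ι‖ ≤ 1 := ι.opNorm_le_bound zero_le_one fun v => by
    rw [ιa, one_mul]; simpa using norm_pt_le v 0
  have vι : (vertL n).comp ι = 0 := by ext v; simp [ιa]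
  have hd : ∀ x ∈ Metric.ball (0 : E n) (2 * l), HasFDerivAt g
      (-(fderiv ℝ F (pt x (g x)) (pt 0 1))⁻¹ • (fderiv ℝ F (pt x (g x))).comp ι) x := by
    intro x hx
    have nb : ∀ᶠ y in 𝓝 x, ‖y‖ < 2 * l := by
      filter_upwards [Metric.isOpen_ball.mem_nhds hx] with y hy using mem_ball_zero_iff.1 hy
    refine hasFDerivAt_of_implicit (K := 1) (hFd _).hasFDerivAt (by linarith [hb x hx]) ?_ ?_
    · filter_upwards [nb] with y hy using (hg y hy).2
    · filter_upwards [nb] with y hy using lip x y (mem_ball_zero_iff.1 hx) hy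
  have z0 : (0 : E n) ∈ Metric.ball (0 : E n) (2 * l) := Metric.mem_ball_self (by positivity)
  have g0 : g 0 = 0 := by
    have := (main 0 (by simpa using hl)).2.1 F0
    simpa using this.symm
  refine ⟨g, g0, ?_, fun x hx => (hd x hx).differentiableAt.differentiableWithinAt, ?_, main⟩
  · rw [(hd 0 z0).fderiv, g0, pt_zero_zero, hFa, ContinuousLinearMap.smul_comp, vι, smul_zero,
      smul_zero]
  · intro x hx y hy
    rw [(hd x hx).fderiv, (hd y hy).fderiv]
    set P := fderiv ℝ F (pt x (g x))
    set Q := fderiv ℝ F (pt y (g y))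
    have bP := hb x hx
    have bQ := hb y hy
    set p := P (pt 0 1)
    set q := Q (pt 0 1)
    have hPQ : ‖P - Q‖ ≤ w (2 * ‖x - y‖) := by
      refine (hFw _ (gmem x hx) _ (gmem y hy)).trans (hw.mono (norm_nonneg _) (by simp) ?_)
      rw [pt_sub]
      have := lip y x (mem_ball_zero_iff.1 hy) (mem_ball_zero_iff.1 hx)
      linarith [norm_pt_le (x - y) (g x - g y)]
    have hpq : |p - q| ≤ w (2 * ‖x - y‖) := by
      have := (P - Q).le_of_opNorm_le hPQ (pt 0 1)
      rwa [e1, mul_one] at this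
    have hQ : ‖Q.comp ι‖ ≤ 1 / 4 := by
      have : Q.comp ι = (Q - a • vertL n).comp ι := by
        rw [ContinuousLinearMap.sub_comp, ContinuousLinearMap.smul_comp, vι, smul_zero, sub_zero]
      rw [this]
      refine ((Q - a • vertL n).opNorm_comp_le ι).trans ?_
      have := hA _ (gmem y hy)
      nlinarith [norm_nonneg (Q - a • vertL n)]
    have hPQι : ‖(P - Q).comp ι‖ ≤ w (2 * ‖x - y‖) := by
      refine ((P - Q).opNorm_comp_le ι).trans ?_
      nlinarith [norm_nonneg (P - Q)]
    have p0 : 0 < p := by linarith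
    have q0 : 0 < q := by linarith
    have e : -p⁻¹ • P.comp ι - -q⁻¹ • Q.comp ι =
        -p⁻¹ • (P - Q).comp ι + (p⁻¹ * q⁻¹ * (p - q)) • Q.comp ι := by
      rw [ContinuousLinearMap.sub_comp, smul_sub]
      have : p⁻¹ * q⁻¹ * (p - q) = q⁻¹ - p⁻¹ := by field_simp
      rw [this, sub_smul, neg_smul, neg_smul, neg_smul]
      abel
    rw [e]
    refine (norm_add_le _ _).trans ?_
    rw [norm_smul, norm_smul, norm_neg, norm_inv, norm_mul, norm_mul, norm_inv, norm_inv,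
      Real.norm_of_nonneg p0.le, Real.norm_of_nonneg q0.le, Real.norm_eq_abs]
    have ip : p⁻¹ ≤ 4 / 3 := by
      rw [inv_le_comm₀ p0 (by norm_num)]; linarith
    have iq : q⁻¹ ≤ 4 / 3 := by
      rw [inv_le_comm₀ q0 (by norm_num)]; linarith
    have w0 := (abs_nonneg _).trans hpq
    calc _ ≤ 4 / 3 * w (2 * ‖x - y‖) + 4 / 3 * (4 / 3) * w (2 * ‖x - y‖) * (1 / 4) := by gcongr
      _ ≤ _ := by linarith

end Graph

/-! ### Existence of boundary charts -/

section Charts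

variable {n : ℕ}

theorem hasFDerivAt_affineIsometryEquiv {d : ℕ} (κ : E d ≃ᵃⁱ[ℝ] E d) (x : E d) :
    HasFDerivAt κ (κ.linearIsometryEquiv.toContinuousLinearEquiv : E d →L[ℝ] E d) x := by
  have e : ⇑κ = fun x =>
      (κ.linearIsometryEquiv.toContinuousLinearEquiv : E d →L[ℝ] E d) x + κ 0 := by
    ext1 x
    simpa using κ.map_vadd 0 x
  rw [e]
  exact (ContinuousLinearMap.hasFDerivAt _).add_const _

theorem inner_pt_zero_one (y : E (n + 1)) : inner ℝ (pt 0 1) y = vert y := by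
  rw [PiLp.inner_apply, Fin.sum_univ_castSucc]
  simp [pt, vert]

/-- Every linear form becomes a multiple of `x_d` after a rotation. -/
theorem exists_rotation (L : E (n + 1) →L[ℝ] ℝ) :
    ∃ ρ : E (n + 1) ≃ₗᵢ[ℝ] E (n + 1), ∀ y, L (ρ.symm y) = ‖L‖ * vert y := by
  by_cases hL : L = 0
  · exact ⟨.refl ℝ _, fun y => by simp [hL]⟩
  have L0 : ‖L‖ ≠ 0 := norm_ne_zero_iff.2 hL
  set N := (InnerProductSpace.toDual ℝ (E (n + 1))).symm L
  have hN : ∀ y, inner ℝ N y = L y := fun y => InnerProductSpace.toDual_symm_apply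
  have nN : ‖N‖ = ‖L‖ := LinearIsometryEquiv.norm_map _ _
  set v := ‖L‖⁻¹ • N
  have nv : ‖v‖ = ‖(pt 0 1 : E (n + 1))‖ := by
    rw [norm_pt_zero, abs_one, norm_smul, nN, norm_inv, norm_norm, inv_mul_cancel₀ L0]
  refine ⟨(ℝ ∙ (v - pt 0 1))ᗮ.reflection, fun y => ?_⟩
  have hv := Submodule.reflection_sub nv
  have Nv : N = ‖L‖ • v := by rw [smul_inv_smul₀ L0]
  rw [← hN, ← LinearIsometryEquiv.inner_map_eq_flip, Nv, map_smul, hv, inner_smul_left,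
    inner_pt_zero_one]
  simp

theorem eq_zero_of_mem_frontier {d : ℕ} {Ω U : Set (E d)} (hΩ : IsOpen Ω) (hU : IsOpen U)
    {f : E d → ℝ} (hf : Continuous f) (hfΩ : ∀ x ∈ U, x ∈ Ω ↔ 0 < f x) {x : E d} (hx : x ∈ U)
    (hxΩ : x ∈ frontier Ω) : f x = 0 := by
  rw [hΩ.frontier_eq] at hxΩ
  refine le_antisymm (not_lt.1 (mt (hfΩ x hx).2 hxΩ.2)) (not_lt.1 fun h => ?_)
  obtain ⟨y, ⟨hy, hyU⟩, hyΩ⟩ := mem_closure_iff.1 hxΩ.1 _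
    ((isOpen_lt hf continuous_const).inter hU) ⟨h, hx⟩
  exact ((hfΩ y hyU).1 hyΩ).not_gt hy

theorem IsModulus.scale {w : ℝ → ℝ} (hw : IsModulus w) : IsModulus fun t => 2 * w (2 * t) where
  nonneg t ht := mul_nonneg zero_le_two (hw.nonneg _ (by positivity))
  mono s hs t ht h := by
    simp only [Set.mem_Ici] at hs ht
    have := hw.mono (show (0 : ℝ) ≤ 2 * s by positivity) (show (0 : ℝ) ≤ 2 * t by positivity)
      (show 2 * s ≤ 2 * t by linarith)
    dsimp only
    linarith
  tendsto_zero := by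
    have h : Tendsto (fun t : ℝ => 2 * t) (𝓝[>] 0) (𝓝[>] 0) := by
      refine tendsto_nhdsWithin_iff.2 ⟨?_, ?_⟩
      · have : Tendsto (fun t : ℝ => 2 * t) (𝓝 0) (𝓝 (2 * 0)) :=
          (continuous_const.mul continuous_id).tendsto 0
        rw [mul_zero] at this
        exact this.mono_left nhdsWithin_le_nhds
      · filter_upwards [self_mem_nhdsWithin] with t ht
        exact mul_pos two_pos (Set.mem_Ioi.1 ht)
    simpa using (hw.tendsto_zero.comp h).const_mul 2

theorem IsModulus.sum {ι : Type*} {s : Finset ι} {w : ι → ℝ → ℝ}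
    (hw : ∀ i ∈ s, IsModulus (w i)) : IsModulus fun t => ∑ i ∈ s, w i t where
  nonneg t ht := Finset.sum_nonneg fun i hi => (hw i hi).nonneg t ht
  mono t ht t' ht' h := Finset.sum_le_sum fun i hi => (hw i hi).mono ht ht' h
  tendsto_zero := by
    simpa using tendsto_finsetSum s fun i hi => (hw i hi).tendsto_zero

theorem IsBoundaryChart.mono {Ω : Set (E (n + 1))} {w w' : ℝ → ℝ} {z p : E (n + 1)} {l : ℝ}
    {κ : E (n + 1) ≃ᵃⁱ[ℝ] E (n + 1)} {g : E n → ℝ} (hc : IsBoundaryChart Ω w z l p κ g)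
    (hw : ∀ t, 0 ≤ t → w t ≤ w' t) : IsBoundaryChart Ω w' z l p κ g :=
  { hc with modulus := fun x hx y hy => (hc.modulus x hx y hy).trans (hw _ (norm_nonneg _)) }

/-- A boundary chart at `p` for a domain given near `p` by `f > 0`. -/
theorem exists_isBoundaryChart {Ω : Set (E (n + 1))} (hΩ : IsOpen Ω) {f : E (n + 1) → ℝ}
    (hf : ContDiff ℝ 1 f) {p z : E (n + 1)} {l : ℝ} (hl : 0 < l)
    (hfΩ : ∀ x ∈ Metric.ball p (2 * l), x ∈ Ω ↔ 0 < f x) (hp : p ∈ frontier Ω)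
    (hfp : 1 ≤ ‖fderiv ℝ f p‖) {w : ℝ → ℝ} (hw : IsModulus w)
    (hfw : ∀ x ∈ Metric.closedBall p (4 * l), ∀ y ∈ Metric.closedBall p (4 * l),
      ‖fderiv ℝ f x - fderiv ℝ f y‖ ≤ w ‖x - y‖) (hwl : w (4 * l) ≤ 1 / 4)
    (hpz : p ∈ Metric.ball z l) :
    ∃ κ g, IsBoundaryChart Ω (fun t => 2 * w (2 * t)) z l p κ g := by
  obtain ⟨ρ, hρ⟩ := exists_rotation (fderiv ℝ f p)
  set κ : E (n + 1) ≃ᵃⁱ[ℝ] E (n + 1) :=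
    (AffineIsometryEquiv.vaddConst ℝ p).symm.trans ρ.toAffineIsometryEquiv with hκ
  have κs : ∀ y, κ.symm y = ρ.symm y + p := fun y => rfl
  have κp : κ p = 0 := by simp [hκ]
  have κn : ∀ x, ‖κ x‖ = ‖x - p‖ := fun x => by rw [← norm_map_sub κ, κp, sub_zero]
  set A : E (n + 1) →L[ℝ] E (n + 1) :=
    (ρ.symm.toContinuousLinearEquiv : E (n + 1) →L[ℝ] E (n + 1))
  have An : ‖A‖ ≤ 1 := A.opNorm_le_bound zero_le_one fun y => by
    rw [one_mul]; exact (ρ.symm.norm_map y).le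
  have κd : ∀ y, HasFDerivAt κ.symm A y := fun y => A.hasFDerivAt.add_const p
  set F : E (n + 1) → ℝ := fun y => f (κ.symm y) with hFdef
  have hF : ContDiff ℝ 1 F := hf.comp κ.symm.toAffineIsometry.toContinuousAffineMap.contDiff
  have hFd : ∀ y, fderiv ℝ F y = (fderiv ℝ f (κ.symm y)).comp A := fun y =>
    ((hf.differentiable one_ne_zero _).hasFDerivAt.comp y (κd y)).fderiv
  have κ0 : κ.symm 0 = p := by rw [← κp, κ.symm_apply_apply]
  have fp : f p = 0 := eq_zero_of_mem_frontier hΩ Metric.isOpen_ball hf.continuous hfΩ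
    (Metric.mem_ball_self (by positivity)) hp
  obtain ⟨g, g0, g1, g2, g3, g4⟩ := exists_graph (F := F) (a := ‖fderiv ℝ f p‖) hF
    (by rw [hFdef]; simp only [κ0, fp]) hfp hl (by
      ext y
      rw [hFd, κ0]
      exact hρ y) hw (fun x hx y hy => by
      rw [hFd, hFd, ← ContinuousLinearMap.sub_comp]
      refine (ContinuousLinearMap.opNorm_comp_le _ _).trans ?_
      have mem : ∀ {x}, x ∈ Metric.closedBall (0 : E (n + 1)) (4 * l) →
          κ.symm x ∈ Metric.closedBall p (4 * l) := fun {x} hx => by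
        rw [mem_closedBall_zero_iff] at hx
        rwa [mem_closedBall_iff_norm, ← κn, κ.apply_symm_apply]
      have := hfw _ (mem hx) _ (mem hy)
      rw [norm_map_sub κ.symm] at this
      nlinarith [norm_nonneg (fderiv ℝ f (κ.symm x) - fderiv ℝ f (κ.symm y))]) hwl
  have hball : ∀ x ∈ Metric.ball z l, ‖x - p‖ < 2 * l := fun x hx => by
    rw [← dist_eq_norm]
    calc dist x p ≤ dist x z + dist p z := dist_triangle_right _ _ _
      _ < 2 * l := by rw [two_mul]; exact add_lt_add hx hpz
  have hD : projBall κ z l ⊆ Metric.ball 0 (2 * l) := by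
    rintro _ ⟨x, hx, rfl⟩
    rw [mem_ball_zero_iff]
    exact ((norm_horiz_le _).trans (κn x).le).trans_lt (hball x hx)
  have hFκ : ∀ x, F (κ x) = f x := fun x => by simp [hFdef]
  have hmem : ∀ x, ‖x - p‖ < 2 * l → (x ∈ Ω ↔ g (horiz (κ x)) < vert (κ x)) := fun x hx => by
    rw [hfΩ x (mem_ball_iff_norm.2 hx), ← hFκ, (g4 (κ x) (by rwa [κn])).1]
  refine ⟨κ, g, hpz, hp, κp, g2.mono hD, g0, g1,
    fun x hx y hy => g3 x (hD hx) y (hD hy), fun x hx => ?_, fun x hx => hmem x (hball x hx)⟩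
  have hx2 := hball x hx
  rw [← (g4 (κ x) (by rw [κn]; exact hx2)).2, hFκ]
  constructor
  · exact eq_zero_of_mem_frontier hΩ Metric.isOpen_ball hf.continuous hfΩ (mem_ball_iff_norm.2 hx2)
  · intro h
    rw [hΩ.frontier_eq]
    refine ⟨?_, fun h' => ?_⟩
    swap
    · rw [hfΩ x (mem_ball_iff_norm.2 hx2), h] at h'
      exact lt_irrefl _ h'
    -- the points above `x` belong to `Ω`
    have hg := (g4 (κ x) (by rw [κn]; exact hx2)).2.1 (by rw [hFκ, h])
    have lim : Tendsto (fun s => κ.symm (pt (horiz (κ x)) (vert (κ x) + s))) (𝓝 0) (𝓝 x) := by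
      have : Continuous fun s => κ.symm (pt (horiz (κ x)) (vert (κ x) + s)) :=
        κ.symm.continuous.comp (by fun_prop)
      simpa using this.tendsto 0
    have nb : ∀ᶠ s in 𝓝 (0 : ℝ), ‖κ.symm (pt (horiz (κ x)) (vert (κ x) + s)) - p‖ < 2 * l :=
      (lim.sub_const p).norm.eventually (gt_mem_nhds hx2)
    refine mem_closure_of_tendsto (lim.mono_left (nhdsWithin_le_nhds (s := Set.Ioi 0))) ?_
    filter_upwards [nhdsWithin_le_nhds nb, self_mem_nhdsWithin] with s hs hs0
    rw [hmem _ hs]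
    simp only [κ.apply_symm_apply, horiz_pt, vert_pt]
    rw [← hg]
    exact lt_add_of_pos_right _ hs0

/-- Charts for all boundary points near `q`, with a common modulus. -/
theorem exists_isBoundaryChart_of_graph {Ω : Set (E (n + 1))} (hΩ : IsOpen Ω) {q : E (n + 1)}
    (h : ∃ (κ : E (n + 1) ≃ᵃⁱ[ℝ] E (n + 1)) (γ : E n → ℝ) (r : ℝ),
      ContDiff ℝ 1 γ ∧ 0 < r ∧ ∀ x ∈ Metric.ball q r, (x ∈ Ω ↔ γ (horiz (κ x)) < vert (κ x))) :
    ∃ r > 0, ∃ w, IsModulus w ∧ ∃ c > 0, ∀ p ∈ frontier Ω ∩ Metric.ball q r, ∀ z l, 0 < l → l ≤ c →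
      p ∈ Metric.ball z l → ∃ κ g, IsBoundaryChart Ω w z l p κ g := by
  obtain ⟨κ, γ, r, hγ, hr, hΩr⟩ := h
  set f : E (n + 1) → ℝ := fun x => vertL n (κ x) - γ (horizL n (κ x)) with hfdef
  have κc : ContDiff ℝ 1 κ := κ.toAffineIsometry.toContinuousAffineMap.contDiff
  have hf : ContDiff ℝ 1 f :=
    ((vertL n).contDiff.comp κc).sub (hγ.comp ((horizL n).contDiff.comp κc))
  -- the derivative of `f` in the vertical direction of the coordinates `κ` is `1`
  have hfp : ∀ p, 1 ≤ ‖fderiv ℝ f p‖ := by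
    intro p
    have hd := ((vertL n).hasFDerivAt.comp p (hasFDerivAt_affineIsometryEquiv κ p)).sub
      ((hγ.differentiable one_ne_zero _).hasFDerivAt.comp p
        ((horizL n).hasFDerivAt.comp p (hasFDerivAt_affineIsometryEquiv κ p)))
    have e : fderiv ℝ f p (κ.linearIsometryEquiv.symm (pt 0 1)) = 1 := by
      rw [HasFDerivAt.fderiv (f := f) hd]
      simp
    have := (fderiv ℝ f p).le_opNorm (κ.linearIsometryEquiv.symm (pt 0 1))
    rwa [e, LinearIsometryEquiv.norm_map, norm_pt_zero, abs_one, mul_one, norm_one] at this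
  obtain ⟨w, hw, hfw⟩ := exists_isModulus (isCompact_closedBall q (r / 2 + 1))
    (hf.continuous_fderiv one_ne_zero)
  obtain ⟨δ, hδ, hwδ⟩ := Metric.tendsto_nhdsWithin_nhds.1 hw.tendsto_zero (1 / 4) (by norm_num)
  refine ⟨r / 2, by positivity, _, hw.scale, min (1 / 4) (min (δ / 8) (r / 4)), by positivity, ?_⟩
  rintro p ⟨hp, hpq⟩ z l l0 hl hpz
  rw [le_min_iff, le_min_iff] at hl
  obtain ⟨l1, l2, l3⟩ := hl
  rw [Metric.mem_ball] at hpq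
  have sub : Metric.closedBall p (4 * l) ⊆ Metric.closedBall q (r / 2 + 1) :=
    Metric.closedBall_subset_closedBall' (by linarith)
  refine exists_isBoundaryChart hΩ hf l0 (fun x hx => ?_) hp (hfp p) hw
    (fun x hx y hy => hfw x (sub hx) y (sub hy)) ?_ hpz
  · rw [hΩr x (Metric.ball_subset_ball' (by linarith) hx), hfdef]
    exact sub_pos.symm
  · have := hwδ (x := 4 * l) (show 0 < 4 * l by positivity) (by
      rw [Real.dist_eq, sub_zero, abs_of_pos (by positivity)]; linarith)
    rw [Real.dist_eq, sub_zero] at this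
    exact (le_abs_self _).trans this.le

theorem exists_boundaryCharts {Ω : Set (E (n + 1))} (hΩo : IsOpen Ω)
    (hΩb : Bornology.IsBounded Ω) (hΩ : HasC1Boundary Ω) :
    ∃ w : ℝ → ℝ, IsModulus w ∧ ∃ c : ℝ, 0 < c ∧
      ∀ (z : E (n + 1)) (l : ℝ), 0 < l → l ≤ c →
        ∀ p ∈ Metric.ball z l ∩ frontier Ω, ∃ κ g, IsBoundaryChart Ω w z l p κ g := by
  have hK : IsCompact (frontier Ω) :=
    hΩb.isCompact_closure.of_isClosed_subset isClosed_frontier frontier_subset_closure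
  have hq := fun q : frontier Ω => exists_isBoundaryChart_of_graph hΩo (hΩ q q.2)
  choose r hr w hw c hc hch using hq
  obtain ⟨t, ht⟩ := hK.elim_nhds_subcover' (fun q hq => Metric.ball q (r ⟨q, hq⟩))
    fun q hq => Metric.ball_mem_nhds q (hr _)
  obtain ⟨c', hc', hc0⟩ : ∃ c' : ℝ, (∀ q ∈ t, c' ≤ c q) ∧ 0 < c' := by
    have h1 : ∀ᶠ c' : ℝ in 𝓝[>] 0, ∀ q ∈ t, c' ≤ c q := by
      rw [Filter.eventually_all_finset]
      exact fun q _ => nhdsWithin_le_nhds (Iic_mem_nhds (hc q))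
    exact (h1.and self_mem_nhdsWithin).exists
  refine ⟨_, IsModulus.sum fun q (_ : q ∈ t) => hw q, c', hc0, ?_⟩
  rintro z l l0 hl p ⟨hpz, hp⟩
  obtain ⟨q, hqt, hpq⟩ := Set.mem_iUnion₂.1 (ht hp)
  obtain ⟨κ, g, hκ⟩ := hch q p ⟨hp, hpq⟩ z l l0 (hl.trans (hc' q hqt)) hpz
  exact ⟨κ, g, hκ.mono fun s hs =>
    Finset.single_le_sum (f := fun q => w q s) (fun q _ => (hw q).nonneg s hs) hqt⟩

end Charts

end PseudoRelativistic

theorem proposition3 (n : ℕ) (hn : 1 ≤ n) (Ω : Set (E (n + 1))) (hΩo : IsOpen Ω)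
    (hΩb : Bornology.IsBounded Ω) (hΩ : HasC1Boundary Ω) :
    -- existence of the boundary coordinates, with a common modulus of continuity
    (∃ w : ℝ → ℝ, IsModulus w ∧ ∃ c : ℝ, 0 < c ∧
      ∀ (z : E (n + 1)) (l : ℝ), 0 < l → l ≤ c →
        ∀ p ∈ Metric.ball z l ∩ frontier Ω, ∃ κ g, IsBoundaryChart Ω w z l p κ g) ∧
    -- the estimates, for every such modulus and every choice of coordinates
    (∀ w : ℝ → ℝ, IsModulus w → ∃ c : ℝ, 0 < c ∧ ∃ C : ℝ, 0 < C ∧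
      ∀ (z : E (n + 1)) (l : ℝ), 0 < l → l ≤ c →
      ∀ (p : E (n + 1)) (κ : E (n + 1) ≃ᵃⁱ[ℝ] E (n + 1)) (g : E n → ℝ),
        IsBoundaryChart Ω w z l p κ g →
      ∀ (φ : E (n + 1) → ℝ) (M : ℝ), ContDiff ℝ 1 φ → tsupport φ ⊆ Metric.ball z l →
        (∀ x, |φ x| ≤ M) →
      ∀ φ' : E (n + 1) → ℝ, φ' = straightened κ g (projBall κ z l) φ →
        (ContDiff ℝ 1 φ' ∧ HasCompactSupport φ') ∧
        (∀ μ h : ℝ, 0 ≤ μ → 0 < h →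
          ∃ (N N' : L2 (n + 1) →L[ℂ] L2 (n + 1)) (t t' : ℝ),
            IsNegPart (localDomain Ω φ) (localForm μ h φ) N ∧ HasTrace N t ∧
            IsNegPart (localDomain (halfSpace n) φ') (localForm μ h φ') N' ∧ HasTrace N' t' ∧
            |t - t'| ≤ C * M ^ 2 * w l * l ^ (n + 1) * (1 + μ) ^ (((n : ℝ) + 1) / 2) /
              h ^ (n + 1)) ∧
        (∫ x in Ω, φ x ^ 2) = (∫ x in halfSpace n, φ' x ^ 2) ∧
        IntegrableOn (fun x => φ x ^ 2) (frontier Ω) μHE[n] ∧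
        0 ≤ (∫ x in frontier Ω, φ x ^ 2 ∂μHE[n]) - (∫ x' : E n, φ' (pt x' 0) ^ 2) ∧
        (∫ x in frontier Ω, φ x ^ 2 ∂μHE[n]) - (∫ x' : E n, φ' (pt x' 0) ^ 2) ≤
          C * M ^ 2 * w l ^ 2 * l ^ n) :=
  ⟨exists_boundaryCharts hΩo hΩb hΩ, fun _ hw => exists_straightening_estimates hΩo hw⟩
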